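/- Lemma A1. Let $n\ge 2$. There is a constant $C>0$, depending only on $n$, such that the following holds. Let $S\subset\mathbb R^n$ be a smooth, compact hypersurface (embedded, without boundary) with positive definite second fundamental form (for a suitable choice of the unit normal at each point), and let $\sigma$ be its surface measure. Let $1<p<2$ and $0<\gamma<1$, write $B_R=B(0,R)$ and $\hat f(\xi)=\int_{\mathbb R^n} f(x)e^{-2\pi i x\cdot\xi}\,dx$, and suppose that the local estimate $$\Vert \hat f|_S\Vert_{L^1(d\sigma)}\le A\,R^\gamma\,\Vert f\Vert_{L^p(B_R)}$$ holds for all $R\ge 1$ and all $f\in L^p(\mathbb R^n)$ supported in $B_R$, with a constant $A$ independent of $R$ and $f$. Then for every exponent $p_1\ge 1$ with $$\frac1{p_1}>\frac1p+\frac{C}{\log\frac1\gamma}$$ the global estimate $$\Vert \hat f|_S\Vert_{L^1(d\sigma)}\le A_1\,\Vert f\Vert_{L^{p_1}(\mathbb R^n)}$$ holds for all $f\in L^{p_1}(\mathbb R^n)$, with a constant $A_1$ independent of $f$. Here $\hat f|_S$ is, for general $f\in L^{p_1}(\mathbb R^n)$, the limit in $L^1(d\sigma)$ of $\hat f_k|_S$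 for any sequence $f_k\in L^1\cap L^{p_1}$ converging to $f$ in $L^{p_1}$; that this limit exists and does not depend on the sequence is part of the claim. (For $\gamma$ not small the condition on $p_1$ is void, so the content is in the range $0<\gamma\ll1$.) -/

import Mathlib

open MeasureTheory Filter Topology
open scoped ENNReal ContDiff FourierTransform

noncomputable section

/-- Euclidean space `ℝⁿ`. -/
abbrev Euc (n : ℕ) : Type := EuclideanSpace ℝ (Fin n)

/-- `F` is a smooth local defining function of `S` on the open neighbourhood `U` of `x`:
`S ∩ U = {F = 0} ∩ U` and `dF ≠ 0` on `S ∩ U`. -/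
structure IsLocalDefiningFunction {n : ℕ} (S : Set (Euc n)) (x : Euc n) (U : Set (Euc n))
    (F : Euc n → ℝ) : Prop where
  isOpen : IsOpen U
  mem : x ∈ U
  smooth : ContDiffOn ℝ ∞ F U
  zero_iff : ∀ y ∈ U, y ∈ S ↔ F y = 0
  regular : ∀ y ∈ S ∩ U, fderiv ℝ F y ≠ 0

/-- The second fundamental form at `x` of the level set of `F` through `x`, with respect to the
unit normal `-∇F(x) / |∇F(x)|`, evaluated on tangent vectors `v, w ∈ ker dF(x)`. -/
def secondFundamentalForm {n : ℕ} (F : Euc n → ℝ) (x v w : Euc n) : ℝ :=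
  fderiv ℝ (fderiv ℝ F) x v w / ‖fderiv ℝ F x‖

/-- `S` is a smooth, compact hypersurface (embedded, without boundary) of `ℝⁿ` whose second
fundamental form is positive definite at every point, for a suitable choice of the unit normal.
The choice is made by the sign of the local defining function. -/
structure IsCompactPosDefHypersurface {n : ℕ} (S : Set (Euc n)) : Prop where
  isCompact : IsCompact S
  exists_defining : ∀ x ∈ S, ∃ (U : Set (Euc n)) (F : Euc n → ℝ),
    IsLocalDefiningFunction S x U F ∧
      ∀ y ∈ S ∩ U, ∀ v : Euc n, fderiv ℝ F y v = 0 → v ≠ 0 → 0 < secondFundamentalForm F y v v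

/-- The surface measure of a hypersurface `S ⊆ ℝⁿ`: the `(n-1)`-dimensional Hausdorff measure,
normalized to agree with Lebesgue measure on `ℝⁿ⁻¹`, restricted to `S`. -/
def surfaceMeasure {n : ℕ} (S : Set (Euc n)) : Measure (Euc n) :=
  (μHE[n - 1] : Measure (Euc n)).restrict S

/-- The local estimate `‖f̂|_S‖_{L¹(dσ)} ≤ A R^γ ‖f‖_{Lᵖ(B_R)}` for all `R ≥ 1` and all `f ∈ Lᵖ`
supported in `B_R = B(0, R)`, with some constant `A` independent of `R` and `f`.
Such an `f` is integrable, so that `f̂` is given by the Fourier integral. -/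
def LocalRestrictionEstimate {n : ℕ} (S : Set (Euc n)) (p γ : ℝ) : Prop :=
  ∃ A : ℝ, 0 < A ∧ ∀ R : ℝ, 1 ≤ R → ∀ f : Euc n → ℂ,
    MemLp f (ENNReal.ofReal p) volume → Function.support f ⊆ Metric.ball 0 R →
      eLpNorm (𝓕 f) 1 (surfaceMeasure S) ≤
        ENNReal.ofReal (A * R ^ γ) * eLpNorm f (ENNReal.ofReal p) volume

/-- `g ∈ L¹(S, dσ)` is the restriction `f̂|_S` of the Fourier transform of `f ∈ L^q(ℝⁿ)`:
it is the limit in `L¹(dσ)` of `f̂ₖ|_S` for every sequence `fₖ ∈ L¹ ∩ L^q` which converges to `f`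
in `L^q`. For `1 ≤ q < ∞` such a `g` is unique up to `σ`-null sets, as `L¹ ∩ L^q` is dense in `L^q`,
and it agrees `σ`-almost everywhere with the Fourier integral of `f` if `f ∈ L¹`. -/
def IsFourierRestriction {n : ℕ} (S : Set (Euc n)) (q : ℝ≥0∞) (f g : Euc n → ℂ) : Prop :=
  MemLp g 1 (surfaceMeasure S) ∧
    ∀ u : ℕ → Euc n → ℂ, (∀ k, Integrable (u k) volume) → (∀ k, MemLp (u k) q volume) →
      Tendsto (fun k => eLpNorm (u k - f) q volume) atTop (𝓝 0) →
        Tendsto (fun k => eLpNorm (𝓕 (u k) - g) 1 (surfaceMeasure S)) atTop (𝓝 0)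

/-- The global estimate `‖f̂|_S‖_{L¹(dσ)} ≤ A ‖f‖_{L^q}` for all `f ∈ L^q(ℝⁿ)`, with some constant
`A` independent of `f`; part of the claim is that `f̂|_S` is meaningful for every `f ∈ L^q(ℝⁿ)`. -/
def GlobalRestrictionEstimate {n : ℕ} (S : Set (Euc n)) (q : ℝ) : Prop :=
  ∃ A : ℝ, 0 < A ∧ ∀ f : Euc n → ℂ, MemLp f (ENNReal.ofReal q) volume →
    ∃ g : Euc n → ℂ, IsFourierRestriction S (ENNReal.ofReal q) f g ∧
      eLpNorm g 1 (surfaceMeasure S) ≤ ENNReal.ofReal A * eLpNorm f (ENNReal.ofReal q) volume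

end

/-! ### One-dimensional oscillatory integrals -/

section VanDerCorput

variable {φ φ' φ'' : ℝ → ℝ} {a b : ℝ}

/-! The local estimate survives, with the same loss R^γ, for sums of arbitrarily many pieces living
in balls of radius R, provided that the balls are extremely far apart compared with R and with their
number. Every function splits into few such sums, with radii that are a bounded power of the number
of unit cells involved. Since γ is small, such radii cost little.

Sparse sums (`sparse_restriction_estimate`). On S the transform of a piece centred at x_i is a plane
wave of frequency x_i times the transform g_i of the piece moved to the origin, and g_i varies
slowly. Because S is curved, the transform of a small cap of S decays like |x|^(-1/2), so plane
waves with widely separated frequencies are almost orthogonal on small caps. Hence the L¹ norm of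
the sum is controlled by the square function (∑ |g_i|²)^(1/2) up to a small error
(`exists_squareFunctionBound`). By Khintchine's inequality the square function is an average over
signs of the transforms of ∑ ± h_i, where all the moved pieces h_i sit in one ball B_R; there the
hypothesis applies. Finally L^p has type p for p ≤ 2, so the average of the norms ‖∑ ± h_i‖_p is at
most (∑ ‖h_i‖_p^p)^(1/p).

Masses instead of L^p norms (`exists_sparseMassEstimate`). As S is bounded, averaging a function
over a small fixed ball changes its transform on S by a factor between 1/2 and 1 in size. Thus only
the masses in unit cells matter, and local singularities, which prevent f ∈ L^p1 from being in L^p,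
are harmless.

Covering (`exists_sparse_cover`). Let N cells be given and put θ = N^(1/K). By pigeonhole each cell
has a scale k < K at which the number of neighbouring cells grows by at most a factor θ on passing
to the next scale. Cells of the same scale then split into O(θ) sparse families. The separation
needed is polynomial in N and the radius, so the radii can grow as iterated powers, and the largest
is a multiple of N^(D^K) with D depending only on n. For mass at most a per cell this gives the
bound N^s a with s = 1/p + 1/K + γ D^K (`SparseMassEstimate.level_set`).

Taking K comparable to log(1/γ) makes s at most 1/p + C / log(1/γ). Summing over dyadic levels of
cell mass converges when 1/p1 > s, and Hölder's inequality in each cell, truncation and density give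
the global estimate. -/

theorem norm_integral_exp_le_of_le_abs_deriv (hab : a ≤ b)
    (h1 : ∀ t ∈ Set.Icc a b, HasDerivAt φ (φ' t) t)
    (h2 : ∀ t ∈ Set.Icc a b, HasDerivAt φ' (φ'' t) t)
    (hc : ContinuousOn φ'' (Set.Icc a b)) (h0 : ∀ t ∈ Set.Icc a b, 0 ≤ φ'' t)
    {μ : ℝ} (hμ : 0 < μ) (hl : ∀ t ∈ Set.Icc a b, μ ≤ |φ' t|) :
    ‖∫ t in a..b, Complex.exp (φ t * Complex.I)‖ ≤ 4 / μ := by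
  have hne : ∀ t ∈ Set.Icc a b, φ' t ≠ 0 := fun t ht h => by
    have := hl t ht; rw [h, abs_zero] at this; linarith
  have hneC : ∀ t ∈ Set.Icc a b, (φ' t : ℂ) ≠ 0 := fun t ht => by exact_mod_cast hne t ht
  have cφ : ContinuousOn φ (Set.Icc a b) := fun t ht => (h1 t ht).continuousAt.continuousWithinAt
  have cφ' : ContinuousOn φ' (Set.Icc a b) := fun t ht => (h2 t ht).continuousAt.continuousWithinAt
  have ce : ContinuousOn (fun t => Complex.exp (φ t * Complex.I)) (Set.Icc a b) := by fun_prop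
  have cq : ContinuousOn (fun t => φ'' t / (φ' t) ^ 2) (Set.Icc a b) :=
    hc.div (cφ'.pow 2) fun t ht => pow_ne_zero _ (hne t ht)
  have cw : ContinuousOn (fun t => Complex.exp (φ t * Complex.I) * Complex.I *
      ((φ'' t / (φ' t) ^ 2 : ℝ) : ℂ)) (Set.Icc a b) :=
    (ce.mul continuousOn_const).mul (Complex.continuous_ofReal.comp_continuousOn cq)
  -- Integration by parts, written as the fundamental theorem for the primitive -i e^(iφ) / φ'. Its
  -- derivative is e^(iφ) plus the error term i e^(iφ) φ'' / φ'².
  have key : ∫ t in a..b, (Complex.exp (φ t * Complex.I) + Complex.exp (φ t * Complex.I) * Complex.I *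
      ((φ'' t / (φ' t) ^ 2 : ℝ) : ℂ)) =
      Complex.exp (φ b * Complex.I) * (-Complex.I) * (φ' b : ℂ)⁻¹ -
        Complex.exp (φ a * Complex.I) * (-Complex.I) * (φ' a : ℂ)⁻¹ := by
    refine intervalIntegral.integral_eq_sub_of_hasDerivAt
      (f := fun t => Complex.exp (φ t * Complex.I) * (-Complex.I) * (φ' t : ℂ)⁻¹) ?_ ?_
    · intro t ht
      rw [Set.uIcc_of_le hab] at ht
      have e1 : HasDerivAt (fun t => Complex.exp (φ t * Complex.I))
          (Complex.exp (φ t * Complex.I) * ((φ' t : ℂ) * Complex.I)) t :=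
        (((h1 t ht).ofReal_comp).mul_const Complex.I).cexp
      have e2 := ((h2 t ht).ofReal_comp).fun_inv (hneC t ht)
      refine ((e1.mul_const (-Complex.I)).mul e2).congr_deriv ?_
      have := hneC t ht
      push_cast
      field_simp
      ring_nf
      simp only [Complex.I_sq]
      ring
    · refine (ce.add cw).intervalIntegrable_of_Icc hab
  rw [intervalIntegral.integral_add (ce.intervalIntegrable_of_Icc hab)
    (cw.intervalIntegrable_of_Icc hab)] at key
  -- The size of the error term is φ'' / φ'² because φ'' ≥ 0, and this is the exact derivative of
  -- -1/φ'. No bound on φ'' is needed.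
  have hq : ∫ t in a..b, φ'' t / (φ' t) ^ 2 = -(φ' b)⁻¹ - -(φ' a)⁻¹ := by
    refine intervalIntegral.integral_eq_sub_of_hasDerivAt (f := fun t => -(φ' t)⁻¹) ?_
      (cq.intervalIntegrable_of_Icc hab)
    intro t ht
    rw [Set.uIcc_of_le hab] at ht
    convert ((h2 t ht).fun_inv (hne t ht)).fun_neg using 1
    ring
  have hinv : ∀ t ∈ Set.Icc a b, |(φ' t)⁻¹| ≤ 1 / μ := fun t ht => by
    rw [abs_inv, ← one_div]; exact one_div_le_one_div_of_le hμ (hl t ht)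
  have hA := hinv a (Set.left_mem_Icc.2 hab)
  have hB := hinv b (Set.right_mem_Icc.2 hab)
  have hw : ‖∫ t in a..b, Complex.exp (φ t * Complex.I) * Complex.I *
      ((φ'' t / (φ' t) ^ 2 : ℝ) : ℂ)‖ ≤ 2 / μ := by
    calc _ ≤ ∫ t in a..b, φ'' t / (φ' t) ^ 2 := by
          refine intervalIntegral.norm_integral_le_of_norm_le hab ?_
            (cq.intervalIntegrable_of_Icc hab)
          refine Filter.Eventually.of_forall fun t ht => ?_
          rw [norm_mul, norm_mul, Complex.norm_exp_ofReal_mul_I, Complex.norm_I, Complex.norm_real,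
            Real.norm_eq_abs, abs_of_nonneg (div_nonneg (h0 t (Set.Ioc_subset_Icc_self ht))
              (sq_nonneg _))]
          simp
      _ ≤ 2 / μ := by
          rw [hq, show 2 / μ = 1 / μ + 1 / μ by ring]
          have := abs_le.1 hA; have := abs_le.1 hB
          linarith
  have hb : ∀ t ∈ Set.Icc a b,
      ‖Complex.exp (φ t * Complex.I) * (-Complex.I) * (φ' t : ℂ)⁻¹‖ ≤ 1 / μ := fun t ht => by
    rw [norm_mul, norm_mul, Complex.norm_exp_ofReal_mul_I, norm_neg, Complex.norm_I, norm_inv,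
      Complex.norm_real, Real.norm_eq_abs, ← abs_inv]
    simpa using hinv t ht
  rw [eq_sub_of_add_eq key]
  refine (norm_sub_le _ _).trans ?_
  refine (add_le_add ((norm_sub_le _ _).trans (add_le_add (hb b (Set.right_mem_Icc.2 hab))
    (hb a (Set.left_mem_Icc.2 hab)))) hw).trans (le_of_eq ?_)
  ring

/-- Since φ' increases with slope at least l, it is small only near one point c. The neighbourhood
of c is estimated trivially and the rest by the first derivative bound; the constant is 4 + 2 + 4.
-/
theorem norm_integral_exp_le_of_le_deriv2 (hab : a ≤ b)
    (h1 : ∀ t ∈ Set.Icc a b, HasDerivAt φ (φ' t) t)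
    (h2 : ∀ t ∈ Set.Icc a b, HasDerivAt φ' (φ'' t) t)
    (hc : ContinuousOn φ'' (Set.Icc a b)) {l : ℝ} (hl0 : 0 < l)
    (hl : ∀ t ∈ Set.Icc a b, l ≤ φ'' t) :
    ‖∫ t in a..b, Complex.exp (φ t * Complex.I)‖ ≤ 10 / √l := by
  have cφ : ContinuousOn φ (Set.Icc a b) := fun t ht => (h1 t ht).continuousAt.continuousWithinAt
  have cφ' : ContinuousOn φ' (Set.Icc a b) := fun t ht => (h2 t ht).continuousAt.continuousWithinAt
  have ce : ContinuousOn (fun t => Complex.exp (φ t * Complex.I)) (Set.Icc a b) := by fun_prop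
  have growth : ∀ s ∈ Set.Icc a b, ∀ t ∈ Set.Icc a b, s ≤ t → l * (t - s) ≤ φ' t - φ' s := by
    intro s hs t ht hst
    refine (convex_Icc a b).mul_sub_le_image_sub_of_le_deriv cφ' ?_ ?_ s hs t ht hst
    · intro u hu
      exact (h2 u (interior_subset hu)).differentiableAt.differentiableWithinAt
    · intro u hu
      rw [(h2 u (interior_subset hu)).deriv]
      exact hl u (interior_subset hu)
  -- The point c is a zero of φ', or, if φ' keeps one sign, the endpoint at which |φ'| is smallest.
  obtain ⟨c, hcm, hcl⟩ : ∃ c ∈ Set.Icc a b, ∀ t ∈ Set.Icc a b, l * |t - c| ≤ |φ' t| := by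
    have ha := Set.left_mem_Icc.2 hab
    have hb := Set.right_mem_Icc.2 hab
    rcases le_or_gt 0 (φ' a) with h | h
    · refine ⟨a, ha, fun t ht => ?_⟩
      rw [abs_of_nonneg (sub_nonneg.2 ht.1)]
      have := growth a ha t ht ht.1
      exact le_trans (by linarith) (le_abs_self _)
    rcases le_or_gt (φ' b) 0 with h' | h'
    · refine ⟨b, hb, fun t ht => ?_⟩
      rw [abs_of_nonpos (sub_nonpos.2 ht.2)]
      have := growth t ht b hb ht.2
      exact le_trans (by linarith) (neg_le_abs _)
    · obtain ⟨c, hcm, hc0⟩ := intermediate_value_Icc hab cφ' ⟨h.le, h'.le⟩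
      refine ⟨c, hcm, fun t ht => ?_⟩
      rcases le_total t c with htc | htc
      · rw [abs_of_nonpos (sub_nonpos.2 htc)]
        have := growth t ht c hcm htc
        exact le_trans (by linarith) (neg_le_abs _)
      · rw [abs_of_nonneg (sub_nonneg.2 htc)]
        have := growth c hcm t ht htc
        exact le_trans (by linarith) (le_abs_self _)
  have hs : 0 < √l := Real.sqrt_pos.2 hl0
  have hss : √l * √l = l := Real.mul_self_sqrt hl0.le
  -- This radius balances the trivial bound 2δ near c against 4 / (lδ) away from c.
  set δ : ℝ := 1 / √l with hδ
  have hδ0 : 0 < δ := by positivity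
  have hlδ : l * δ = √l := by
    rw [hδ, mul_one_div, div_eq_iff hs.ne', hss]
  have outer : ∀ u v, a ≤ u → v ≤ b → (∀ t ∈ Set.Icc u v, δ ≤ |t - c|) →
      (u ≤ v) → ‖∫ t in u..v, Complex.exp (φ t * Complex.I)‖ ≤ 4 / √l := by
    intro u v hu hv hd huv
    have hsub : Set.Icc u v ⊆ Set.Icc a b := Set.Icc_subset_Icc hu hv
    refine norm_integral_exp_le_of_le_abs_deriv huv (fun t ht => h1 t (hsub ht))
      (fun t ht => h2 t (hsub ht)) (hc.mono hsub) (fun t ht => hl0.le.trans (hl t (hsub ht))) hs ?_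
    intro t ht
    refine le_trans ?_ (hcl t (hsub ht))
    rw [← hlδ]
    exact mul_le_mul_of_nonneg_left (hd t ht) hl0.le
  have p0 : 0 ≤ 4 / √l := by positivity
  have I1 : ‖∫ t in a..max a (c - δ), Complex.exp (φ t * Complex.I)‖ ≤ 4 / √l := by
    rcases le_total a (c - δ) with h | h
    · rw [max_eq_right h]
      refine outer _ _ le_rfl (by linarith [hcm.2]) (fun t ht => ?_) h
      rw [abs_sub_comm]; exact le_trans (by linarith [ht.2]) (le_abs_self _)
    · rw [max_eq_left h]; simpa using p0
  have I3 : ‖∫ t in (min b (c + δ))..b, Complex.exp (φ t * Complex.I)‖ ≤ 4 / √l := by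
    rcases le_total (c + δ) b with h | h
    · rw [min_eq_right h]
      refine outer _ _ (by linarith [hcm.1]) le_rfl (fun t ht => ?_) h
      exact le_trans (by linarith [ht.1]) (le_abs_self _)
    · rw [min_eq_left h]; simpa using p0
  have I2 : ‖∫ t in (max a (c - δ))..(min b (c + δ)), Complex.exp (φ t * Complex.I)‖ ≤ 2 / √l := by
    refine (intervalIntegral.norm_integral_le_of_norm_le_const (C := 1) fun t _ => by
      rw [Complex.norm_exp_ofReal_mul_I]).trans ?_
    have : 2 / √l = 2 * δ := by rw [hδ]; ring
    rw [this, one_mul, abs_le]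
    have := le_max_right a (c - δ); have := min_le_right b (c + δ)
    have : max a (c - δ) ≤ c := max_le hcm.1 (by linarith)
    have : c ≤ min b (c + δ) := le_min hcm.2 (by linarith)
    constructor <;> linarith
  have m1 : max a (c - δ) ∈ Set.Icc a b := ⟨le_max_left _ _, max_le hab (by linarith [hcm.2])⟩
  have m2 : min b (c + δ) ∈ Set.Icc a b := ⟨le_min hab (by linarith [hcm.1]), min_le_left _ _⟩
  have ii : ∀ u ∈ Set.Icc a b, ∀ v ∈ Set.Icc a b,
      IntervalIntegrable (fun t => Complex.exp (φ t * Complex.I)) volume u v := fun u hu v hv =>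
    (ce.mono (Set.uIcc_subset_Icc hu hv)).intervalIntegrable
  rw [← intervalIntegral.integral_add_adjacent_intervals
      (ii a (Set.left_mem_Icc.2 hab) _ m1) (ii _ m1 b (Set.right_mem_Icc.2 hab)),
    ← intervalIntegral.integral_add_adjacent_intervals
      (ii _ m1 _ m2) (ii _ m2 b (Set.right_mem_Icc.2 hab))]
  refine (norm_add_le _ _).trans ((add_le_add I1 ((norm_add_le _ _).trans
    (add_le_add I2 I3))).trans (le_of_eq ?_))
  ring

theorem norm_integral_exp_neg (φ : ℝ → ℝ) (a b : ℝ) :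
    ‖∫ t in a..b, Complex.exp ((-φ t : ℝ) * Complex.I)‖ =
      ‖∫ t in a..b, Complex.exp (φ t * Complex.I)‖ := by
  have : ∀ t, Complex.exp ((-φ t : ℝ) * Complex.I) =
      (starRingEnd ℂ) (Complex.exp (φ t * Complex.I)) := fun t => by
    rw [← Complex.exp_conj]; simp
  simp_rw [this, intervalIntegral.intervalIntegral_eq_integral_uIoc, norm_smul]
  rw [integral_conj, RCLike.norm_conj]

/-- Van der Corput estimates for a phase whose second derivative has one sign. -/
theorem norm_integral_exp_le (hab : a ≤ b)
    (h1 : ∀ t ∈ Set.Icc a b, HasDerivAt φ (φ' t) t)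
    (h2 : ∀ t ∈ Set.Icc a b, HasDerivAt φ' (φ'' t) t)
    (hc : ContinuousOn φ'' (Set.Icc a b))
    (hs : (∀ t ∈ Set.Icc a b, 0 ≤ φ'' t) ∨ ∀ t ∈ Set.Icc a b, φ'' t ≤ 0) {l : ℝ} (hl0 : 0 < l) :
    ((∀ t ∈ Set.Icc a b, l ≤ |φ' t|) →
      ‖∫ t in a..b, Complex.exp (φ t * Complex.I)‖ ≤ 4 / l) ∧
    ((∀ t ∈ Set.Icc a b, l ≤ |φ'' t|) →
      ‖∫ t in a..b, Complex.exp (φ t * Complex.I)‖ ≤ 10 / √l) := by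
  rcases hs with hs | hs
  · refine ⟨fun h => norm_integral_exp_le_of_le_abs_deriv hab h1 h2 hc hs hl0 h,
      fun h => norm_integral_exp_le_of_le_deriv2 hab h1 h2 hc hl0 fun t ht => ?_⟩
    rw [← abs_of_nonneg (hs t ht)]; exact h t ht
  · rw [← norm_integral_exp_neg]
    refine ⟨fun h => norm_integral_exp_le_of_le_abs_deriv (φ := fun t => -φ t)
        (φ' := fun t => -φ' t) (φ'' := fun t => -φ'' t) hab
        (fun t ht => (h1 t ht).neg) (fun t ht => (h2 t ht).neg) hc.neg
        (fun t ht => neg_nonneg.2 (hs t ht)) hl0 fun t ht => by rw [abs_neg]; exact h t ht,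
      fun h => norm_integral_exp_le_of_le_deriv2 (φ := fun t => -φ t)
        (φ' := fun t => -φ' t) (φ'' := fun t => -φ'' t) hab
        (fun t ht => (h1 t ht).neg) (fun t ht => (h2 t ht).neg) hc.neg hl0 fun t ht => ?_⟩
    rw [← abs_of_nonpos (hs t ht)]; exact h t ht

end VanDerCorput

/-! ### Oscillatory integrals over boxes in a graph -/

section GraphOscillation

/-- The point of the graph of `h` over `y`, where the `k`-th coordinate is the dependent one. -/
def graphMap {d : ℕ} (k : Fin (d + 1)) (h : (Fin d → ℝ) → ℝ) (y : Fin d → ℝ) : Euc (d + 1) :=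
  WithLp.toLp 2 (k.insertNth (α := fun _ => ℝ) (h y) y)

theorem inner_graphMap {d : ℕ} (k : Fin (d + 1)) (h : (Fin d → ℝ) → ℝ) (x : Euc (d + 1))
    (y : Fin d → ℝ) :
    inner ℝ x (graphMap k h y) = x k * h y + ∑ j, x (k.succAbove j) * y j := by
  rw [PiLp.inner_apply, Fin.sum_univ_succAbove _ k]
  simp [graphMap, mul_comm]

theorem continuous_graphMap {d : ℕ} (k : Fin (d + 1)) {h : (Fin d → ℝ) → ℝ} (hh : Continuous h) :
    Continuous (graphMap k h) := by
  refine (PiLp.continuous_toLp 2 _).comp (continuous_pi fun i => ?_)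
  refine Fin.succAboveCases k ?_ (fun j => ?_) i
  · simpa using hh
  · simpa using continuous_apply j

/-- `h` is twice differentiable along the coordinate lines in `B`, with gradient bounded by `M`, and
its pure second derivatives are at least `l` in size and share one sign. -/
structure IsCurvedOn {d : ℕ} (h : (Fin d → ℝ) → ℝ) (h1 h2 : Fin d → (Fin d → ℝ) → ℝ)
    (B : Set (Fin d → ℝ)) (M l : ℝ) : Prop where
  hasDerivAt : ∀ y ∈ B, ∀ j, HasDerivAt (fun t => h (Function.update y j t)) (h1 j y) (y j)
  hasDerivAt' : ∀ y ∈ B, ∀ j, HasDerivAt (fun t => h1 j (Function.update y j t)) (h2 j y) (y j)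
  continuousOn : ∀ j, ContinuousOn (h2 j) B
  abs_le : ∀ y ∈ B, ∀ j, |h1 j y| ≤ M
  curved : (∀ y ∈ B, ∀ j, l ≤ h2 j y) ∨ ∀ y ∈ B, ∀ j, h2 j y ≤ -l

/-- The half-open cube with lower corner `a` and side `r`. -/
def cube {d : ℕ} (a : Fin d → ℝ) (r : ℝ) : Set (Fin d → ℝ) :=
  Set.univ.pi fun i => Set.Ico (a i) (a i + r)

theorem measurableSet_cube {d : ℕ} (a : Fin d → ℝ) (r : ℝ) : MeasurableSet (cube a r) :=
  MeasurableSet.univ_pi fun _ => measurableSet_Ico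

theorem volume_cube {d : ℕ} (a : Fin d → ℝ) (r : ℝ) :
    volume (cube a r) = ENNReal.ofReal r ^ d := by
  simp [cube, Real.volume_pi_Ico]

theorem exists_div_le_abs_apply {n : ℕ} (x : Euc (n + 1)) : ∃ i, ‖x‖ / (n + 1) ≤ |x i| := by
  by_contra! hcon
  have hx : ‖x‖ ≤ ∑ i, |x i| := by
    have := (EuclideanSpace.basisFun (Fin (n + 1)) ℝ).sum_repr x
    conv_lhs => rw [← this]
    refine (norm_sum_le _ _).trans (Finset.sum_le_sum fun i _ => ?_)
    rw [norm_smul]; simp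
  have := Finset.sum_lt_sum_of_nonempty (Finset.univ_nonempty (α := Fin (n + 1)))
    (fun i _ => hcon i)
  simp only [Finset.sum_const, Finset.card_univ, Fintype.card_fin, nsmul_eq_mul] at this
  have h : ((n + 1 : ℕ) : ℝ) * (‖x‖ / (n + 1)) = ‖x‖ := by push_cast; field_simp
  linarith

/-- An integral over a cube is bounded by a bound for the integrals along lines in one direction. -/
theorem norm_setIntegral_cube_le {e : ℕ} (j : Fin (e + 1)) (a : Fin (e + 1) → ℝ) {r : ℝ}
    (hr : 0 ≤ r) {F : (Fin (e + 1) → ℝ) → ℂ} (hF : Continuous F) (hF1 : ∀ y, ‖F y‖ ≤ 1) {C : ℝ}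
    (hC : ∀ y : Fin e → ℝ, (∀ i, y i ∈ Set.Icc (a (j.succAbove i)) (a (j.succAbove i) + r)) →
      ‖∫ t in (a j)..(a j + r), F (j.insertNth (α := fun _ => ℝ) t y)‖ ≤ C) :
    ‖∫ y in cube a r, F y‖ ≤ C * r ^ e := by
  let eq : ℝ × (Fin e → ℝ) ≃ᵐ (Fin (e + 1) → ℝ) :=
    (MeasurableEquiv.piFinSuccAbove (fun _ : Fin (e + 1) => ℝ) j).symm
  have hem : MeasurePreserving eq :=
    (volume_preserving_piFinSuccAbove (fun _ : Fin (e + 1) => ℝ) j).symm _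
  have heq : ∀ t y, eq (t, y) = j.insertNth (α := fun _ => ℝ) t y := fun t y => rfl
  have hpre : eq ⁻¹' cube a r =
      Set.Ico (a j) (a j + r) ×ˢ cube (fun i => a (j.succAbove i)) r := by
    ext ⟨t, y⟩
    simp only [Set.mem_preimage, cube, Set.mem_univ_pi, Set.mem_prod]
    rw [Fin.forall_iff_succAbove j]
    simp [heq]
  have hcont : Continuous fun p : ℝ × (Fin e → ℝ) => F (eq p) := by
    refine hF.comp (continuous_pi fun i => ?_)
    simp only [heq]
    refine Fin.succAboveCases j ?_ (fun j' => ?_) i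
    · simpa using continuous_fst
    · simp only [Fin.insertNth_apply_succAbove]; fun_prop
  rw [← hem.map_eq, setIntegral_map_equiv, hpre, Measure.volume_eq_prod, ← Measure.prod_restrict,
    integral_prod_symm]
  · refine (norm_setIntegral_le_of_norm_le_const (C := C) ?_ ?_).trans (le_of_eq ?_)
    · rw [volume_cube]; exact ENNReal.pow_lt_top ENNReal.ofReal_lt_top
    · intro y hy
      rw [integral_Ico_eq_integral_Ioc, ← intervalIntegral.integral_of_le (by linarith)]
      exact hC y fun i => Set.Ico_subset_Icc_self (hy i (Set.mem_univ _))
    · rw [measureReal_def, volume_cube, ENNReal.toReal_pow, ENNReal.toReal_ofReal hr]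
  · rw [Measure.prod_restrict, ← Measure.volume_eq_prod]
    refine Measure.integrableOn_of_bounded (M := 1) ?_ hcont.aestronglyMeasurable
      (Filter.Eventually.of_forall fun p => hF1 _)
    rw [Measure.volume_eq_prod, Measure.prod_prod, volume_cube, Real.volume_Ico]
    exact ENNReal.mul_ne_top ENNReal.ofReal_ne_top (ENNReal.pow_ne_top ENNReal.ofReal_ne_top)

/-- Decay of the Fourier transform of a piece of a curved graph over a cube. -/
theorem norm_setIntegral_cube_graphMap_le {e : ℕ} {M l : ℝ} (hM : 0 ≤ M) (hl : 0 < l) :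
    ∃ C : ℝ, 0 < C ∧ ∀ (k : Fin (e + 2)) (h : (Fin (e + 1) → ℝ) → ℝ)
      (h1 h2 : Fin (e + 1) → (Fin (e + 1) → ℝ) → ℝ) (B : Set (Fin (e + 1) → ℝ)),
      IsCurvedOn h h1 h2 B M l → Continuous h → ∀ (a : Fin (e + 1) → ℝ) (r : ℝ), 0 ≤ r →
      (Set.univ.pi fun i => Set.Icc (a i) (a i + r)) ⊆ B → ∀ x : Euc (e + 2), 1 ≤ ‖x‖ →
      ‖∫ y in cube a r, Complex.exp (((-2 * Real.pi * inner ℝ x (graphMap k h y) : ℝ) : ℂ) *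
        Complex.I)‖ ≤ C / √‖x‖ * r ^ e := by
  set D : ℝ := (e : ℝ) + 2 with hD
  have hD0 : 0 < D := by positivity
  -- With D the dimension, some coordinate of x has size at least ‖x‖ / D. The choice of ε lets the
  -- gradient term, at most ε‖x‖M, use up no more than half of it. With M + 1 instead of M one also
  -- has ε ≤ 1/(2D), which shows that the large coordinate is not the k-th one when |x k| < ε‖x‖.
  set ε : ℝ := 1 / (2 * D * (M + 1)) with hε
  have hε0 : 0 < ε := by positivity
  refine ⟨4 * (2 * D) + 10 / √(ε * l), by positivity, ?_⟩
  intro k h h1 h2 B hB hh a r hr hsub x hx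
  have hx0 : 0 < ‖x‖ := by linarith
  set F : (Fin (e + 1) → ℝ) → ℂ := fun y =>
    Complex.exp (((-2 * Real.pi * inner ℝ x (graphMap k h y) : ℝ) : ℂ) * Complex.I) with hF
  have hFc : Continuous F := by
    have := continuous_graphMap k hh
    fun_prop
  have hF1 : ∀ y, ‖F y‖ ≤ 1 := fun y => by rw [hF, Complex.norm_exp_ofReal_mul_I]
  have hsq : √‖x‖ ≤ ‖x‖ := by
    rw [Real.sqrt_le_left hx0.le]; nlinarith
  have hsq0 : 0 < √‖x‖ := Real.sqrt_pos.2 hx0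
  have hpi : (1 : ℝ) ≤ 2 * Real.pi := by linarith [Real.pi_gt_three]
  -- a line in direction `j`
  have line : ∀ (j : Fin (e + 1)) (y : Fin e → ℝ),
      (∀ i, y i ∈ Set.Icc (a (j.succAbove i)) (a (j.succAbove i) + r)) →
      ∀ L : ℝ, 0 < L →
      ((∀ z ∈ B, L ≤ |2 * Real.pi * (x k * h1 j z + x (k.succAbove j))|) →
        ‖∫ t in (a j)..(a j + r), F (j.insertNth (α := fun _ => ℝ) t y)‖ ≤ 4 / L) ∧
      ((∀ z ∈ B, L ≤ |2 * Real.pi * (x k * h2 j z)|) →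
        ‖∫ t in (a j)..(a j + r), F (j.insertNth (α := fun _ => ℝ) t y)‖ ≤ 10 / √L) := by
    intro j y hy L hL
    set p : ℝ → (Fin (e + 1) → ℝ) := fun t => j.insertNth (α := fun _ => ℝ) t y with hp
    have hpB : ∀ t ∈ Set.Icc (a j) (a j + r), p t ∈ B := by
      intro t ht
      refine hsub ?_
      rw [Set.mem_univ_pi, Fin.forall_iff_succAbove j]
      simpa [hp] using ⟨ht, hy⟩
    have hup : ∀ t s, Function.update (p t) j s = p s := fun t s => by
      simp [hp]
    have hpj : ∀ t, p t j = t := fun t => by simp [hp]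
    have hpc : Continuous p := by
      refine continuous_pi fun i => ?_
      refine Fin.succAboveCases j ?_ (fun j' => ?_) i
      · simpa [hp] using continuous_id'
      · simpa [hp] using continuous_const
    set c : ℝ := ∑ i, x (k.succAbove (j.succAbove i)) * y i
    have hphase : ∀ t, -2 * Real.pi * inner ℝ x (graphMap k h (p t)) =
        -2 * Real.pi * (x k * h (p t) + (x (k.succAbove j) * t + c)) := by
      intro t
      rw [inner_graphMap, Fin.sum_univ_succAbove _ j]
      simp [hp, c]
    have d1 : ∀ t ∈ Set.Icc (a j) (a j + r), HasDerivAt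
        (fun t => -2 * Real.pi * (x k * h (p t) + (x (k.succAbove j) * t + c)))
        (-2 * Real.pi * (x k * h1 j (p t) + x (k.succAbove j))) t := by
      intro t ht
      have h0 := hB.hasDerivAt (p t) (hpB t ht) j
      simp only [hup, hpj] at h0
      have h3 : HasDerivAt (fun t => x (k.succAbove j) * t + c) (x (k.succAbove j)) t := by
        simpa using ((hasDerivAt_id t).const_mul (x (k.succAbove j))).add_const c
      exact ((h0.const_mul (x k)).add h3).const_mul _
    have d2 : ∀ t ∈ Set.Icc (a j) (a j + r), HasDerivAt
        (fun t => -2 * Real.pi * (x k * h1 j (p t) + x (k.succAbove j)))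
        (-2 * Real.pi * (x k * h2 j (p t))) t := by
      intro t ht
      have h0 := hB.hasDerivAt' (p t) (hpB t ht) j
      simp only [hup, hpj] at h0
      exact ((h0.const_mul (x k)).add_const _).const_mul _
    have c2 : ContinuousOn (fun t => -2 * Real.pi * (x k * h2 j (p t)))
        (Set.Icc (a j) (a j + r)) := by
      have : ContinuousOn (fun t => h2 j (p t)) (Set.Icc (a j) (a j + r)) :=
        (hB.continuousOn j).comp hpc.continuousOn hpB
      exact continuousOn_const.mul (continuousOn_const.mul this)
    have sg : (∀ t ∈ Set.Icc (a j) (a j + r), 0 ≤ -2 * Real.pi * (x k * h2 j (p t))) ∨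
        ∀ t ∈ Set.Icc (a j) (a j + r), -2 * Real.pi * (x k * h2 j (p t)) ≤ 0 := by
      have hpp := Real.pi_pos
      rcases hB.curved with hc | hc <;> rcases le_total 0 (x k) with hk | hk
      · right; intro t ht
        have := mul_nonneg hpp.le (mul_nonneg hk (hl.le.trans (hc _ (hpB t ht) j)))
        linarith
      · left; intro t ht
        have := mul_nonneg hpp.le (mul_nonneg (neg_nonneg.2 hk) (hl.le.trans (hc _ (hpB t ht) j)))
        linarith
      · left; intro t ht
        have := mul_nonneg hpp.le (mul_nonneg hk (neg_nonneg.2 ((hc _ (hpB t ht) j).trans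
          (neg_nonpos.2 hl.le))))
        linarith
      · right; intro t ht
        have := mul_nonneg hpp.le (mul_nonneg (neg_nonneg.2 hk) (neg_nonneg.2
          ((hc _ (hpB t ht) j).trans (neg_nonpos.2 hl.le))))
        linarith
    have key := norm_integral_exp_le (by linarith : a j ≤ a j + r) d1 d2 c2 sg hL
    have hFp : ∀ t, F (j.insertNth (α := fun _ => ℝ) t y) = Complex.exp
        (((-2 * Real.pi * (x k * h (p t) + (x (k.succAbove j) * t + c)) : ℝ) : ℂ) * Complex.I) :=
      fun t => by rw [← hphase]
    simp_rw [hFp]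
    refine ⟨fun H => key.1 fun t ht => ?_, fun H => key.2 fun t ht => ?_⟩
    · rw [neg_mul, neg_mul, abs_neg]; exact H _ (hpB t ht)
    · rw [neg_mul, neg_mul, abs_neg]; exact H _ (hpB t ht)
  -- If x is not too close to the coordinate hyperplane, the phase has second derivative of size ‖x‖
  -- along every coordinate line. Otherwise it has first derivative of size ‖x‖ along one line,
  -- which is even better as ‖x‖ ≥ 1. Only one line is used; the other e directions contribute the
  -- factor r^e.
  rcases le_or_gt (ε * ‖x‖) |x k| with hk | hk
  · refine norm_setIntegral_cube_le 0 a hr hFc hF1 fun y hy => ?_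
    have hL : 0 < ε * l * ‖x‖ := by positivity
    refine ((line 0 y hy _ hL).2 fun z hz => ?_).trans ?_
    · rw [abs_mul, abs_of_nonneg (by positivity : 0 ≤ 2 * Real.pi), abs_mul]
      have h2l : l ≤ |h2 0 z| := by
        rcases hB.curved with hc | hc
        · exact (hc z hz 0).trans (le_abs_self _)
        · exact (by linarith [hc z hz 0] : l ≤ -h2 0 z).trans (neg_le_abs _)
      calc ε * l * ‖x‖ = 1 * (ε * ‖x‖ * l) := by ring
        _ ≤ 2 * Real.pi * (|x k| * |h2 0 z|) := by gcongr
    · rw [Real.sqrt_mul (by positivity), ← div_div]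
      gcongr
      linarith [show 0 < 4 * (2 * D) by positivity]
  · obtain ⟨i, hi⟩ := exists_div_le_abs_apply x
    have hDi : ‖x‖ / D ≤ |x i| := by
      refine le_trans (le_of_eq ?_) hi
      rw [hD]; push_cast; ring
    have hεD : ε ≤ 1 / (2 * D) := by
      rw [hε]; apply one_div_le_one_div_of_le (by positivity); nlinarith
    have hik : i ≠ k := by
      rintro rfl
      have : ε * ‖x‖ ≤ 1 / (2 * D) * ‖x‖ := by gcongr
      have e2 : ‖x‖ / D = 2 * (1 / (2 * D) * ‖x‖) := by field_simp
      have : 0 < 1 / (2 * D) * ‖x‖ := by positivity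
      linarith
    obtain ⟨j, rfl⟩ := Fin.exists_succAbove_eq hik
    refine norm_setIntegral_cube_le j a hr hFc hF1 fun y hy => ?_
    have hL : 0 < ‖x‖ / (2 * D) := by positivity
    refine ((line j y hy _ hL).1 fun z hz => ?_).trans ?_
    · rw [abs_mul, abs_of_nonneg (by positivity : 0 ≤ 2 * Real.pi)]
      have h3 : |x k * h1 j z| ≤ ‖x‖ / (2 * D) := by
        rw [abs_mul]
        calc |x k| * |h1 j z| ≤ (ε * ‖x‖) * (M + 1) := by
              gcongr; linarith [hB.abs_le z hz j]
          _ = ‖x‖ / (2 * D) := by rw [hε]; field_simp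
      have h4 : |x (k.succAbove j)| - |x k * h1 j z| ≤ |x k * h1 j z + x (k.succAbove j)| := by
        have := abs_sub_abs_le_abs_sub (x (k.succAbove j)) (-(x k * h1 j z))
        rw [abs_neg, sub_neg_eq_add, add_comm (x (k.succAbove j))] at this
        exact this
      have e2 : ‖x‖ / D = ‖x‖ / (2 * D) + ‖x‖ / (2 * D) := by field_simp; ring
      calc ‖x‖ / (2 * D) = 1 * (‖x‖ / (2 * D)) := (one_mul _).symm
        _ ≤ _ := by gcongr; linarith
    · calc 4 / (‖x‖ / (2 * D)) = 4 * (2 * D) / ‖x‖ := by field_simp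
        _ ≤ 4 * (2 * D) / √‖x‖ := by gcongr
        _ ≤ _ := by
          gcongr
          linarith [show 0 < 10 / √(ε * l) by positivity]

end GraphOscillation

/-! ### Local graph parametrizations -/

section Patches

/-- The linear map which inserts the last component as the `k`-th coordinate. -/
noncomputable def insertCLM {d : ℕ} (k : Fin (d + 1)) : (Fin d → ℝ) × ℝ →L[ℝ] Euc (d + 1) :=
  LinearMap.toContinuousLinearMap
    { toFun := fun p => WithLp.toLp 2 (k.insertNth (α := fun _ => ℝ) p.2 p.1)
      map_add' := fun p q => by
        ext i
        refine Fin.succAboveCases k ?_ (fun j => ?_) i <;> simp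
      map_smul' := fun c p => by
        ext i
        refine Fin.succAboveCases k ?_ (fun j => ?_) i <;> simp }

theorem insertCLM_apply {d : ℕ} (k : Fin (d + 1)) (p : (Fin d → ℝ) × ℝ) :
    insertCLM k p = WithLp.toLp 2 (k.insertNth (α := fun _ => ℝ) p.2 p.1) := rfl

theorem insertCLM_graph {d : ℕ} (k : Fin (d + 1)) (h : (Fin d → ℝ) → ℝ) (y : Fin d → ℝ) :
    insertCLM k (y, h y) = graphMap k h y := rfl

/-- The coordinates other than the `k`-th. -/
def removeCoord {d : ℕ} (k : Fin (d + 1)) (x : Euc (d + 1)) : Fin d → ℝ := fun j => x (k.succAbove j)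

theorem continuous_removeCoord {d : ℕ} (k : Fin (d + 1)) : Continuous (removeCoord k) := by
  unfold removeCoord; fun_prop

theorem insertCLM_removeCoord {d : ℕ} (k : Fin (d + 1)) (x : Euc (d + 1)) :
    insertCLM k (removeCoord k x, x k) = x := by
  ext i
  refine Fin.succAboveCases k ?_ (fun j => ?_) i <;> simp [insertCLM_apply, removeCoord]

theorem removeCoord_graphMap {d : ℕ} (k : Fin (d + 1)) (h : (Fin d → ℝ) → ℝ) (y : Fin d → ℝ) :
    removeCoord k (graphMap k h y) = y := by
  ext j; simp [removeCoord, graphMap]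

theorem exists_insertCLM_ne_zero {d : ℕ} {T : Euc (d + 1) →L[ℝ] ℝ} (hT : T ≠ 0) :
    ∃ k, T (insertCLM k (0, 1)) ≠ 0 := by
  by_contra! hcon
  refine hT ?_
  ext v
  rw [← (EuclideanSpace.basisFun (Fin (d + 1)) ℝ).sum_repr v, map_sum]
  refine Finset.sum_eq_zero fun k _ => ?_
  have : EuclideanSpace.basisFun (Fin (d + 1)) ℝ k = insertCLM k (0, 1) := by
    ext i
    refine Fin.succAboveCases k ?_ (fun j => ?_) i <;> simp [insertCLM_apply]
  rw [map_smul, this, hcon k, smul_zero]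

theorem hasDerivAt_update_comp {d : ℕ} {E : Type*} [NormedAddCommGroup E] [NormedSpace ℝ E]
    {g : (Fin d → ℝ) → E} {y : Fin d → ℝ} (hg : DifferentiableAt ℝ g y) (j : Fin d) :
    HasDerivAt (fun t => g (Function.update y j t)) (fderiv ℝ g y (Pi.single j 1)) (y j) := by
  have h1 : HasFDerivAt g (fderiv ℝ g y) (Function.update y j (y j)) := by
    rw [Function.update_eq_self]; exact hg.hasFDerivAt
  exact h1.comp_hasDerivAt (y j) (hasDerivAt_update y j (y j))

theorem continuous_update_line {d : ℕ} (y : Fin d → ℝ) (j : Fin d) :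
    Continuous fun t : ℝ => Function.update y j t := continuous_const.update j continuous_id

/-- Near each of its points, a curved hypersurface is a graph over a cube in a coordinate
hyperplane, and the graph is curved along all coordinate lines. -/
theorem exists_curved_graph {e : ℕ} {S : Set (Euc (e + 2))} (hS : IsCompactPosDefHypersurface S)
    {x : Euc (e + 2)} (hx : x ∈ S) :
    ∃ (k : Fin (e + 2)) (h : (Fin (e + 1) → ℝ) → ℝ) (h1 h2 : Fin (e + 1) → (Fin (e + 1) → ℝ) → ℝ)
      (B : Set (Fin (e + 1) → ℝ)) (M l : ℝ) (K : NNReal) (a : Fin (e + 1) → ℝ) (r : ℝ),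
      0 ≤ M ∧ 0 < l ∧ 0 < r ∧ IsCurvedOn h h1 h2 B M l ∧ LipschitzWith K h ∧
      (Set.univ.pi fun i => Set.Icc (a i) (a i + r)) ⊆ B ∧
      graphMap k h '' cube a r ⊆ S ∧ ∃ W ∈ 𝓝 x, S ∩ W ⊆ graphMap k h '' cube a r := by
  obtain ⟨U, F, hF, hpos⟩ := hS.exists_defining x hx
  have hUx : U ∈ 𝓝 x := hF.isOpen.mem_nhds hF.mem
  have hFx : ∀ y ∈ U, ContDiffAt ℝ ∞ F y := fun y hy =>
    hF.smooth.contDiffAt (hF.isOpen.mem_nhds hy)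
  -- The k-th partial derivative of F does not vanish at x, so the implicit function theorem solves
  -- for the k-th coordinate.
  obtain ⟨k, hk⟩ := exists_insertCLM_ne_zero (hF.regular x ⟨hx, hF.mem⟩)
  set y₀ : Fin (e + 1) → ℝ := removeCoord k x with hy₀
  set u : (Fin (e + 1) → ℝ) × ℝ := (y₀, x k) with hu
  have hux : insertCLM k u = x := insertCLM_removeCoord k x
  set G : (Fin (e + 1) → ℝ) × ℝ → ℝ := fun p => F (insertCLM k p) with hG
  have cdf : ContDiffAt ℝ ∞ G u := by
    refine ContDiffAt.comp u ?_ (insertCLM k).contDiff.contDiffAt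
    rw [hux]; exact hFx x hF.mem
  have hGu : G u = 0 := by
    rw [hG]; simp only [hux]; exact (hF.zero_iff x hF.mem).1 hx
  have hGd : fderiv ℝ G u = (fderiv ℝ F x).comp (insertCLM k) := by
    have h0 : HasFDerivAt F (fderiv ℝ F x) (insertCLM k u) := by
      rw [hux]; exact ((hFx x hF.mem).differentiableAt (by simp)).hasFDerivAt
    exact (h0.comp u (insertCLM k).hasFDerivAt).fderiv
  have if₂ : (fderiv ℝ G u ∘L .inr ℝ (Fin (e + 1) → ℝ) ℝ).IsInvertible := by
    refine ⟨ContinuousLinearEquiv.unitsEquivAut ℝ (Units.mk0 _ hk), ?_⟩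
    ext
    simp [hGd]
  have pn : (∞ : WithTop ℕ∞) ≠ 0 := by simp
  set h := cdf.implicitFunction pn if₂ with hh
  have hc : ContDiffAt ℝ ∞ h y₀ := cdf.contDiffAt_implicitFunction pn if₂
  have hself : h y₀ = x k := cdf.implicitFunction_apply_self pn if₂
  have hzero : ∀ᶠ y in 𝓝 y₀, G (y, h y) = 0 := by
    filter_upwards [cdf.eventually_apply_implicitFunction pn if₂] with y hy
    rw [hy, hGu]
  have hiff : ∀ᶠ v in 𝓝 u, G v = 0 ↔ h v.1 = v.2 := by
    filter_upwards [cdf.eventually_apply_eq_iff_implicitFunction pn if₂] with v hv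
    rw [← hv, hGu]
  have hc2 : ∀ᶠ y in 𝓝 y₀, ContDiffAt ℝ 2 h y :=
    (hc.of_le (WithTop.coe_le_coe.2 (le_top : (2 : ℕ∞) ≤ ⊤))).eventually (by simp)
  set h1 : Fin (e + 1) → (Fin (e + 1) → ℝ) → ℝ := fun j y => fderiv ℝ h y (Pi.single j 1) with hh1
  set h2 : Fin (e + 1) → (Fin (e + 1) → ℝ) → ℝ := fun j y =>
    fderiv ℝ (h1 j) y (Pi.single j 1) with hh2
  have hd1 : ∀ y, ContDiffAt ℝ 2 h y → ∀ j, ContDiffAt ℝ 1 (h1 j) y := fun y hy j =>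
    (hy.fderiv_right (m := 1) (by norm_num)).clm_apply contDiffAt_const
  have hcont1 : ∀ j, ContinuousAt (h1 j) y₀ := fun j => (hd1 _ hc2.self_of_nhds j).continuousAt
  have hcont2 : ∀ y, ContDiffAt ℝ 2 h y → ∀ j, ContinuousAt (h2 j) y := fun y hy j =>
    (((hd1 y hy j).fderiv_right (m := 0) (by norm_num)).clm_apply contDiffAt_const).continuousAt
  have hgc : ContinuousAt (fun y => graphMap k h y) y₀ := by
    have : ContinuousAt (fun y => insertCLM k (y, h y)) y₀ :=
      (insertCLM k).continuous.continuousAt.comp (continuousAt_id.prodMk hc.continuousAt)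
    exact this
  have hgx : graphMap k h y₀ = x := by
    rw [← insertCLM_graph, hself]; exact hux
  have hgU : ∀ᶠ y in 𝓝 y₀, graphMap k h y ∈ U := hgc.preimage_mem_nhds (by rw [hgx]; exact hUx)
  -- the sign of the second derivatives at the centre
  have hsign : ∀ j, h2 j y₀ * fderiv ℝ F x (insertCLM k (0, 1)) < 0 := by
    intro j
    set p : ℝ → (Fin (e + 1) → ℝ) := fun t => Function.update y₀ j t with hp
    have hp0 : p (y₀ j) = y₀ := Function.update_eq_self _ _
    have hpt : Tendsto p (𝓝 (y₀ j)) (𝓝 y₀) := by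
      have := (continuous_update_line y₀ j).tendsto (y₀ j)
      rwa [Function.update_eq_self] at this
    have hline : ∀ᶠ t in 𝓝 (y₀ j), HasDerivAt (fun s => h (p s)) (h1 j (p t)) t := by
      filter_upwards [hpt.eventually hc2] with t ht
      have := hasDerivAt_update_comp (ht.differentiableAt (by simp)) j
      simpa [hp, hh1] using this
    have hcurve : ∀ᶠ t in 𝓝 (y₀ j), HasDerivAt (fun s => graphMap k h (p s))
        (insertCLM k (Pi.single j 1, h1 j (p t))) t := by
      filter_upwards [hline] with t ht
      exact (insertCLM k).hasFDerivAt.comp_hasDerivAt t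
        ((hasDerivAt_update y₀ j t).prodMk ht)
    have hF0 : ∀ᶠ t in 𝓝 (y₀ j), (fun s => F (graphMap k h (p s))) =ᶠ[𝓝 t] fun _ => 0 := by
      have h3 : ∀ᶠ t in 𝓝 (y₀ j), F (graphMap k h (p t)) = 0 := hpt.eventually hzero
      exact h3.eventually_nhds
    -- The lifted line runs in the level set, so its velocity V is annihilated by dF.
    -- Differentiating this once more at the centre gives F''(V, V) + h2 j · ∂_k F = 0. Positivity
    -- of the second fundamental form then makes h2 j opposite in sign to ∂_k F, hence of the same
    -- sign for all j.
    have hV : ∀ᶠ t in 𝓝 (y₀ j), fderiv ℝ F (graphMap k h (p t))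
        (insertCLM k (Pi.single j 1, h1 j (p t))) = 0 := by
      filter_upwards [hF0, hcurve, hpt.eventually hgU] with t h3 h4 h5
      have h6 := ((hFx _ h5).differentiableAt (by simp)).hasFDerivAt.comp_hasDerivAt t h4
      exact h6.unique ((hasDerivAt_const t (0 : ℝ)).congr_of_eventuallyEq h3)
    have hfx : ContDiffAt ℝ 1 (fderiv ℝ F) x :=
      (hFx x hF.mem).fderiv_right (WithTop.coe_le_coe.2 (le_top : (2 : ℕ∞) ≤ ⊤))
    have e1 : HasDerivAt (fun t => fderiv ℝ F (graphMap k h (p t)))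
        (fderiv ℝ (fderiv ℝ F) x (insertCLM k (Pi.single j 1, h1 j y₀))) (y₀ j) := by
      have h3 : HasFDerivAt (fderiv ℝ F) (fderiv ℝ (fderiv ℝ F) x) (graphMap k h (p (y₀ j))) := by
        rw [hp0, hgx]; exact (hfx.differentiableAt (by simp)).hasFDerivAt
      have h4 := hcurve.self_of_nhds
      have h5 := h3.comp_hasDerivAt (y₀ j) h4
      rwa [hp0] at h5
    have e2 : HasDerivAt (fun t => insertCLM k (Pi.single j 1, h1 j (p t)))
        (insertCLM k (0, h2 j y₀)) (y₀ j) := by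
      have h3 : HasDerivAt (fun t => h1 j (p t)) (h2 j y₀) (y₀ j) :=
        hasDerivAt_update_comp ((hd1 _ hc2.self_of_nhds j).differentiableAt (by simp)) j
      exact (insertCLM k).hasFDerivAt.comp_hasDerivAt (y₀ j)
        ((hasDerivAt_const (y₀ j) (Pi.single j 1 : Fin (e + 1) → ℝ)).prodMk h3)
    have e3 := e1.clm_apply e2
    have e4 := e3.unique ((hasDerivAt_const (y₀ j) (0 : ℝ)).congr_of_eventuallyEq hV)
    rw [hp0, hgx] at e4
    set V := insertCLM k (Pi.single j 1, h1 j y₀) with hVd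
    have hV0 : fderiv ℝ F x V = 0 := by
      have := hV.self_of_nhds
      rwa [hp0, hgx] at this
    have hVne : V ≠ 0 := by
      intro h0
      have : V (k.succAbove j) = 1 := by simp [hVd, insertCLM_apply]
      rw [h0] at this; simp at this
    have hQ := hpos x ⟨hx, hF.mem⟩ V hV0 hVne
    unfold secondFundamentalForm at hQ
    have hQ' : 0 < fderiv ℝ (fderiv ℝ F) x V V := by
      by_contra hcon
      have := div_nonpos_of_nonpos_of_nonneg (not_lt.1 hcon) (norm_nonneg (fderiv ℝ F x))
      linarith
    have h7 : insertCLM k ((0 : Fin (e + 1) → ℝ), h2 j y₀) =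
        h2 j y₀ • insertCLM k ((0 : Fin (e + 1) → ℝ), (1 : ℝ)) := by
      rw [← map_smul]; simp
    rw [h7, map_smul, smul_eq_mul] at e4
    linarith
  obtain ⟨j₀, hj₀⟩ := Finite.exists_min fun j => |h2 j y₀|
  set l : ℝ := |h2 j₀ y₀| / 2 with hl
  have hl0 : 0 < l := by
    have : h2 j₀ y₀ ≠ 0 := fun h0 => by have := hsign j₀; rw [h0] at this; simp at this
    have := abs_pos.2 this; positivity
  have hlj : ∀ j, l < |h2 j y₀| := fun j => by
    have := hj₀ j; linarith
  set M : ℝ := (∑ j, |h1 j y₀|) + 1 with hM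
  have hM0 : 0 ≤ M := by positivity
  have hMe : ∀ᶠ y in 𝓝 y₀, ∀ j, |h1 j y| ≤ M := by
    rw [eventually_all]
    intro j
    have h3 : |h1 j y₀| < M := by
      have := Finset.single_le_sum (f := fun j => |h1 j y₀|) (fun i _ => abs_nonneg _)
        (Finset.mem_univ j)
      linarith
    exact ((hcont1 j).abs.eventually (gt_mem_nhds h3)).mono fun y hy => le_of_lt hy
  obtain ⟨K, t, ht, hKt⟩ := (hc2.self_of_nhds.of_le (m := 1) (by norm_num)).exists_lipschitzOnWith
  have hcurved : (∀ᶠ y in 𝓝 y₀, ∀ j, l ≤ h2 j y) ∨ ∀ᶠ y in 𝓝 y₀, ∀ j, h2 j y ≤ -l := by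
    have hcc := fun j => hcont2 _ hc2.self_of_nhds j
    rcases lt_or_gt_of_ne hk with hk' | hk'
    · left
      rw [eventually_all]
      intro j
      have h3 : 0 < h2 j y₀ := by
        by_contra hcon
        have := mul_nonneg_of_nonpos_of_nonpos (not_lt.1 hcon) hk'.le
        linarith [hsign j]
      have h4 : l < h2 j y₀ := by have := hlj j; rwa [abs_of_pos h3] at this
      exact ((hcc j).eventually (lt_mem_nhds h4)).mono fun y hy => le_of_lt hy
    · right
      rw [eventually_all]
      intro j
      have h3 : h2 j y₀ < 0 := by
        by_contra hcon
        have := mul_nonneg (not_lt.1 hcon) hk'.le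
        linarith [hsign j]
      have h4 : h2 j y₀ < -l := by have := hlj j; rw [abs_of_neg h3] at this; linarith
      exact ((hcc j).eventually (gt_mem_nhds h4)).mono fun y hy => le_of_lt hy
  -- The alternative between the two signs is encoded in one proposition c, so that it can be
  -- combined with the other conditions into a single neighbourhood of y₀.
  have hcurved' : ∃ c : Prop, ∀ᶠ y in 𝓝 y₀, (c → ∀ j, l ≤ h2 j y) ∧ (¬ c → ∀ j, h2 j y ≤ -l) := by
    rcases hcurved with h3 | h3
    · exact ⟨True, h3.mono fun y hy => ⟨fun _ => hy, fun h => absurd trivial h⟩⟩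
    · exact ⟨False, h3.mono fun y hy => ⟨fun h => h.elim, fun _ => hy⟩⟩
  obtain ⟨c, hcur⟩ := hcurved'
  have hall : ∀ᶠ y in 𝓝 y₀, ContDiffAt ℝ 2 h y ∧ (∀ j, |h1 j y| ≤ M) ∧ y ∈ t ∧
      ((c → ∀ j, l ≤ h2 j y) ∧ (¬ c → ∀ j, h2 j y ≤ -l)) ∧ G (y, h y) = 0 ∧ graphMap k h y ∈ U := by
    filter_upwards [hc2, hMe, ht, hcur, hzero, hgU] with y a1 a2 a3 a4 a5 a6
    exact ⟨a1, a2, a3, a4, a5, a6⟩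
  obtain ⟨ρ, hρ, hball⟩ := Metric.eventually_nhds_iff_ball.1 hall
  set B := Metric.ball y₀ ρ
  -- The implicit function is controlled only near y₀; it is replaced by a globally Lipschitz
  -- extension with the same values, hence the same derivatives, on the open ball B.
  obtain ⟨g, hgK, hgeq⟩ := (hKt.mono (fun y hy => (hball y hy).2.2.1 : B ⊆ t)).extend_real
  have hgnear : ∀ y ∈ B, g =ᶠ[𝓝 y] h := fun y hy =>
    Filter.eventuallyEq_of_mem (Metric.isOpen_ball.mem_nhds hy) fun z hz => (hgeq hz).symm
  have hbox : (Set.univ.pi fun i => Set.Icc (y₀ i - ρ / 2) (y₀ i - ρ / 2 + ρ)) ⊆ B := by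
    intro y hy
    rw [Metric.mem_ball, dist_pi_lt_iff hρ]
    intro i
    have := hy i (Set.mem_univ i)
    rw [Real.dist_eq, abs_lt]
    constructor <;> linarith [this.1, this.2]
  have hcubeB : cube (fun i => y₀ i - ρ / 2) ρ ⊆ B := fun y hy =>
    hbox fun i hi => Set.Ico_subset_Icc_self (hy i hi)
  have hgr : ∀ y ∈ B, graphMap k g y = graphMap k h y := fun y hy => by
    unfold graphMap; rw [hgeq hy]
  refine ⟨k, g, h1, h2, B, M, l, K, fun i => y₀ i - ρ / 2, ρ, hM0, hl0, hρ, ?_, hgK, hbox, ?_, ?_⟩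
  · refine ⟨fun y hy j => ?_, fun y hy j => ?_, fun j y hy => ?_, fun y hy => (hball y hy).2.1, ?_⟩
    · have h3 := hasDerivAt_update_comp ((hball y hy).1.differentiableAt (by simp)) j
      refine h3.congr_of_eventuallyEq ?_
      have h4 : Tendsto (fun s => Function.update y j s) (𝓝 (y j)) (𝓝 y) := by
        have := (continuous_update_line y j).tendsto (y j)
        rwa [Function.update_eq_self] at this
      exact h4.eventually (hgnear y hy)
    · exact hasDerivAt_update_comp ((hd1 y (hball y hy).1 j).differentiableAt (by simp)) j
    · exact (hcont2 y (hball y hy).1 j).continuousWithinAt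
    · by_cases hc' : c
      · exact Or.inl fun y hy => (hball y hy).2.2.2.1.1 hc'
      · exact Or.inr fun y hy => (hball y hy).2.2.2.1.2 hc'
  · rintro _ ⟨y, hy, rfl⟩
    rw [hgr y (hcubeB hy)]
    have h3 := hball y (hcubeB hy)
    exact (hF.zero_iff _ h3.2.2.2.2.2).2 h3.2.2.2.2.1
  · have c1 : Tendsto (fun z : Euc (e + 2) => (removeCoord k z, z k)) (𝓝 x) (𝓝 u) := by
      have : Continuous fun z : Euc (e + 2) => (removeCoord k z, z k) := by
        have := continuous_removeCoord k
        fun_prop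
      exact this.tendsto x
    have c2 : ∀ᶠ z in 𝓝 x, removeCoord k z ∈ Metric.ball y₀ (ρ / 2) :=
      (continuous_removeCoord k).continuousAt.preimage_mem_nhds (Metric.ball_mem_nhds _ (by positivity))
    refine ⟨_, (c1.eventually hiff).and (c2.and hUx), ?_⟩
    rintro z ⟨hzS, hz1, hz2, hzU⟩
    have hzc : removeCoord k z ∈ cube (fun i => y₀ i - ρ / 2) ρ := by
      intro i _
      have := (dist_pi_lt_iff (by positivity)).1 hz2 i
      rw [Real.dist_eq, abs_lt] at this
      constructor <;> linarith [this.1, this.2]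
    refine ⟨removeCoord k z, hzc, ?_⟩
    rw [hgr _ (hcubeB hzc), ← insertCLM_graph]
    have h3 : h (removeCoord k z) = z k := by
      refine hz1.1 ?_
      simp only [hG, insertCLM_removeCoord]
      exact (hF.zero_iff z hzU).1 hzS
    rw [h3, insertCLM_removeCoord]

end Patches

/-! ### Comparison of the surface measure with Lebesgue measure in a chart -/

section MeasureComparison

theorem LipschitzWith.euclideanHausdorffMeasure_image_le {X Y : Type*} [EMetricSpace X]
    [MeasurableSpace X] [BorelSpace X] [EMetricSpace Y] [MeasurableSpace Y] [BorelSpace Y]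
    {K : NNReal} {f : X → Y} (hf : LipschitzWith K f) (d : ℕ) (s : Set X) :
    (μHE[d] : Measure Y) (f '' s) ≤ (K : ℝ≥0∞) ^ d * (μHE[d] : Measure X) s := by
  rw [Measure.euclideanHausdorffMeasure_def, Measure.euclideanHausdorffMeasure_def,
    Measure.smul_apply, Measure.smul_apply, ENNReal.smul_def, ENNReal.smul_def, smul_eq_mul,
    smul_eq_mul, mul_left_comm]
  refine mul_le_mul_right ?_ _
  simpa using hf.hausdorffMeasure_image_le (d := (d : ℝ)) (Nat.cast_nonneg d) s

theorem exists_lipschitzWith_insertCLM {d : ℕ} (k : Fin (d + 1)) :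
    ∃ C : NNReal, LipschitzWith C (insertCLM k) :=
  ⟨_, ContinuousLinearMap.lipschitz _⟩

theorem exists_lipschitzWith_graphMap {d : ℕ} (k : Fin (d + 1)) {h : (Fin d → ℝ) → ℝ} {K : NNReal}
    (hh : LipschitzWith K h) : ∃ K' : NNReal, LipschitzWith K' (graphMap k h) := by
  obtain ⟨C, hC⟩ := exists_lipschitzWith_insertCLM k
  have h1 := hC.comp (LipschitzWith.id.prodMk hh)
  exact ⟨_, fun x y => h1 x y⟩

theorem lipschitzWith_toLp_removeCoord {d : ℕ} (k : Fin (d + 1)) :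
    LipschitzWith 1 fun x : Euc (d + 1) => (WithLp.toLp 2 (removeCoord k x) : Euc d) := by
  refine LipschitzWith.of_dist_le_mul fun x y => ?_
  rw [NNReal.coe_one, one_mul, EuclideanSpace.dist_eq, EuclideanSpace.dist_eq,
    Fin.sum_univ_succAbove _ k]
  refine Real.sqrt_le_sqrt ?_
  simp only [removeCoord]
  exact le_add_of_nonneg_left (sq_nonneg _)

theorem euclideanHausdorffMeasure_preimage_ofLp {d : ℕ} {s : Set (Fin d → ℝ)}
    (hs : MeasurableSet s) :
    (μHE[d] : Measure (Euc d)) ((fun x : Euc d => (WithLp.ofLp x : Fin d → ℝ)) ⁻¹' s) = volume s := by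
  rw [EuclideanSpace.euclideanHausdorffMeasure_eq_volume]
  exact (PiLp.volume_preserving_ofLp (Fin d)).measure_preimage hs.nullMeasurableSet

/-- A Lipschitz map enlarges Hausdorff measure by at most K^d. Together with `map_graph_le` this
makes surface measure comparable with Lebesgue measure in the chart, which is enough for bounds up
to constants and avoids the area formula. -/
theorem restrict_graph_le {d : ℕ} {k : Fin (d + 1)} {h : (Fin d → ℝ) → ℝ} {K : NNReal}
    (hK : LipschitzWith K (graphMap k h)) {Q : Set (Fin d → ℝ)} (hQ : MeasurableSet Q) :
    (μHE[d] : Measure (Euc (d + 1))).restrict (graphMap k h '' Q) ≤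
      (K : ℝ≥0∞) ^ d • (volume.restrict Q).map (graphMap k h) := by
  refine Measure.le_iff.2 fun A hA => ?_
  have hm : Measurable (graphMap k h) := hK.continuous.measurable
  rw [Measure.restrict_apply hA, Measure.smul_apply, Measure.map_apply hm hA,
    Measure.restrict_apply (hm hA), smul_eq_mul, ← euclideanHausdorffMeasure_preimage_ofLp
      ((hm hA).inter hQ)]
  have hl : LipschitzWith K fun x : Euc d => graphMap k h (WithLp.ofLp x) := by
    have := hK.comp (PiLp.lipschitzWith_ofLp 2 (fun _ : Fin d => ℝ))
    rw [mul_one] at this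
    exact this
  refine le_trans (measure_mono ?_) (hl.euclideanHausdorffMeasure_image_le d _)
  rintro z ⟨hzA, y, hy, rfl⟩
  exact ⟨WithLp.toLp 2 y, ⟨hzA, hy⟩, rfl⟩

/-- Forgetting the k-th coordinate is 1-Lipschitz and inverts the graph map, so it does not increase
Hausdorff measure. -/
theorem map_graph_le {d : ℕ} {k : Fin (d + 1)} {h : (Fin d → ℝ) → ℝ}
    (hm : Measurable (graphMap k h)) {Q : Set (Fin d → ℝ)} (hQ : MeasurableSet Q)
    {S : Set (Euc (d + 1))} (hS : graphMap k h '' Q ⊆ S) :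
    (volume.restrict Q).map (graphMap k h) ≤ surfaceMeasure S := by
  refine Measure.le_iff.2 fun A hA => ?_
  rw [surfaceMeasure, Nat.add_sub_cancel, Measure.restrict_apply hA, Measure.map_apply hm hA,
    Measure.restrict_apply (hm hA), ← euclideanHausdorffMeasure_preimage_ofLp ((hm hA).inter hQ)]
  have := (lipschitzWith_toLp_removeCoord k).euclideanHausdorffMeasure_image_le d (A ∩ S)
  rw [ENNReal.coe_one, one_pow, one_mul] at this
  refine le_trans (measure_mono ?_) this
  rintro y ⟨hyA, hyQ⟩
  refine ⟨graphMap k h (WithLp.ofLp y), ⟨hyA, hS ⟨_, hyQ, rfl⟩⟩, ?_⟩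
  simp only [removeCoord_graphMap]

end MeasureComparison

/-! ### Almost orthogonality -/

section AlmostOrthogonal

/-- Cauchy–Schwarz for a finite measure, obtained by integrating the pointwise inequality ‖s‖ ≤ ‖s‖²
/ (2√V) + √V / 2. -/
theorem integral_norm_le_of_integral_sq_le {α : Type*} [MeasurableSpace α] {ν : Measure α}
    [IsFiniteMeasure ν] {s : α → ℂ} (h1 : Integrable (fun y => ‖s y‖) ν)
    (h2 : Integrable (fun y => ‖s y‖ ^ 2) ν) {V : ℝ} (hV : 0 < V)
    (hs : ∫ y, ‖s y‖ ^ 2 ∂ν ≤ ν.real Set.univ * V) :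
    ∫ y, ‖s y‖ ∂ν ≤ ν.real Set.univ * √V := by
  have hT : 0 < √V := Real.sqrt_pos.2 hV
  have hTT : √V * √V = V := Real.mul_self_sqrt hV.le
  have h3 : ∫ y, ‖s y‖ ∂ν ≤ ∫ y, ((2 * √V)⁻¹ * ‖s y‖ ^ 2 + √V / 2) ∂ν := by
    refine integral_mono h1 ((h2.const_mul _).add (integrable_const _)) fun y => ?_
    have h4 : (2 * √V)⁻¹ * ‖s y‖ ^ 2 + √V / 2 - ‖s y‖ = (2 * √V)⁻¹ * (‖s y‖ - √V) ^ 2 := by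
      field_simp; ring
    have h5 : 0 ≤ (2 * √V)⁻¹ * (‖s y‖ - √V) ^ 2 := by positivity
    simp only; linarith
  refine h3.trans ?_
  rw [integral_add (h2.const_mul _) (integrable_const _), integral_const_mul, integral_const,
    smul_eq_mul]
  calc _ ≤ (2 * √V)⁻¹ * (ν.real Set.univ * V) + ν.real Set.univ * (√V / 2) := by gcongr
    _ = ν.real Set.univ * √V := by
      rw [← hTT]; field_simp; rw [Real.sqrt_sq hT.le]; ring

/-- The L² norm is expanded: the diagonal contributes ν(univ) ∑ ‖c i‖², and the rest at most η (∑ ‖c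
i‖)² ≤ η · card ι · ∑ ‖c i‖², which `hκη` compares with the diagonal. Finiteness of ν then passes
from L² to L¹. -/
theorem integral_norm_sum_le_of_almost_orthogonal {α ι : Type*} [Fintype ι] [MeasurableSpace α]
    {ν : Measure α} [IsFiniteMeasure ν] {e : ι → α → ℂ} (he : ∀ i, AEStronglyMeasurable (e i) ν)
    (he1 : ∀ i y, ‖e i y‖ ≤ 1) {η κ : ℝ} (hη : 0 ≤ η) (hκ : 0 ≤ κ)
    (ho : ∀ i j, i ≠ j → ‖∫ y, e i y * (starRingEnd ℂ) (e j y) ∂ν‖ ≤ η)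
    (hκη : Fintype.card ι * η ≤ κ * ν.real Set.univ) (c : ι → ℂ) :
    ∫ y, ‖∑ i, e i y * c i‖ ∂ν ≤ ν.real Set.univ * √((1 + κ) * ∑ i, ‖c i‖ ^ 2) := by
  classical
  by_cases hc : ∀ i, c i = 0
  · simp [hc]
  push Not at hc
  obtain ⟨i₀, hi₀⟩ := hc
  have hpos : 0 < ∑ i, ‖c i‖ ^ 2 := by
    have h1 : 0 < ‖c i₀‖ ^ 2 := pow_pos (norm_pos_iff.2 hi₀) 2
    exact h1.trans_le (Finset.single_le_sum (f := fun i => ‖c i‖ ^ 2)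
      (fun i _ => sq_nonneg _) (Finset.mem_univ i₀))
  have hm : AEStronglyMeasurable (fun y => ∑ i, e i y * c i) ν :=
    Finset.aestronglyMeasurable_fun_sum _ fun i _ => (he i).mul_const _
  have hb : ∀ y, ‖∑ i, e i y * c i‖ ≤ ∑ i, ‖c i‖ := fun y =>
    (norm_sum_le _ _).trans (Finset.sum_le_sum fun i _ => by
      rw [norm_mul]; exact mul_le_of_le_one_left (norm_nonneg _) (he1 i y))
  have i1 : Integrable (fun y => ‖∑ i, e i y * c i‖) ν :=
    Integrable.of_bound hm.norm (∑ i, ‖c i‖) (Eventually.of_forall fun y => by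
      rw [norm_norm]; exact hb y)
  have i2 : Integrable (fun y => ‖∑ i, e i y * c i‖ ^ 2) ν :=
    Integrable.of_bound (hm.norm.pow 2) ((∑ i, ‖c i‖) ^ 2) (Eventually.of_forall fun y => by
      rw [norm_pow, norm_norm]; exact pow_le_pow_left₀ (norm_nonneg _) (hb y) 2)
  refine integral_norm_le_of_integral_sq_le i1 i2 (by positivity) ?_
  have i3 : ∀ i j, Integrable (fun y => e i y * (starRingEnd ℂ) (e j y)) ν := fun i j => by
    refine Integrable.of_bound ((he i).mul
      (Complex.continuous_conj.comp_aestronglyMeasurable (he j))) 1 (Eventually.of_forall fun y => ?_)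
    rw [norm_mul, RCLike.norm_conj]
    exact mul_le_one₀ (he1 i y) (norm_nonneg _) (he1 j y)
  have key : ((∫ y, ‖∑ i, e i y * c i‖ ^ 2 ∂ν : ℝ) : ℂ) =
      ∑ i, ∑ j, (c i * (starRingEnd ℂ) (c j)) * ∫ y, e i y * (starRingEnd ℂ) (e j y) ∂ν := by
    rw [← integral_complex_ofReal]
    have : ∀ y, ((‖∑ i, e i y * c i‖ ^ 2 : ℝ) : ℂ) =
        ∑ i, ∑ j, (c i * (starRingEnd ℂ) (c j)) * (e i y * (starRingEnd ℂ) (e j y)) := by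
      intro y
      rw [Complex.ofReal_pow, ← Complex.mul_conj', map_sum, Finset.sum_mul_sum]
      refine Finset.sum_congr rfl fun i _ => Finset.sum_congr rfl fun j _ => ?_
      rw [map_mul]; ring
    simp_rw [this]
    rw [integral_finsetSum _ fun i _ => integrable_finsetSum _ fun j _ => (i3 i j).const_mul _]
    refine Finset.sum_congr rfl fun i _ => ?_
    rw [integral_finsetSum _ fun j _ => (i3 i j).const_mul _]
    refine Finset.sum_congr rfl fun j _ => ?_
    rw [integral_const_mul]
  have hnn : 0 ≤ ∫ y, ‖∑ i, e i y * c i‖ ^ 2 ∂ν := integral_nonneg fun y => sq_nonneg _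
  have hij : ∀ i j, ‖∫ y, e i y * (starRingEnd ℂ) (e j y) ∂ν‖ ≤
      (if i = j then ν.real Set.univ else 0) + η := by
    intro i j
    by_cases hij : i = j
    · subst hij
      rw [if_pos rfl]
      refine (norm_integral_le_of_norm_le_const (C := 1) (Eventually.of_forall fun y => ?_)).trans
        (by linarith)
      rw [norm_mul, RCLike.norm_conj]
      exact mul_le_one₀ (he1 i y) (norm_nonneg _) (he1 i y)
    · rw [if_neg hij, zero_add]; exact ho i j hij
  calc ∫ y, ‖∑ i, e i y * c i‖ ^ 2 ∂ν
      = ‖((∫ y, ‖∑ i, e i y * c i‖ ^ 2 ∂ν : ℝ) : ℂ)‖ := by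
        rw [Complex.norm_real, Real.norm_of_nonneg hnn]
    _ ≤ ∑ i, ∑ j, ‖c i‖ * ‖c j‖ * ((if i = j then ν.real Set.univ else 0) + η) := by
        rw [key]
        refine (norm_sum_le _ _).trans (Finset.sum_le_sum fun i _ => (norm_sum_le _ _).trans
          (Finset.sum_le_sum fun j _ => ?_))
        rw [norm_mul, norm_mul, RCLike.norm_conj]
        exact mul_le_mul_of_nonneg_left (hij i j) (by positivity)
    _ = ν.real Set.univ * ∑ i, ‖c i‖ ^ 2 + (∑ i, ‖c i‖) ^ 2 * η := by
        simp_rw [mul_add, Finset.sum_add_distrib, mul_ite, mul_zero, Finset.sum_ite_eq,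
          Finset.mem_univ, if_true, sq, Finset.sum_mul_sum, Finset.mul_sum, Finset.sum_mul]
        congr 1
        exact Finset.sum_congr rfl fun i _ => mul_comm _ _
    _ ≤ ν.real Set.univ * ∑ i, ‖c i‖ ^ 2 + (Fintype.card ι * ∑ i, ‖c i‖ ^ 2) * η := by
        gcongr
        simpa using sq_sum_le_card_mul_sum_sq (s := Finset.univ) (f := fun i => ‖c i‖)
    _ = ν.real Set.univ * ∑ i, ‖c i‖ ^ 2 + (∑ i, ‖c i‖ ^ 2) * (Fintype.card ι * η) := by ring
    _ ≤ ν.real Set.univ * ∑ i, ‖c i‖ ^ 2 + (∑ i, ‖c i‖ ^ 2) * (κ * ν.real Set.univ) := by gcongr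
    _ = ν.real Set.univ * ((1 + κ) * ∑ i, ‖c i‖ ^ 2) := by ring

end AlmostOrthogonal

/-! ### Square function estimate for sums of separated frequencies -/

section SquareFunction

/-- The character `ξ ↦ exp (-2πi x·ξ)`. -/
noncomputable def planeWave {n : ℕ} (x ξ : Euc n) : ℂ :=
  Complex.exp (((-2 * Real.pi * inner ℝ x ξ : ℝ) : ℂ) * Complex.I)

theorem norm_planeWave {n : ℕ} (x ξ : Euc n) : ‖planeWave x ξ‖ = 1 :=
  Complex.norm_exp_ofReal_mul_I _

theorem continuous_planeWave {n : ℕ} (x : Euc n) : Continuous (planeWave x) := by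
  unfold planeWave; fun_prop

theorem planeWave_mul_conj {n : ℕ} (x y ξ : Euc n) :
    planeWave x ξ * (starRingEnd ℂ) (planeWave y ξ) = planeWave (x - y) ξ := by
  unfold planeWave
  rw [← Complex.exp_conj, ← Complex.exp_add, inner_sub_left]
  congr 1
  simp only [map_mul, Complex.conj_ofReal, Complex.conj_I]
  push_cast
  ring

theorem sqrt_sum_sq_le {ι : Type*} [Fintype ι] (u v : ι → ℂ) :
    √(∑ i, ‖u i‖ ^ 2) ≤ √(∑ i, ‖v i‖ ^ 2) + ∑ i, ‖u i - v i‖ := by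
  have h1 : ∀ w : ι → ℂ, √(∑ i, ‖w i‖ ^ 2) = ‖(WithLp.toLp 2 w : EuclideanSpace ℂ ι)‖ := fun w => by
    rw [EuclideanSpace.norm_eq]
  have h2 : ‖(WithLp.toLp 2 (fun i => u i - v i) : EuclideanSpace ℂ ι)‖ ≤ ∑ i, ‖u i - v i‖ := by
    rw [← h1, Real.sqrt_le_left (by positivity)]
    exact Finset.sum_sq_le_sq_sum_of_nonneg fun i _ => norm_nonneg _
  rw [h1, h1]
  have h3 : (WithLp.toLp 2 u : EuclideanSpace ℂ ι) =
      WithLp.toLp 2 v + WithLp.toLp 2 (fun i => u i - v i) := by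
    ext i; simp
  rw [h3]
  exact (norm_add_le _ _).trans (by gcongr)

theorem integrableOn_cube {d : ℕ} {E : Type*} [NormedAddCommGroup E] {f : (Fin d → ℝ) → E}
    (hf : Continuous f) (a : Fin d → ℝ) (r : ℝ) : IntegrableOn f (cube a r) := by
  refine (hf.integrableOn_Icc (a := a) (b := fun i => a i + r)).mono_set fun y hy => ?_
  exact ⟨fun i => (hy i (Set.mem_univ i)).1, fun i => (hy i (Set.mem_univ i)).2.le⟩

theorem volume_real_cube {d : ℕ} (a : Fin d → ℝ) {r : ℝ} (hr : 0 ≤ r) :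
    (volume.restrict (cube a r)).real Set.univ = r ^ d := by
  rw [measureReal_def, Measure.restrict_apply_univ, volume_cube, ENNReal.toReal_pow,
    ENNReal.toReal_ofReal hr]

theorem isFiniteMeasure_restrict_cube {d : ℕ} (a : Fin d → ℝ) (r : ℝ) :
    IsFiniteMeasure (volume.restrict (cube a r)) :=
  ⟨by rw [Measure.restrict_apply_univ, volume_cube]; exact ENNReal.pow_lt_top ENNReal.ofReal_lt_top⟩

/-- On a small cube the slowly varying g i are frozen at the corner b, where almost orthogonality
with constant coefficients applies, and then released. Freezing the sum and releasing the square
function each cost at most K ρ ∑ B i pointwise, which explains the factor 1 + √(1 + κ). -/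
theorem setIntegral_cube_norm_sum_le {d n : ℕ} {ι : Type*} [Fintype ι] {Φ : (Fin d → ℝ) → Euc n}
    {K : NNReal} (hΦ : LipschitzWith K Φ) {x : ι → Euc n} {g : ι → Euc n → ℂ} {B : ι → ℝ}
    (hB : ∀ i, 0 ≤ B i) (hg : ∀ i ξ η, ‖g i ξ - g i η‖ ≤ B i * ‖ξ - η‖)
    {b : Fin d → ℝ} {ρ η κ : ℝ} (hρ : 0 ≤ ρ) (hη : 0 ≤ η) (hκ : 0 ≤ κ)
    (ho : ∀ i j, i ≠ j → ‖∫ y in cube b ρ, planeWave (x i - x j) (Φ y)‖ ≤ η)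
    (hκη : Fintype.card ι * η ≤ κ * ρ ^ d) :
    ∫ y in cube b ρ, ‖∑ i, planeWave (x i) (Φ y) * g i (Φ y)‖ ≤
      √(1 + κ) * (∫ y in cube b ρ, √(∑ i, ‖g i (Φ y)‖ ^ 2)) +
        (1 + √(1 + κ)) * (K * ρ * ∑ i, B i) * ρ ^ d := by
  have := isFiniteMeasure_restrict_cube b ρ
  have hgc : ∀ i, Continuous (g i) := fun i => by
    refine (LipschitzWith.of_dist_le_mul (K := ⟨B i, hB i⟩) fun ξ η => ?_).continuous
    rw [dist_eq_norm, dist_eq_norm]; exact hg i ξ η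
  have hΦc := hΦ.continuous
  have hpw : ∀ i, Continuous fun y => planeWave (x i) (Φ y) := fun i =>
    (continuous_planeWave (x i)).comp hΦc
  have hgΦ : ∀ i, Continuous fun y => g i (Φ y) := fun i => (hgc i).comp hΦc
  set δ : ℝ := K * ρ * ∑ i, B i with hδ
  have hdist : ∀ y ∈ cube b ρ, ∀ i, ‖g i (Φ y) - g i (Φ b)‖ ≤ B i * (K * ρ) := by
    intro y hy i
    refine (hg i _ _).trans (mul_le_mul_of_nonneg_left ?_ (hB i))
    rw [← dist_eq_norm]
    refine (hΦ.dist_le_mul y b).trans (mul_le_mul_of_nonneg_left ?_ K.2)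
    rw [dist_pi_le_iff hρ]
    intro j
    have := hy j (Set.mem_univ j)
    rw [Real.dist_eq, abs_le]; constructor <;> linarith [this.1, this.2]
  have hsum : ∀ y ∈ cube b ρ, ∑ i, ‖g i (Φ y) - g i (Φ b)‖ ≤ δ := by
    intro y hy
    rw [hδ, Finset.mul_sum]
    refine Finset.sum_le_sum fun i _ => (hdist y hy i).trans (le_of_eq ?_)
    ring
  have hsum' : ∀ y ∈ cube b ρ, ∑ i, ‖g i (Φ b) - g i (Φ y)‖ ≤ δ := by
    intro y hy; simp_rw [norm_sub_rev (g _ (Φ b))]; exact hsum y hy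
  have hvol := volume_real_cube b hρ
  have cF : Continuous fun y => ‖∑ i, planeWave (x i) (Φ y) * g i (Φ y)‖ :=
    (continuous_finsetSum _ fun i _ => (hpw i).mul (hgΦ i)).norm
  have cE : Continuous fun y => ‖∑ i, planeWave (x i) (Φ y) * g i (Φ b)‖ :=
    (continuous_finsetSum _ fun i _ => (hpw i).mul continuous_const).norm
  have cG : Continuous fun y => √(∑ i, ‖g i (Φ y)‖ ^ 2) :=
    (continuous_finsetSum _ fun i _ => (hgΦ i).norm.pow 2).sqrt
  have s1 : ∫ y in cube b ρ, ‖∑ i, planeWave (x i) (Φ y) * g i (Φ y)‖ ≤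
      (∫ y in cube b ρ, ‖∑ i, planeWave (x i) (Φ y) * g i (Φ b)‖) + δ * ρ ^ d := by
    calc _ ≤ ∫ y in cube b ρ, (‖∑ i, planeWave (x i) (Φ y) * g i (Φ b)‖ + δ) := by
          refine setIntegral_mono_on (integrableOn_cube cF b ρ)
            ((integrableOn_cube cE b ρ).add (integrable_const _)) (measurableSet_cube b ρ) ?_
          intro y hy
          have h1 : ∑ i, planeWave (x i) (Φ y) * g i (Φ y) =
              ∑ i, planeWave (x i) (Φ y) * g i (Φ b) +
                ∑ i, planeWave (x i) (Φ y) * (g i (Φ y) - g i (Φ b)) := by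
            rw [← Finset.sum_add_distrib]
            exact Finset.sum_congr rfl fun i _ => by ring
          rw [h1]
          refine (norm_add_le _ _).trans (add_le_add le_rfl ?_)
          refine (norm_sum_le _ _).trans (le_trans (le_of_eq ?_) (hsum y hy))
          exact Finset.sum_congr rfl fun i _ => by rw [norm_mul, norm_planeWave, one_mul]
      _ = _ := by
          rw [integral_add (integrableOn_cube cE b ρ) (integrable_const _), integral_const, hvol,
            smul_eq_mul, mul_comm δ]
  have s2 : ∫ y in cube b ρ, ‖∑ i, planeWave (x i) (Φ y) * g i (Φ b)‖ ≤
      ρ ^ d * √((1 + κ) * ∑ i, ‖g i (Φ b)‖ ^ 2) := by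
    rw [← hvol]
    refine integral_norm_sum_le_of_almost_orthogonal (η := η)
      (fun i => (hpw i).aestronglyMeasurable) (fun i y => (norm_planeWave _ _).le) hη hκ ?_ ?_ _
    · intro i j hij
      simp_rw [planeWave_mul_conj]
      exact ho i j hij
    · rwa [hvol]
  have s3 : ρ ^ d * √(∑ i, ‖g i (Φ b)‖ ^ 2) ≤
      (∫ y in cube b ρ, √(∑ i, ‖g i (Φ y)‖ ^ 2)) + δ * ρ ^ d := by
    calc ρ ^ d * √(∑ i, ‖g i (Φ b)‖ ^ 2) = ∫ y in cube b ρ, √(∑ i, ‖g i (Φ b)‖ ^ 2) := by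
          rw [integral_const, hvol, smul_eq_mul]
      _ ≤ ∫ y in cube b ρ, (√(∑ i, ‖g i (Φ y)‖ ^ 2) + δ) := by
          refine setIntegral_mono_on (integrable_const _)
            ((integrableOn_cube cG b ρ).add (integrable_const _)) (measurableSet_cube b ρ) ?_
          intro y hy
          exact (sqrt_sum_sq_le _ fun i => g i (Φ y)).trans (add_le_add le_rfl (hsum' y hy))
      _ = _ := by
          rw [integral_add (integrableOn_cube cG b ρ) (integrable_const _), integral_const, hvol,
            smul_eq_mul, mul_comm δ]
  rw [Real.sqrt_mul (by positivity)] at s2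
  calc _ ≤ √(1 + κ) * (ρ ^ d * √(∑ i, ‖g i (Φ b)‖ ^ 2)) + δ * ρ ^ d := by
        refine s1.trans (add_le_add (s2.trans (le_of_eq ?_)) le_rfl); ring
    _ ≤ √(1 + κ) * ((∫ y in cube b ρ, √(∑ i, ‖g i (Φ y)‖ ^ 2)) + δ * ρ ^ d) + δ * ρ ^ d := by
        gcongr
    _ = _ := by ring

/-- The `k`-th of the `m ^ d` subcubes of `cube a r`. -/
noncomputable def subcubeCorner {d : ℕ} (a : Fin d → ℝ) (r : ℝ) (m : ℕ) (k : Fin d → Fin m) :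
    Fin d → ℝ := fun i => a i + (k i : ℕ) * (r / m)

theorem floor_of_mem_subcube {d : ℕ} {a : Fin d → ℝ} {r : ℝ} (hr : 0 < r) {m : ℕ} (hm : 1 ≤ m)
    {k : Fin d → Fin m} {y : Fin d → ℝ} (hy : y ∈ cube (subcubeCorner a r m k) (r / m)) (i : Fin d) :
    ⌊(y i - a i) / (r / m)⌋₊ = k i := by
  have hm0 : (0 : ℝ) < m := by exact_mod_cast hm
  have hρ : 0 < r / m := by positivity
  have := hy i (Set.mem_univ i)
  simp only [subcubeCorner, Set.mem_Ico] at this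
  have h0 : (0 : ℝ) ≤ ((k i : ℕ) : ℝ) * (r / m) := by positivity
  rw [Nat.floor_eq_iff (div_nonneg (by linarith) hρ.le), le_div_iff₀ hρ, div_lt_iff₀ hρ]
  constructor <;> linarith

theorem cube_eq_iUnion {d : ℕ} (a : Fin d → ℝ) {r : ℝ} (hr : 0 < r) {m : ℕ} (hm : 1 ≤ m) :
    cube a r = ⋃ k : Fin d → Fin m, cube (subcubeCorner a r m k) (r / m) := by
  have hm0 : (0 : ℝ) < m := by exact_mod_cast hm
  have hρ : 0 < r / m := by positivity
  have hmr : (m : ℝ) * (r / m) = r := by field_simp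
  ext y
  rw [Set.mem_iUnion]
  constructor
  · intro hy
    have hy' : ∀ i, a i ≤ y i ∧ y i < a i + r := fun i => hy i (Set.mem_univ i)
    have hlt : ∀ i, ⌊(y i - a i) / (r / m)⌋₊ < m := fun i => by
      rw [Nat.floor_lt (div_nonneg (by linarith [(hy' i).1]) hρ.le), div_lt_iff₀ hρ, hmr]
      linarith [(hy' i).2]
    refine ⟨fun i => ⟨_, hlt i⟩, fun i _ => ?_⟩
    have h0 : 0 ≤ (y i - a i) / (r / m) := div_nonneg (by linarith [(hy' i).1]) hρ.le
    have h1 := Nat.floor_le h0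
    have h2 := Nat.lt_floor_add_one ((y i - a i) / (r / m))
    rw [le_div_iff₀ hρ] at h1
    rw [div_lt_iff₀ hρ] at h2
    simp only [subcubeCorner]
    constructor <;> linarith
  · rintro ⟨k, hk⟩ i hi
    have := hk i hi
    simp only [subcubeCorner, Set.mem_Ico] at this
    have h0 : (0 : ℝ) ≤ ((k i : ℕ) : ℝ) * (r / m) := by positivity
    have h1 : (((k i : ℕ) : ℝ) + 1) * (r / m) ≤ m * (r / m) := by
      have : ((k i : ℕ) : ℝ) + 1 ≤ m := by exact_mod_cast (k i).2
      gcongr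
    rw [hmr] at h1
    constructor <;> linarith

theorem pairwise_disjoint_subcubes {d : ℕ} (a : Fin d → ℝ) {r : ℝ} (hr : 0 < r) {m : ℕ}
    (hm : 1 ≤ m) :
    Pairwise (Function.onFun Disjoint
      fun k : Fin d → Fin m => cube (subcubeCorner a r m k) (r / m)) := by
  intro k k' hkk
  refine Set.disjoint_left.2 fun y hy hy' => hkk ?_
  ext i
  rw [← floor_of_mem_subcube hr hm hy i, floor_of_mem_subcube hr hm hy' i]

/-- The square function controls sums of well-separated modulations of Lipschitz functions in
`L¹(W)`, up to a small error. -/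
def SquareFunctionBound {n : ℕ} (σ : Measure (Euc n)) (W : Set (Euc n)) (C : ℝ) : Prop :=
  ∀ (ι : Type) [Fintype ι] (x : ι → Euc n) (g : ι → Euc n → ℂ) (B : ι → ℝ) (m : ℕ), 1 ≤ m →
    (∀ i, 0 ≤ B i) → (∀ i ξ η, ‖g i ξ - g i η‖ ≤ B i * ‖ξ - η‖) →
    (∀ i j, i ≠ j → C * (m * Fintype.card ι) ^ 2 ≤ ‖x i - x j‖) →
    ∫⁻ ξ in W, ‖∑ i, planeWave (x i) ξ * g i ξ‖ₑ ∂σ ≤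
      ENNReal.ofReal C * ∫⁻ ξ, ENNReal.ofReal √(∑ i, ‖g i ξ‖ ^ 2) ∂σ +
        ENNReal.ofReal (C / m * ∑ i, B i)

/-- A larger C strengthens the separation hypothesis and weakens the conclusion, so local bounds
with different constants can be combined. -/
theorem SquareFunctionBound.mono {n : ℕ} {σ : Measure (Euc n)} {W W' : Set (Euc n)} {C C' : ℝ}
    (h : SquareFunctionBound σ W C) (hW : W' ⊆ W) (hC : C ≤ C') : SquareFunctionBound σ W' C' := by
  intro ι _ x g B m hm hB hg hx
  refine (lintegral_mono_set hW).trans ((h ι x g B m hm hB hg fun i j hij => ?_).trans ?_)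
  · exact le_trans (by gcongr) (hx i j hij)
  · have := Finset.sum_nonneg fun i (_ : i ∈ Finset.univ) => hB i
    gcongr

theorem SquareFunctionBound.union {n : ℕ} {σ : Measure (Euc n)} {W W' : Set (Euc n)} {C C' : ℝ}
    (h0 : 0 ≤ C) (h0' : 0 ≤ C')
    (h : SquareFunctionBound σ W C) (h' : SquareFunctionBound σ W' C') :
    SquareFunctionBound σ (W ∪ W') (C + C') := by
  intro ι _ x g B m hm hB hg hx
  have hsum := Finset.sum_nonneg fun i (_ : i ∈ Finset.univ) => hB i
  refine (lintegral_union_le _ _ _).trans ((add_le_add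
    (h ι x g B m hm hB hg fun i j hij => le_trans ?_ (hx i j hij))
    (h' ι x g B m hm hB hg fun i j hij => le_trans ?_ (hx i j hij))).trans (le_of_eq ?_))
  · gcongr; linarith
  · gcongr; linarith
  · rw [ENNReal.ofReal_add h0 h0', add_div, add_mul (C / m),
      ENNReal.ofReal_add (by positivity) (by positivity)]
    ring

/-- The chart cube of side r is cut into subcubes of side r / m, and the frozen estimate is applied
on each. The freezing error gains 1 / m; the almost orthogonality stays uniform in m because the
separation grows with m. -/
theorem exists_squareFunctionBound_nhds {e : ℕ} {S : Set (Euc (e + 2))}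
    (hS : IsCompactPosDefHypersurface S) {x₀ : Euc (e + 2)} (hx₀ : x₀ ∈ S) :
    ∃ W ∈ 𝓝 x₀, ∃ C, 0 ≤ C ∧ SquareFunctionBound (surfaceMeasure S) (S ∩ W) C := by
  obtain ⟨k, h, h1, h2, B₀, M, l, K, a, r, hM, hl, hr, hcurv, hK, hbox, hgS, W, hW, hSW⟩ :=
    exists_curved_graph hS hx₀
  obtain ⟨K', hK'⟩ := exists_lipschitzWith_graphMap k hK
  obtain ⟨C₀, hC₀, hosc⟩ := norm_setIntegral_cube_graphMap_le (e := e) hM hl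
  -- With N frequencies separated by (mN)², each off-diagonal integral over a subcube of side ρ = r
  -- / m is at most C₀ / (mN) · ρ^e. The N of them in a row add up to (C₀ / r) ρ^(e+1), a multiple
  -- of the volume that does not depend on m or N.
  set κ : ℝ := C₀ / r with hκ
  have hκ0 : 0 < κ := by positivity
  set A : ℝ := (K' : ℝ) ^ (e + 1) with hA
  have hA0 : 0 ≤ A := by positivity
  set C₁ : ℝ := A * √(1 + κ) with hC₁
  set C₂ : ℝ := A * ((1 + √(1 + κ)) * (K' * r) * r ^ (e + 1)) with hC₂
  have hC₁0 : 0 ≤ C₁ := by positivity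
  have hC₂0 : 0 ≤ C₂ := by positivity
  refine ⟨W, hW, 1 + C₁ + C₂, by positivity, ?_⟩
  intro ι _ x g B m hm hB hg hx
  have hm0 : (0 : ℝ) < m := by exact_mod_cast hm
  have hm1 : (1 : ℝ) ≤ m := by exact_mod_cast hm
  have hsumB := Finset.sum_nonneg fun i (_ : i ∈ Finset.univ) => hB i
  set Φ := graphMap k h with hΦ
  have hΦc := hK'.continuous
  have hgc : ∀ i, Continuous (g i) := fun i => by
    refine (LipschitzWith.of_dist_le_mul (K := ⟨B i, hB i⟩) fun ξ η => ?_).continuous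
    rw [dist_eq_norm, dist_eq_norm]; exact hg i ξ η
  set F : Euc (e + 2) → ℂ := fun ξ => ∑ i, planeWave (x i) ξ * g i ξ with hF
  set G : Euc (e + 2) → ℝ := fun ξ => √(∑ i, ‖g i ξ‖ ^ 2) with hG
  have cF : Continuous F :=
    continuous_finsetSum _ fun i _ => (continuous_planeWave (x i)).mul (hgc i)
  have cG : Continuous G := (continuous_finsetSum _ fun i _ => (hgc i).norm.pow 2).sqrt
  have cFΦ : Continuous fun y => ‖F (Φ y)‖ := (cF.comp hΦc).norm
  have cGΦ : Continuous fun y => G (Φ y) := cG.comp hΦc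
  have hQ : ∫ y in cube a r, ‖F (Φ y)‖ ≤ √(1 + κ) * (∫ y in cube a r, G (Φ y)) +
      (1 + √(1 + κ)) * (K' * (r / m) * ∑ i, B i) * r ^ (e + 1) := by
    set N : ℝ := (Fintype.card ι : ℝ) with hN
    set ρ : ℝ := r / m with hρ
    have hρ0 : 0 < ρ := by positivity
    have hsub : ∀ q : Fin (e + 1) → Fin m,
        ∫ y in cube (subcubeCorner a r m q) ρ, ‖F (Φ y)‖ ≤
          √(1 + κ) * (∫ y in cube (subcubeCorner a r m q) ρ, G (Φ y)) +
            (1 + √(1 + κ)) * (K' * ρ * ∑ i, B i) * ρ ^ (e + 1) := by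
      intro q
      refine setIntegral_cube_norm_sum_le (η := C₀ / (m * N) * ρ ^ e) hK' hB hg hρ0.le
        (by positivity) hκ0.le ?_ ?_
      · intro i j hij
        have hN1 : 1 ≤ N := by
          have : 0 < Fintype.card ι := Fintype.card_pos_iff.2 ⟨i⟩
          rw [hN]; exact_mod_cast this
        have hmN : 1 ≤ m * N := one_le_mul_of_one_le_of_one_le hm1 hN1
        have hx1 : (m * N) ^ 2 ≤ ‖x i - x j‖ := by
          refine le_trans ?_ (hx i j hij)
          exact le_mul_of_one_le_left (sq_nonneg _) (by linarith)
        have hx2 : 1 ≤ ‖x i - x j‖ := le_trans (one_le_pow₀ hmN) hx1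
        refine (hosc k h h1 h2 B₀ hcurv hK.continuous _ ρ hρ0.le ?_ _ hx2).trans ?_
        · refine fun y hy => hbox fun i _ => ?_
          have := hy i (Set.mem_univ i)
          simp only [subcubeCorner, Set.mem_Icc] at this
          have h0 : (0 : ℝ) ≤ ((q i : ℕ) : ℝ) * (r / m) := by positivity
          have h1 : (((q i : ℕ) : ℝ) + 1) * (r / m) ≤ m * (r / m) := by
            have : ((q i : ℕ) : ℝ) + 1 ≤ m := by exact_mod_cast (q i).2
            gcongr
          have hmr : (m : ℝ) * (r / m) = r := by field_simp
          constructor <;> linarith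
        · have : m * N ≤ √‖x i - x j‖ := Real.le_sqrt_of_sq_le hx1
          gcongr
      · have e1 : κ * ρ ^ (e + 1) = C₀ / m * ρ ^ e := by
          rw [hκ, pow_succ, hρ]; field_simp
        rw [e1]
        rcases eq_or_ne N 0 with h0 | h0
        · rw [← hN, h0, zero_mul]; positivity
        · refine le_of_eq ?_
          rw [← hN]; field_simp
    rw [cube_eq_iUnion a hr hm,
      integral_iUnion_fintype (fun q => measurableSet_cube _ _) (pairwise_disjoint_subcubes a hr hm)
        (fun q => integrableOn_cube cFΦ _ _),
      integral_iUnion_fintype (fun q => measurableSet_cube _ _) (pairwise_disjoint_subcubes a hr hm)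
        (fun q => integrableOn_cube cGΦ _ _)]
    refine (Finset.sum_le_sum fun q _ => hsub q).trans (le_of_eq ?_)
    rw [Finset.sum_add_distrib, ← Finset.mul_sum, Finset.sum_const, Finset.card_univ,
      Fintype.card_fun, Fintype.card_fin, Fintype.card_fin, nsmul_eq_mul]
    have e2 : ρ ^ (e + 1) * (m : ℝ) ^ (e + 1) = r ^ (e + 1) := by
      rw [← mul_pow, hρ, div_mul_cancel₀ _ hm0.ne']
    push_cast
    rw [← e2]; ring
  have hσ : (surfaceMeasure S).restrict (S ∩ W) ≤
      (K' : ℝ≥0∞) ^ (e + 1) • (volume.restrict (cube a r)).map Φ := by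
    refine le_trans ?_ (restrict_graph_le hK' (measurableSet_cube a r))
    exact Measure.restrict_mono hSW Measure.restrict_le_self
  have hmap : (volume.restrict (cube a r)).map Φ ≤ surfaceMeasure S :=
    map_graph_le hΦc.measurable (measurableSet_cube a r) hgS
  have hKA : (K' : ℝ≥0∞) ^ (e + 1) = ENNReal.ofReal A := by
    rw [hA, ENNReal.ofReal_pow K'.coe_nonneg, ENNReal.ofReal_coe_nnreal]
  have hG0 : ∀ ξ, 0 ≤ G ξ := fun ξ => Real.sqrt_nonneg _
  have l1 : ∫⁻ y in cube a r, ‖F (Φ y)‖ₑ = ENNReal.ofReal (∫ y in cube a r, ‖F (Φ y)‖) := by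
    rw [ofReal_integral_eq_lintegral_ofReal (integrableOn_cube cFΦ a r)
      (Eventually.of_forall fun y => norm_nonneg _)]
    simp_rw [ofReal_norm]
  have l2 : ENNReal.ofReal (∫ y in cube a r, G (Φ y)) ≤
      ∫⁻ ξ, ENNReal.ofReal (G ξ) ∂surfaceMeasure S := by
    rw [ofReal_integral_eq_lintegral_ofReal (integrableOn_cube cGΦ a r)
      (Eventually.of_forall fun y => hG0 _)]
    calc _ = ∫⁻ ξ, ENNReal.ofReal (G ξ) ∂((volume.restrict (cube a r)).map Φ) := by
          rw [lintegral_map (by fun_prop) hΦc.measurable]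
      _ ≤ _ := lintegral_mono' hmap le_rfl
  calc ∫⁻ ξ in S ∩ W, ‖F ξ‖ₑ ∂surfaceMeasure S
      ≤ ∫⁻ ξ, ‖F ξ‖ₑ ∂((K' : ℝ≥0∞) ^ (e + 1) • (volume.restrict (cube a r)).map Φ) :=
        lintegral_mono' hσ le_rfl
    _ = ENNReal.ofReal A * ENNReal.ofReal (∫ y in cube a r, ‖F (Φ y)‖) := by
        rw [lintegral_smul_measure, lintegral_map (by fun_prop) hΦc.measurable, l1, smul_eq_mul, hKA]
    _ = ENNReal.ofReal (A * ∫ y in cube a r, ‖F (Φ y)‖) := (ENNReal.ofReal_mul hA0).symm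
    _ ≤ ENNReal.ofReal (C₁ * (∫ y in cube a r, G (Φ y)) + C₂ / m * ∑ i, B i) := by
        refine ENNReal.ofReal_le_ofReal ((mul_le_mul_of_nonneg_left hQ hA0).trans (le_of_eq ?_))
        rw [hC₁, hC₂]; ring
    _ ≤ ENNReal.ofReal (C₁ * (∫ y in cube a r, G (Φ y))) + ENNReal.ofReal (C₂ / m * ∑ i, B i) :=
        ENNReal.ofReal_add_le
    _ ≤ ENNReal.ofReal C₁ * (∫⁻ ξ, ENNReal.ofReal (G ξ) ∂surfaceMeasure S) +
          ENNReal.ofReal (C₂ / m * ∑ i, B i) := by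
        rw [ENNReal.ofReal_mul hC₁0]; gcongr
    _ ≤ _ := by
        gcongr <;> linarith

theorem exists_squareFunctionBound {e : ℕ} {S : Set (Euc (e + 2))}
    (hS : IsCompactPosDefHypersurface S) :
    ∃ C, 1 ≤ C ∧ SquareFunctionBound (surfaceMeasure S) S C := by
  have key : ∃ C, 0 ≤ C ∧ SquareFunctionBound (surfaceMeasure S) S C := by
    refine hS.isCompact.induction_on
      (p := fun W => ∃ C, 0 ≤ C ∧ SquareFunctionBound (surfaceMeasure S) W C) ?_ ?_ ?_ ?_
    · exact ⟨0, le_rfl, fun ι _ x g B m _ _ _ _ => by simp⟩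
    · rintro s t hst ⟨C, hC, h⟩
      exact ⟨C, hC, h.mono hst le_rfl⟩
    · rintro s t ⟨C, hC, h⟩ ⟨C', hC', h'⟩
      exact ⟨C + C', add_nonneg hC hC', h.union hC hC' h'⟩
    · intro x hx
      obtain ⟨W, hW, C, hC, h⟩ := exists_squareFunctionBound_nhds hS hx
      exact ⟨S ∩ W, inter_mem self_mem_nhdsWithin (mem_nhdsWithin_of_mem_nhds hW), C, hC, h⟩
  obtain ⟨C, hC, h⟩ := key
  exact ⟨C + 1, by linarith, h.mono subset_rfl (by linarith)⟩

end SquareFunction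

/-! ### Random signs -/

section RandomSigns

/-- The signed sum over `s`, with plus signs on `t`. -/
noncomputable def signedSum {ι : Type*} [DecidableEq ι] (s t : Finset ι) (c : ι → ℂ) : ℂ :=
  ∑ i ∈ s, if i ∈ t then c i else -c i

/-- The induction step for all sign averages below: subsets are split according to whether they
contain a. -/
theorem sum_powerset_insert_signedSum {ι : Type*} [DecidableEq ι] {a : ι} {s : Finset ι} (ha : a ∉ s)
    (c : ι → ℂ) (f : ℂ → ℝ) :
    ∑ t ∈ (insert a s).powerset, f (signedSum (insert a s) t c) =
      ∑ t ∈ s.powerset, (f (signedSum s t c + c a) + f (signedSum s t c - c a)) := by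
  rw [Finset.sum_powerset_insert ha, Finset.sum_add_distrib, add_comm]
  congr 1
  · refine Finset.sum_congr rfl fun t ht => ?_
    congr 1
    rw [signedSum, Finset.sum_insert ha, if_pos (Finset.mem_insert_self a t), add_comm, signedSum]
    congr 1
    refine Finset.sum_congr rfl fun i hi => ?_
    have : i ≠ a := fun h => ha (h ▸ hi)
    simp [this]
  · refine Finset.sum_congr rfl fun t ht => ?_
    congr 1
    have hat : a ∉ t := fun h => ha (Finset.mem_powerset.1 ht h)
    rw [signedSum, Finset.sum_insert ha, if_neg hat, signedSum]
    ring

theorem norm_add_sq_add_norm_sub_sq (x c : ℂ) :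
    ‖x + c‖ ^ 2 + ‖x - c‖ ^ 2 = 2 * ‖x‖ ^ 2 + 2 * ‖c‖ ^ 2 := by
  have := parallelogram_law_with_norm ℝ x c
  nlinarith [this]

theorem norm_add_pow_four_add_le (x c : ℂ) :
    ‖x + c‖ ^ 4 + ‖x - c‖ ^ 4 ≤ 2 * ‖x‖ ^ 4 + 12 * (‖x‖ ^ 2 * ‖c‖ ^ 2) + 2 * ‖c‖ ^ 4 := by
  have h1 := norm_add_sq_add_norm_sub_sq x c
  have h2 : |‖x + c‖ ^ 2 - ‖x - c‖ ^ 2| ≤ 4 * (‖x‖ * ‖c‖) := by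
    have e1 := norm_add_sq_real x c
    have e2 := norm_sub_sq_real x c
    have e3 := abs_real_inner_le_norm x c
    have : ‖x + c‖ ^ 2 - ‖x - c‖ ^ 2 = 4 * inner ℝ x c := by rw [e1, e2]; ring
    rw [this, abs_mul, abs_of_nonneg (by norm_num : (0 : ℝ) ≤ 4)]
    linarith
  have h3 := sq_le_sq' (abs_le.1 h2).1 (abs_le.1 h2).2
  have h4 : ‖x + c‖ ^ 4 + ‖x - c‖ ^ 4 = ((‖x + c‖ ^ 2 + ‖x - c‖ ^ 2) ^ 2 +
      (‖x + c‖ ^ 2 - ‖x - c‖ ^ 2) ^ 2) / 2 := by ring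
  rw [h4, h1]
  nlinarith [h3]

theorem sum_signedSum_sq {ι : Type*} [DecidableEq ι] (s : Finset ι) (c : ι → ℂ) :
    ∑ t ∈ s.powerset, ‖signedSum s t c‖ ^ 2 = 2 ^ s.card * ∑ i ∈ s, ‖c i‖ ^ 2 := by
  induction s using Finset.induction_on with
  | empty => simp [signedSum]
  | insert a s ha ih =>
    rw [sum_powerset_insert_signedSum ha c (fun z => ‖z‖ ^ 2)]
    simp_rw [norm_add_sq_add_norm_sub_sq]
    rw [Finset.sum_add_distrib, ← Finset.mul_sum, ih, Finset.sum_const, Finset.card_powerset,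
      Finset.card_insert_of_notMem ha, Finset.sum_insert ha, nsmul_eq_mul]
    push_cast
    ring

/-- The constant 3 closes the induction: with V the sum of squares so far, the step produces 3V² +
6V‖c a‖² + ‖c a‖⁴ at most, and this is below 3 (V + ‖c a‖²)². -/
theorem sum_signedSum_pow_four_le {ι : Type*} [DecidableEq ι] (s : Finset ι) (c : ι → ℂ) :
    ∑ t ∈ s.powerset, ‖signedSum s t c‖ ^ 4 ≤ 2 ^ s.card * (3 * (∑ i ∈ s, ‖c i‖ ^ 2) ^ 2) := by
  induction s using Finset.induction_on with
  | empty => simp [signedSum]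
  | insert a s ha ih =>
    rw [sum_powerset_insert_signedSum ha c (fun z => ‖z‖ ^ 4)]
    refine (Finset.sum_le_sum fun t _ => norm_add_pow_four_add_le _ _).trans ?_
    rw [Finset.sum_add_distrib, Finset.sum_add_distrib, ← Finset.mul_sum, ← Finset.mul_sum,
      ← Finset.sum_mul, sum_signedSum_sq, Finset.sum_const, Finset.card_powerset,
      Finset.card_insert_of_notMem ha, Finset.sum_insert ha, nsmul_eq_mul]
    push_cast
    set V := ∑ i ∈ s, ‖c i‖ ^ 2
    have h2 : (0 : ℝ) < 2 ^ s.card := by positivity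
    have h3 : 0 ≤ (2 : ℝ) ^ s.card * ‖c a‖ ^ 4 := by positivity
    rw [pow_succ (2 : ℝ)]
    nlinarith [ih, h3]

/-- Khintchine's inequality in `L¹`. -/
theorem sqrt_sum_sq_le_average {ι : Type*} [Fintype ι] [DecidableEq ι] (c : ι → ℂ) :
    2 ^ Fintype.card ι * √(∑ i, ‖c i‖ ^ 2) ≤
      2 * ∑ t : Finset ι, ‖signedSum Finset.univ t c‖ := by
  set V := ∑ i, ‖c i‖ ^ 2 with hV
  have hV0 : 0 ≤ V := by positivity
  rcases hV0.eq_or_lt with h0 | hpos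
  · rw [← h0]; simp; positivity
  have e2 := sum_signedSum_sq Finset.univ c
  have e4 := sum_signedSum_pow_four_le Finset.univ c
  rw [Finset.powerset_univ, Finset.card_univ, ← hV] at e2 e4
  set w := √V with hw
  have hw0 : 0 < w := Real.sqrt_pos.2 hpos
  have hww : V = w ^ 2 := (Real.sq_sqrt hV0).symm
  set L := 2 * w with hL
  have hL0 : 0 < L := by positivity
  -- The combination of x² and x⁴ touches x from below at x = L, so that second and fourth moments
  -- bound the first moment from below. With L = 2w the result is 9/16 of w, which exceeds the
  -- required 1/2.
  have hpt : ∀ x : ℝ, 0 ≤ x → (3 / 2) / L * x ^ 2 - 1 / (2 * L ^ 3) * x ^ 4 ≤ x := by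
    intro x hx
    have e : x - ((3 / 2) / L * x ^ 2 - 1 / (2 * L ^ 3) * x ^ 4) =
        x * ((x - L) ^ 2 * (x + 2 * L)) / (2 * L ^ 3) := by field_simp; ring
    have : 0 ≤ x * ((x - L) ^ 2 * (x + 2 * L)) / (2 * L ^ 3) := by positivity
    linarith
  have hs : (3 / 2) / L * ∑ t : Finset ι, ‖signedSum Finset.univ t c‖ ^ 2 -
      1 / (2 * L ^ 3) * ∑ t : Finset ι, ‖signedSum Finset.univ t c‖ ^ 4 ≤
        ∑ t : Finset ι, ‖signedSum Finset.univ t c‖ := by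
    rw [Finset.mul_sum, Finset.mul_sum, ← Finset.sum_sub_distrib]
    exact Finset.sum_le_sum fun t _ => hpt _ (norm_nonneg _)
  have h5 : 1 / (2 * L ^ 3) * ∑ t : Finset ι, ‖signedSum Finset.univ t c‖ ^ 4 ≤
      1 / (2 * L ^ 3) * (2 ^ Fintype.card ι * (3 * V ^ 2)) := by gcongr
  rw [e2] at hs
  have h6 : (3 / 2) / L * (2 ^ Fintype.card ι * V) -
      1 / (2 * L ^ 3) * (2 ^ Fintype.card ι * (3 * V ^ 2)) =
        2 ^ Fintype.card ι * w * (9 / 16) := by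
    rw [hww, hL]; field_simp; ring
  have h7 : 0 ≤ 2 ^ Fintype.card ι * w := by positivity
  linarith

/-- Interpolation of the parallelogram law: convexity of z^(2/p) compares the p-th powers with the
squares, and subadditivity of z^(p/2) splits the result. -/
theorem norm_add_rpow_add_le (x c : ℂ) {p : ℝ} (hp : 0 < p) (hp2 : p ≤ 2) :
    ‖x + c‖ ^ p + ‖x - c‖ ^ p ≤ 2 * ‖x‖ ^ p + 2 * ‖c‖ ^ p := by
  set u := ‖x + c‖
  set v := ‖x - c‖
  have hu : 0 ≤ u := norm_nonneg _
  have hv : 0 ≤ v := norm_nonneg _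
  have hpow : ∀ z : ℝ, 0 ≤ z → (z ^ p) ^ (2 / p) = z ^ 2 := fun z hz => by
    rw [← Real.rpow_mul hz, mul_div_cancel₀ _ hp.ne']; norm_cast
  have hpow' : ∀ z : ℝ, 0 ≤ z → (z ^ 2) ^ (p / 2) = z ^ p := fun z hz => by
    rw [← Real.rpow_natCast, ← Real.rpow_mul hz]; congr 1; push_cast; ring
  have h1 : ((1 / 2) * u ^ p + (1 / 2) * v ^ p) ^ (2 / p) ≤ (1 / 2) * u ^ 2 + (1 / 2) * v ^ 2 := by
    obtain ⟨-, hconv⟩ := convexOn_rpow (p := 2 / p) ((one_le_div hp).2 hp2)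
    have := hconv (Set.mem_Ici.2 (by positivity : 0 ≤ u ^ p))
      (Set.mem_Ici.2 (by positivity : 0 ≤ v ^ p)) (by norm_num : (0 : ℝ) ≤ 1 / 2)
      (by norm_num : (0 : ℝ) ≤ 1 / 2) (by norm_num)
    simp only [smul_eq_mul] at this
    rwa [hpow u hu, hpow v hv] at this
  have h2 : (1 / 2) * u ^ 2 + (1 / 2) * v ^ 2 = ‖x‖ ^ 2 + ‖c‖ ^ 2 := by
    have := norm_add_sq_add_norm_sub_sq x c
    linarith
  have h3 : (1 / 2) * u ^ p + (1 / 2) * v ^ p ≤ (‖x‖ ^ 2 + ‖c‖ ^ 2) ^ (p / 2) := by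
    rw [← h2]
    have h4 := Real.rpow_le_rpow (by positivity) h1 (show 0 ≤ p / 2 by positivity)
    rwa [← Real.rpow_mul (by positivity), show 2 / p * (p / 2) = 1 by field_simp,
      Real.rpow_one] at h4
  have h5 := Real.rpow_add_le_add_rpow (sq_nonneg ‖x‖) (sq_nonneg ‖c‖)
    (show 0 ≤ p / 2 by positivity) (show p / 2 ≤ 1 by linarith)
  rw [hpow' _ (norm_nonneg _), hpow' _ (norm_nonneg _)] at h5
  linarith

theorem sum_signedSum_rpow_le {ι : Type*} [DecidableEq ι] (s : Finset ι) (c : ι → ℂ) {p : ℝ}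
    (hp : 0 < p) (hp2 : p ≤ 2) :
    ∑ t ∈ s.powerset, ‖signedSum s t c‖ ^ p ≤ 2 ^ s.card * ∑ i ∈ s, ‖c i‖ ^ p := by
  induction s using Finset.induction_on with
  | empty => simp [signedSum, Real.zero_rpow hp.ne']
  | insert a s ha ih =>
    rw [sum_powerset_insert_signedSum ha c (fun z => ‖z‖ ^ p)]
    refine (Finset.sum_le_sum fun t _ => norm_add_rpow_add_le _ _ hp hp2).trans ?_
    rw [Finset.sum_add_distrib, ← Finset.mul_sum, Finset.sum_const, Finset.card_powerset,
      Finset.card_insert_of_notMem ha, Finset.sum_insert ha, nsmul_eq_mul]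
    push_cast
    rw [pow_succ]
    nlinarith [ih]

end RandomSigns

/-! ### Fourier transforms of functions supported in balls -/

theorem two_mul_ofReal (a : ℝ) : (2 : ℝ≥0∞) * ENNReal.ofReal a = ENNReal.ofReal (2 * a) := by
  rw [ENNReal.ofReal_mul zero_le_two, ENNReal.ofReal_ofNat]

section FourierBasics

variable {n : ℕ}

theorem fourier_eq_integral_planeWave (f : Euc n → ℂ) (ξ : Euc n) :
    𝓕 f ξ = ∫ v, planeWave v ξ * f v := by
  rw [Real.fourier_eq']; rfl

theorem planeWave_add (v x ξ : Euc n) : planeWave (v + x) ξ = planeWave x ξ * planeWave v ξ := by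
  unfold planeWave
  rw [← Complex.exp_add, inner_add_left]
  congr 1
  push_cast
  ring

theorem continuous_planeWave_left (ξ : Euc n) : Continuous fun v : Euc n => planeWave v ξ := by
  unfold planeWave; fun_prop

theorem integrable_planeWave_mul {f : Euc n → ℂ} (hf : Integrable f) (ξ : Euc n) :
    Integrable fun v => planeWave v ξ * f v :=
  hf.bdd_mul (continuous_planeWave_left ξ).aestronglyMeasurable
    (Eventually.of_forall fun v => (norm_planeWave v ξ).le)

theorem fourier_eq_planeWave_mul_fourier_translate (f : Euc n → ℂ) (x ξ : Euc n) :
    𝓕 f ξ = planeWave x ξ * 𝓕 (fun v => f (v + x)) ξ := by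
  rw [fourier_eq_integral_planeWave, fourier_eq_integral_planeWave,
    ← integral_add_right_eq_self _ x, ← integral_const_mul]
  refine integral_congr_ae (Eventually.of_forall fun v => ?_)
  simp only [planeWave_add]
  ring

theorem fourier_finsetSum {ι : Type*} (s : Finset ι) {f : ι → Euc n → ℂ}
    (hf : ∀ i ∈ s, Integrable (f i)) (ξ : Euc n) :
    𝓕 (fun v => ∑ i ∈ s, f i v) ξ = ∑ i ∈ s, 𝓕 (f i) ξ := by
  simp_rw [fourier_eq_integral_planeWave, Finset.mul_sum]
  exact integral_finsetSum s fun i hi => integrable_planeWave_mul (hf i hi) ξ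

theorem fourier_sub_apply {f g : Euc n → ℂ} (hf : Integrable f) (hg : Integrable g) (ξ : Euc n) :
    𝓕 (f - g) ξ = 𝓕 f ξ - 𝓕 g ξ := by
  simp_rw [fourier_eq_integral_planeWave, Pi.sub_apply, mul_sub]
  exact integral_sub (integrable_planeWave_mul hf ξ) (integrable_planeWave_mul hg ξ)

theorem fourier_fun_neg (f : Euc n → ℂ) (ξ : Euc n) : 𝓕 (fun v => -f v) ξ = -𝓕 f ξ := by
  simp_rw [fourier_eq_integral_planeWave, mul_neg, integral_neg]

theorem norm_planeWave_sub_le (v ξ η : Euc n) :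
    ‖planeWave v ξ - planeWave v η‖ ≤ 2 * Real.pi * ‖v‖ * ‖ξ - η‖ := by
  have h1 : planeWave v ξ - planeWave v η = planeWave v η *
      (Complex.exp (Complex.I * ((-2 * Real.pi * inner ℝ v (ξ - η) : ℝ) : ℂ)) - 1) := by
    unfold planeWave
    rw [mul_sub, mul_one, ← Complex.exp_add, inner_sub_right]
    congr 2
    push_cast
    ring
  rw [h1, norm_mul, norm_planeWave, one_mul]
  refine Real.norm_exp_I_mul_ofReal_sub_one_le.trans ?_
  rw [Real.norm_eq_abs, abs_mul, abs_mul, abs_neg, abs_of_nonneg zero_le_two,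
    abs_of_nonneg Real.pi_pos.le, mul_assoc (2 * Real.pi)]
  exact mul_le_mul_of_nonneg_left (abs_real_inner_le_norm _ _) (by positivity)

/-- Supplies the Lipschitz constants in `SquareFunctionBound`: for v in the support, the plane wave
is Lipschitz with constant at most 2πR. -/
theorem norm_fourier_sub_le {f : Euc n → ℂ} (hf : Integrable f) {R : ℝ}
    (hs : Function.support f ⊆ Metric.ball 0 R) (ξ η : Euc n) :
    ‖𝓕 f ξ - 𝓕 f η‖ ≤ (2 * Real.pi * R * ∫ v, ‖f v‖) * ‖ξ - η‖ := by
  rw [fourier_eq_integral_planeWave, fourier_eq_integral_planeWave,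
    ← integral_sub (integrable_planeWave_mul hf ξ) (integrable_planeWave_mul hf η)]
  calc _ ≤ ∫ v, (2 * Real.pi * R * ‖ξ - η‖) * ‖f v‖ := by
        refine norm_integral_le_of_norm_le (hf.norm.const_mul _) (Eventually.of_forall fun v => ?_)
        rw [← sub_mul, norm_mul]
        by_cases hv : f v = 0
        · simp [hv]
        · have h1 : ‖v‖ ≤ R := by
            have := hs (Function.mem_support.2 hv)
            rw [mem_ball_zero_iff] at this
            exact this.le
          refine mul_le_mul_of_nonneg_right ((norm_planeWave_sub_le v ξ η).trans ?_) (norm_nonneg _)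
          have := Real.pi_pos
          gcongr
    _ = _ := by rw [integral_const_mul]; ring

theorem continuous_fourier_of_integrable {f : Euc n → ℂ} (hf : Integrable f) : Continuous (𝓕 f) := by
  have : 𝓕 f = fun ξ => ∫ v, planeWave v ξ * f v := funext (fourier_eq_integral_planeWave f)
  rw [this]
  refine continuous_of_dominated (bound := fun v => ‖f v‖)
    (fun ξ => (integrable_planeWave_mul hf ξ).aestronglyMeasurable)
    (fun ξ => Eventually.of_forall fun v => ?_) hf.norm (Eventually.of_forall fun v => ?_)
  · rw [norm_mul, norm_planeWave, one_mul]
  · exact (continuous_planeWave v).mul continuous_const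

/-- Hölder's inequality on balls of radius at least one. -/
theorem exists_eLpNorm_one_le_of_support_subset_ball (n : ℕ) :
    ∃ V : ℝ, 0 < V ∧ ∀ (p : ℝ), 1 < p → ∀ (f : Euc n → ℂ) (R : ℝ), 1 ≤ R →
      MemLp f (ENNReal.ofReal p) → Function.support f ⊆ Metric.ball 0 R →
      Integrable f ∧
        eLpNorm f 1 volume ≤ ENNReal.ofReal (V * R ^ n) * eLpNorm f (ENNReal.ofReal p) volume := by
  set v : ℝ := (volume (Metric.ball (0 : Euc n) 1)).toReal with hv
  refine ⟨1 + v, by positivity, fun p hp f R hR hf hs => ?_⟩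
  have hR0 : 0 ≤ R := by linarith
  have hp1 : (1 : ℝ≥0∞) ≤ ENNReal.ofReal p := by
    rw [← ENNReal.ofReal_one]; exact ENNReal.ofReal_le_ofReal hp.le
  have hvol : volume (Metric.ball (0 : Euc n) R) = ENNReal.ofReal (R ^ n * v) := by
    rw [Measure.addHaar_ball_of_pos _ _ (by linarith), finrank_euclideanSpace_fin, hv, ENNReal.ofReal_mul (by positivity),
      ENNReal.ofReal_toReal measure_ball_lt_top.ne]
  have hle : eLpNorm f 1 volume ≤
      ENNReal.ofReal ((1 + v) * R ^ n) * eLpNorm f (ENNReal.ofReal p) volume := by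
    have h1 := eLpNorm_le_eLpNorm_mul_rpow_measure_univ
      (μ := volume.restrict (Metric.ball (0 : Euc n) R)) hp1 hf.1.restrict
    rw [eLpNorm_restrict_eq_of_support_subset hs, eLpNorm_restrict_eq_of_support_subset hs,
      Measure.restrict_apply_univ, hvol, ENNReal.toReal_one, ENNReal.toReal_ofReal (by linarith),
      mul_comm] at h1
    refine h1.trans (mul_le_mul_left ?_ _)
    have hexp0 : 0 ≤ 1 / 1 - 1 / p := by
      have : 1 / p ≤ 1 := (div_le_one (by linarith)).2 hp.le
      linarith
    have hexp1 : 1 / 1 - 1 / p ≤ 1 := by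
      have : 0 ≤ 1 / p := by positivity
      linarith
    have hRn : 1 ≤ R ^ n := one_le_pow₀ hR
    have hv0 : 0 ≤ v := ENNReal.toReal_nonneg
    -- The volume is enlarged to a number that is at least 1, so that the exponent 1 - 1/p can be
    -- raised to 1. This keeps the constant independent of p.
    have h2 : R ^ n * v ≤ (1 + v) * R ^ n := by nlinarith
    have h3 : 1 ≤ (1 + v) * R ^ n := one_le_mul_of_one_le_of_one_le (by linarith) hRn
    calc ENNReal.ofReal (R ^ n * v) ^ (1 / 1 - 1 / p)
        ≤ ENNReal.ofReal ((1 + v) * R ^ n) ^ (1 / 1 - 1 / p) := by gcongr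
      _ ≤ ENNReal.ofReal ((1 + v) * R ^ n) ^ (1 : ℝ) :=
          ENNReal.rpow_le_rpow_of_exponent_le (by rw [← ENNReal.ofReal_one]; gcongr) hexp1
      _ = _ := ENNReal.rpow_one _
  refine ⟨memLp_one_iff_integrable.1 ⟨hf.1, hle.trans_lt ?_⟩, hle⟩
  exact ENNReal.mul_lt_top ENNReal.ofReal_lt_top hf.2

end FourierBasics

/-! ### The estimate for sparse families of balls -/

section Sparse

variable {n : ℕ}

theorem fourier_signedSum {ι : Type*} [Fintype ι] [DecidableEq ι] {h : ι → Euc n → ℂ}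
    (hh : ∀ i, Integrable (h i)) (t : Finset ι) (ξ : Euc n) :
    𝓕 (fun v => signedSum Finset.univ t fun i => h i v) ξ =
      signedSum Finset.univ t fun i => 𝓕 (h i) ξ := by
  unfold signedSum
  have h1 : ∀ i ∈ Finset.univ, Integrable fun v => if i ∈ t then h i v else -h i v := fun i _ => by
    by_cases hi : i ∈ t
    · simpa [hi] using hh i
    · simpa [hi] using (hh i).neg
  rw [fourier_finsetSum _ h1]
  refine Finset.sum_congr rfl fun i _ => ?_
  by_cases hi : i ∈ t
  · simp [hi]
  · simp only [hi, if_false]; exact fourier_fun_neg (h i) ξ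

theorem eLpNorm_rpow_eq_lintegral {α : Type*} [MeasurableSpace α] {μ : Measure α} {p : ℝ}
    (hp : 0 < p) (f : α → ℂ) :
    eLpNorm f (ENNReal.ofReal p) μ ^ p = ∫⁻ v, ‖f v‖ₑ ^ p ∂μ := by
  rw [eLpNorm_eq_lintegral_rpow_enorm_toReal (ENNReal.ofReal_pos.2 hp).ne' ENNReal.ofReal_ne_top,
    ENNReal.toReal_ofReal hp.le, ← ENNReal.rpow_mul, one_div, inv_mul_cancel₀ hp.ne',
    ENNReal.rpow_one]

/-- Random signs have type `p` in `Lᵖ` for `1 ≤ p ≤ 2`. -/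
theorem sum_eLpNorm_signedSum_le {α ι : Type*} [MeasurableSpace α] {μ : Measure α} [Fintype ι]
    [DecidableEq ι] {p : ℝ} (hp : 1 ≤ p) (hp2 : p ≤ 2) {h : ι → α → ℂ}
    (hm : ∀ i, AEStronglyMeasurable (h i) μ) :
    ∑ t : Finset ι, eLpNorm (fun v => signedSum Finset.univ t fun i => h i v) (ENNReal.ofReal p) μ ≤
      2 ^ Fintype.card ι * (∑ i, eLpNorm (h i) (ENNReal.ofReal p) μ ^ p) ^ (1 / p) := by
  have hp0 : 0 < p := by linarith
  set T := ∑ i, eLpNorm (h i) (ENNReal.ofReal p) μ ^ p with hT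
  have hms : ∀ t : Finset ι, AEStronglyMeasurable
      (fun v => signedSum Finset.univ t fun i => h i v) μ := fun t => by
    refine Finset.aestronglyMeasurable_fun_sum _ fun i _ => ?_
    by_cases hi : i ∈ t
    · simpa [hi] using hm i
    · simp only [hi, if_false]; exact (hm i).neg
  have key : (∑ t : Finset ι, eLpNorm (fun v => signedSum Finset.univ t fun i => h i v)
      (ENNReal.ofReal p) μ) ^ p ≤ (2 ^ Fintype.card ι) ^ p * T := by
    -- Jensen's inequality over the signs moves the p-th power inside; after that the pointwise
    -- inequality for p-th powers is integrated.
    refine (ENNReal.rpow_sum_le_const_mul_sum_rpow _ _ hp).trans ?_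
    have h2 : ∑ t : Finset ι, eLpNorm (fun v => signedSum Finset.univ t fun i => h i v)
        (ENNReal.ofReal p) μ ^ p ≤ 2 ^ Fintype.card ι * T := by
      simp_rw [hT, eLpNorm_rpow_eq_lintegral hp0]
      rw [← lintegral_finsetSum' _ fun t _ => (hms t).enorm.pow_const p,
        ← lintegral_finsetSum' _ fun i _ => (hm i).enorm.pow_const p,
        ← lintegral_const_mul' _ _ (by simp)]
      refine lintegral_mono fun v => ?_
      have h3 := sum_signedSum_rpow_le Finset.univ (fun i => h i v) hp0 hp2
      rw [Finset.powerset_univ, Finset.card_univ] at h3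
      have h4 : ∀ z : ℂ, ‖z‖ₑ ^ p = ENNReal.ofReal (‖z‖ ^ p) := fun z => by
        rw [← ofReal_norm, ENNReal.ofReal_rpow_of_nonneg (norm_nonneg _) hp0.le]
      simp only [h4]
      rw [← ENNReal.ofReal_sum_of_nonneg fun _ _ => by positivity,
        ← ENNReal.ofReal_sum_of_nonneg fun _ _ => by positivity]
      have h5 : (2 : ℝ≥0∞) ^ Fintype.card ι = ENNReal.ofReal (2 ^ Fintype.card ι) := by
        rw [ENNReal.ofReal_pow zero_le_two]; simp
      rw [h5, ← ENNReal.ofReal_mul (by positivity)]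
      exact ENNReal.ofReal_le_ofReal h3
    refine (mul_le_mul_right h2 _).trans (le_of_eq ?_)
    rw [← mul_assoc, Finset.card_univ, Fintype.card_finset]
    congr 1
    push_cast
    conv_lhs => rw [← ENNReal.rpow_one ((2 : ℝ≥0∞) ^ Fintype.card ι), ← ENNReal.rpow_mul,
      ← ENNReal.rpow_add _ _ (by simp) (by simp)]
    congr 1; ring
  have h6 := ENNReal.rpow_le_rpow key (show 0 ≤ 1 / p by positivity)
  rwa [ENNReal.mul_rpow_of_nonneg _ _ (by positivity), ← ENNReal.rpow_mul, ← ENNReal.rpow_mul,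
    mul_one_div_cancel hp0.ne', ENNReal.rpow_one, ENNReal.rpow_one] at h6

/-- Translating the pieces to the origin turns the sum of transforms into a sum of separated
modulations, whose L¹(σ) norm is bounded by a square function. Khintchine's inequality linearizes it
into transforms of signed sums of the translated pieces. These are all supported in one ball of
radius R, so the number of pieces does not enter the loss R^γ. -/
theorem sparse_restriction_estimate {e : ℕ} {S : Set (Euc (e + 2))}
    (hS : IsCompactPosDefHypersurface S) {p γ : ℝ} (hp : 1 < p) (hp2 : p < 2) (hγ : 0 < γ)
    (hloc : LocalRestrictionEstimate S p γ) :
    ∃ C₁ A : ℝ, 1 ≤ C₁ ∧ 0 < A ∧ ∀ (ι : Type) [Fintype ι] (x : ι → Euc (e + 2)) (R : ℝ)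
      (f : ι → Euc (e + 2) → ℂ), 1 ≤ R → (∀ i, MemLp (f i) (ENNReal.ofReal p)) →
      (∀ i, Function.support (f i) ⊆ Metric.ball (x i) R) →
      (∀ i j, i ≠ j → C₁ * (Fintype.card ι * R) ^ (2 * e + 6) ≤ ‖x i - x j‖) →
      ∫⁻ ξ, ‖𝓕 (fun v => ∑ i, f i v) ξ‖ₑ ∂surfaceMeasure S ≤
        ENNReal.ofReal (A * R ^ γ) *
          (∑ i, eLpNorm (f i) (ENNReal.ofReal p) volume ^ p) ^ (1 / p) := by
  classical
  obtain ⟨A₀, hA₀, hest⟩ := hloc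
  obtain ⟨C, hC1, hsq⟩ := exists_squareFunctionBound hS
  obtain ⟨V, hV, hhold⟩ := exists_eLpNorm_one_le_of_support_subset_ball (e + 2)
  have hpi := Real.pi_pos
  have hp0 : 0 < p := by linarith
  -- For a nonempty family the integer m below is at most 3 N R^(e+3), so C (mN)² ≤ 9 C N⁴ R^(2e+6)
  -- ≤ 9 C (NR)^(2e+6); this is where the exponent 2e + 6 and the 9 come from.
  refine ⟨9 * C, 2 * C * A₀ + 2 * Real.pi * C * V, by linarith, by positivity, ?_⟩
  intro ι _ x R f hR hf hs hx
  have hR0 : 0 < R := by linarith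
  set N : ℝ := (Fintype.card ι : ℝ) with hN
  have hN0 : 0 ≤ N := by positivity
  set T := ∑ i, eLpNorm (f i) (ENNReal.ofReal p) volume ^ p with hT
  have hTtop : T ≠ ⊤ := by
    refine (ENNReal.sum_lt_top.2 fun i _ => ENNReal.rpow_lt_top_of_nonneg hp0.le (hf i).2.ne).ne
  have hTptop : T ^ (1 / p) ≠ ⊤ := ENNReal.rpow_ne_top_of_nonneg (by positivity) hTtop
  set H := (T ^ (1 / p)).toReal with hH
  have hH0 : 0 ≤ H := ENNReal.toReal_nonneg
  have hHT : ENNReal.ofReal H = T ^ (1 / p) := ENNReal.ofReal_toReal hTptop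
  set h : ι → Euc (e + 2) → ℂ := fun i v => f i (v + x i) with hh
  have hmp : ∀ i, MeasurePreserving (fun v : Euc (e + 2) => v + x i) volume volume := fun i =>
    measurePreserving_add_right volume (x i)
  have hhL : ∀ i, MemLp (h i) (ENNReal.ofReal p) := fun i => (hf i).comp_measurePreserving (hmp i)
  have hhn : ∀ i, eLpNorm (h i) (ENNReal.ofReal p) volume = eLpNorm (f i) (ENNReal.ofReal p) volume :=
    fun i => eLpNorm_comp_measurePreserving (hf i).1 (hmp i)
  have hhs : ∀ i, Function.support (h i) ⊆ Metric.ball 0 R := by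
    intro i v hv
    have h1 : v + x i ∈ Metric.ball (x i) R := hs i hv
    simpa [mem_ball_iff_norm] using h1
  have hhI : ∀ i, Integrable (h i) := fun i => (hhold p hp (h i) R hR (hhL i) (hhs i)).1
  have hfI : ∀ i, Integrable (f i) := fun i => by
    have := (hhI i).comp_sub_right (x i)
    simpa [hh] using this
  have hb : ∀ i, ∫ v, ‖h i v‖ ≤ V * R ^ (e + 2) * H := by
    intro i
    have h1 := (hhold p hp (h i) R hR (hhL i) (hhs i)).2
    have h2 : eLpNorm (h i) (ENNReal.ofReal p) volume ≤ T ^ (1 / p) := by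
      have h3 : eLpNorm (h i) (ENNReal.ofReal p) volume ^ p ≤ T := by
        rw [hhn i]
        exact Finset.single_le_sum
          (f := fun i => eLpNorm (f i) (ENNReal.ofReal p) volume ^ p)
          (fun _ _ => zero_le) (Finset.mem_univ i)
      have h4 := ENNReal.rpow_le_rpow h3 (show 0 ≤ 1 / p by positivity)
      rwa [← ENNReal.rpow_mul, mul_one_div_cancel hp0.ne', ENNReal.rpow_one] at h4
    have h5 := h1.trans (mul_le_mul_right h2 _)
    rw [← hHT, ← ENNReal.ofReal_mul (by positivity), eLpNorm_one_eq_lintegral_enorm,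
      ← ofReal_integral_norm_eq_lintegral_enorm (hhI i),
      ENNReal.ofReal_le_ofReal_iff (by positivity)] at h5
    exact h5
  set g : ι → Euc (e + 2) → ℂ := fun i => 𝓕 (h i) with hg
  have hsum : ∀ ξ, 𝓕 (fun v => ∑ i, f i v) ξ = ∑ i, planeWave (x i) ξ * g i ξ := fun ξ => by
    rw [fourier_finsetSum _ fun i _ => hfI i]
    exact Finset.sum_congr rfl fun i _ => fourier_eq_planeWave_mul_fourier_translate (f i) (x i) ξ
  -- Each Lipschitz constant is at most 2πR · V R^(e+2) H, so the N of them sum to a multiple of N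
  -- R^(e+3) H, and division by m leaves a multiple of H. The added 1 keeps m positive for an empty
  -- family.
  set m : ℕ := ⌈N * R ^ (e + 3)⌉₊ + 1 with hm
  have hm1 : 1 ≤ m := by omega
  have hmle : N * R ^ (e + 3) ≤ m := by
    rw [hm]; push_cast
    linarith [Nat.le_ceil (N * R ^ (e + 3))]
  have hmpos : (0 : ℝ) < m := by exact_mod_cast hm1
  have key := hsq ι x g (fun i => 2 * Real.pi * R * ∫ v, ‖h i v‖) m hm1
    (fun i => by positivity) (fun i ξ η => norm_fourier_sub_le (hhI i) (hhs i) ξ η) (by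
      intro i j hij
      refine le_trans ?_ (hx i j hij)
      have hN1 : 1 ≤ N := by
        have : 0 < Fintype.card ι := Fintype.card_pos_iff.2 ⟨i⟩
        rw [hN]; exact_mod_cast this
      have hR1 : 1 ≤ R ^ (e + 3) := one_le_pow₀ hR
      have hNR : 1 ≤ N * R ^ (e + 3) := one_le_mul_of_one_le_of_one_le hN1 hR1
      have hm3 : (m : ℝ) ≤ 3 * (N * R ^ (e + 3)) := by
        rw [hm]; push_cast
        linarith [Nat.ceil_lt_add_one (show 0 ≤ N * R ^ (e + 3) by positivity)]
      calc C * (m * N) ^ 2 ≤ C * ((3 * (N * R ^ (e + 3))) * N) ^ 2 := by gcongr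
        _ = 9 * C * (N ^ 4 * R ^ (2 * e + 6)) := by ring
        _ ≤ 9 * C * (N ^ (2 * e + 6) * R ^ (2 * e + 6)) := by
            gcongr
            omega
        _ = _ := by rw [mul_pow])
  have hrestr : (surfaceMeasure S).restrict S = surfaceMeasure S := by
    rw [surfaceMeasure, Measure.restrict_restrict hS.isCompact.isClosed.measurableSet, Set.inter_self]
  rw [hrestr] at key
  simp_rw [hsum]
  refine key.trans ?_
  -- the square function
  have hG : ∫⁻ ξ, ENNReal.ofReal √(∑ i, ‖g i ξ‖ ^ 2) ∂surfaceMeasure S ≤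
      ENNReal.ofReal (2 * A₀ * R ^ γ * H) := by
    have h1 : 2 ^ Fintype.card ι *
        ∫⁻ ξ, ENNReal.ofReal √(∑ i, ‖g i ξ‖ ^ 2) ∂surfaceMeasure S ≤
        2 * ∑ t : Finset ι, ∫⁻ ξ, ‖𝓕 (fun v => signedSum Finset.univ t fun i => h i v) ξ‖ₑ
          ∂surfaceMeasure S := by
      have hcont : ∀ t : Finset ι,
          Continuous (𝓕 (fun v => signedSum Finset.univ t fun i => h i v)) := fun t => by
        refine continuous_fourier_of_integrable (integrable_finsetSum _ fun i _ => ?_)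
        by_cases hi : i ∈ t
        · simpa [hi] using hhI i
        · simpa [hi] using (hhI i).neg
      rw [← lintegral_finsetSum _ fun t _ => (hcont t).measurable.enorm,
        ← lintegral_const_mul' _ _ (by simp), ← lintegral_const_mul' _ _ (by simp)]
      refine lintegral_mono fun ξ => ?_
      simp_rw [fourier_signedSum hhI, ← ofReal_norm]
      have h2 := sqrt_sum_sq_le_average fun i => g i ξ
      have h5 : (2 : ℝ≥0∞) ^ Fintype.card ι = ENNReal.ofReal (2 ^ Fintype.card ι) := by
        rw [ENNReal.ofReal_pow zero_le_two]; simp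
      rw [h5, ← ENNReal.ofReal_mul (by positivity),
        ← ENNReal.ofReal_sum_of_nonneg fun _ _ => norm_nonneg _, two_mul_ofReal]
      exact ENNReal.ofReal_le_ofReal h2
    have h2 : ∀ t : Finset ι,
        ∫⁻ ξ, ‖𝓕 (fun v => signedSum Finset.univ t fun i => h i v) ξ‖ₑ ∂surfaceMeasure S ≤
          ENNReal.ofReal (A₀ * R ^ γ) *
            eLpNorm (fun v => signedSum Finset.univ t fun i => h i v) (ENNReal.ofReal p) volume := by
      intro t
      rw [← eLpNorm_one_eq_lintegral_enorm]
      refine hest R hR _ (memLp_finsetSum _ fun i _ => ?_) ?_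
      · by_cases hi : i ∈ t
        · simpa [hi] using hhL i
        · simp only [hi, if_false]; exact (hhL i).neg
      · intro v hv
        by_contra hcon
        refine hv ?_
        have : ∀ i, h i v = 0 := fun i => by
          by_contra h0; exact hcon (hhs i h0)
        simp [signedSum, this]
    have h3 := sum_eLpNorm_signedSum_le hp.le hp2.le (fun i => (hhL i).1)
    simp_rw [hhn] at h3
    rw [← hT, ← hHT] at h3
    have h4 : 2 ^ Fintype.card ι *
        ∫⁻ ξ, ENNReal.ofReal √(∑ i, ‖g i ξ‖ ^ 2) ∂surfaceMeasure S ≤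
        2 ^ Fintype.card ι * ENNReal.ofReal (2 * A₀ * R ^ γ * H) := by
      calc _ ≤ 2 * ∑ t : Finset ι, ENNReal.ofReal (A₀ * R ^ γ) *
            eLpNorm (fun v => signedSum Finset.univ t fun i => h i v) (ENNReal.ofReal p) volume :=
            h1.trans (mul_le_mul_right (Finset.sum_le_sum fun t _ => h2 t) _)
        _ ≤ 2 * (ENNReal.ofReal (A₀ * R ^ γ) * (2 ^ Fintype.card ι * ENNReal.ofReal H)) := by
            rw [← Finset.mul_sum]; gcongr
        _ = 2 ^ Fintype.card ι * (2 * ENNReal.ofReal (A₀ * R ^ γ) * ENNReal.ofReal H) := by ring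
        _ = _ := by
            rw [two_mul_ofReal, ← ENNReal.ofReal_mul (by positivity)]
            congr 2
            ring
    exact (ENNReal.mul_le_mul_iff_right (by simp) (by simp)).1 h4
  have herr : C / m * ∑ i, 2 * Real.pi * R * ∫ v, ‖h i v‖ ≤ 2 * Real.pi * C * V * H := by
    have h1 : ∑ i, 2 * Real.pi * R * ∫ v, ‖h i v‖ ≤
        ∑ i : ι, 2 * Real.pi * R * (V * R ^ (e + 2) * H) := by
      gcongr with i; exact hb i
    rw [Finset.sum_const, Finset.card_univ, nsmul_eq_mul, ← hN] at h1
    calc C / m * ∑ i, 2 * Real.pi * R * ∫ v, ‖h i v‖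
        ≤ C / m * (N * (2 * Real.pi * R * (V * R ^ (e + 2) * H))) := by gcongr
      _ = (N * R ^ (e + 3)) / m * (2 * Real.pi * C * V * H) := by ring
      _ ≤ 1 * (2 * Real.pi * C * V * H) := by
          gcongr
          exact (div_le_one hmpos).2 hmle
      _ = _ := one_mul _
  have hRγ : 1 ≤ R ^ γ := Real.one_le_rpow hR hγ.le
  calc _ ≤ ENNReal.ofReal C * ENNReal.ofReal (2 * A₀ * R ^ γ * H) +
        ENNReal.ofReal (2 * Real.pi * C * V * H) := by gcongr
    _ = ENNReal.ofReal (C * (2 * A₀ * R ^ γ * H) + 2 * Real.pi * C * V * H) := by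
        rw [← ENNReal.ofReal_mul (by linarith), ENNReal.ofReal_add (by positivity) (by positivity)]
    _ ≤ ENNReal.ofReal ((2 * C * A₀ + 2 * Real.pi * C * V) * R ^ γ * H) := by
        refine ENNReal.ofReal_le_ofReal ?_
        have h1 : 2 * Real.pi * C * V * H ≤ 2 * Real.pi * C * V * H * R ^ γ :=
          le_mul_of_one_le_right (by positivity) hRγ
        linarith
    _ = _ := by rw [ENNReal.ofReal_mul (by positivity), hHT]

end Sparse

/-! ### Smoothing at unit scale -/

section Smoothing

open scoped Convolution

/-- The normalized indicator function of a ball centred at the origin. -/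
noncomputable def ballBump (n : ℕ) (ε : ℝ) : Euc n → ℂ :=
  (Metric.ball (0 : Euc n) ε).indicator fun _ => (((volume.real (Metric.ball (0 : Euc n) ε))⁻¹ : ℝ) : ℂ)

variable {n : ℕ} {ε : ℝ}

theorem volume_real_ball_pos (hε : 0 < ε) : 0 < volume.real (Metric.ball (0 : Euc n) ε) :=
  ENNReal.toReal_pos (Metric.measure_ball_pos _ _ hε).ne' measure_ball_lt_top.ne

theorem integrable_ballBump : Integrable (ballBump n ε) :=
  (integrableOn_const measure_ball_lt_top.ne).integrable_indicator measurableSet_ball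

theorem integral_ballBump (hε : 0 < ε) : ∫ v, ballBump n ε v = 1 := by
  rw [ballBump, integral_indicator measurableSet_ball, setIntegral_const, Complex.real_smul,
    ← Complex.ofReal_mul, mul_inv_cancel₀ (volume_real_ball_pos hε).ne', Complex.ofReal_one]

theorem enorm_ballBump (hε : 0 < ε) (v : Euc n) : ‖ballBump n ε v‖ₑ =
    (Metric.ball (0 : Euc n) ε).indicator
      (fun _ => ENNReal.ofReal (volume.real (Metric.ball (0 : Euc n) ε))⁻¹) v := by
  have h := volume_real_ball_pos (n := n) hε
  unfold ballBump
  by_cases hv : v ∈ Metric.ball (0 : Euc n) ε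
  · rw [Set.indicator_of_mem hv, Set.indicator_of_mem hv, ← ofReal_norm, Complex.norm_real,
      Real.norm_of_nonneg (by positivity)]
  · rw [Set.indicator_of_notMem hv, Set.indicator_of_notMem hv, enorm_zero]

theorem lintegral_enorm_ballBump (hε : 0 < ε) : ∫⁻ v, ‖ballBump n ε v‖ₑ = 1 := by
  have h := volume_real_ball_pos (n := n) hε
  simp_rw [enorm_ballBump hε]
  rw [lintegral_indicator measurableSet_ball, setLIntegral_const, ← ENNReal.ofReal_toReal
    (measure_ball_lt_top (μ := volume) (x := (0 : Euc n)) (r := ε)).ne, ← measureReal_def,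
    ← ENNReal.ofReal_mul (by positivity), inv_mul_cancel₀ h.ne', ENNReal.ofReal_one]

/-- The transform of the bump equals 1 at the origin and has Lipschitz constant 2πε, so for small ε
it stays within 1/2 of 1 on a bounded set. -/
theorem exists_half_le_norm_fourier_ballBump {S : Set (Euc n)} (hS : Bornology.IsBounded S) :
    ∃ ε : ℝ, 0 < ε ∧ ε ≤ 1 ∧ ∀ ξ ∈ S, 1 / 2 ≤ ‖𝓕 (ballBump n ε) ξ‖ := by
  obtain ⟨M, hM⟩ := hS.exists_norm_le
  have hpi := Real.pi_gt_three
  set ε : ℝ := 1 / (4 * Real.pi * (|M| + 1)) with hε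
  have hM0 := abs_nonneg M
  have hε0 : 0 < ε := by positivity
  refine ⟨ε, hε0, ?_, fun ξ hξ => ?_⟩
  · rw [hε, div_le_one (by positivity)]
    nlinarith
  · have h1 : ‖𝓕 (ballBump n ε) ξ - 𝓕 (ballBump n ε) 0‖ ≤ 1 / 2 := by
      refine (norm_fourier_sub_le integrable_ballBump (R := ε) ?_ ξ 0).trans ?_
      · exact Set.support_indicator_subset
      · have h2 : ∫ v, ‖ballBump n ε v‖ = 1 := by
          rw [integral_norm_eq_lintegral_enorm integrable_ballBump.aestronglyMeasurable,
            lintegral_enorm_ballBump hε0, ENNReal.toReal_one]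
        rw [h2, sub_zero, mul_one]
        have h3 : ‖ξ‖ ≤ |M| + 1 := (hM ξ hξ).trans (by linarith [le_abs_self M])
        calc 2 * Real.pi * ε * ‖ξ‖ ≤ 2 * Real.pi * ε * (|M| + 1) := by gcongr
          _ = 1 / 2 := by rw [hε]; field_simp; norm_num
    have h4 : 𝓕 (ballBump n ε) (0 : Euc n) = 1 := by
      rw [fourier_eq_integral_planeWave, ← integral_ballBump (n := n) hε0]
      exact integral_congr_ae (Eventually.of_forall fun v => by simp [planeWave])
    rw [h4] at h1
    have h5 := norm_sub_norm_le (1 : ℂ) (1 - 𝓕 (ballBump n ε) ξ)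
    rw [sub_sub_cancel, norm_one, norm_sub_rev] at h5
    linarith

/-- The average of `f` over balls of radius `ε`. -/
noncomputable def ballAverage (ε : ℝ) (f : Euc n → ℂ) : Euc n → ℂ :=
  f ⋆[ContinuousLinearMap.mul ℂ ℂ] ballBump n ε

theorem fourier_ballAverage {f : Euc n → ℂ} (hf : Integrable f) (ξ : Euc n) :
    𝓕 (ballAverage ε f) ξ = 𝓕 f ξ * 𝓕 (ballBump n ε) ξ :=
  Real.fourier_mul_convolution_eq hf integrable_ballBump ξ

theorem integrable_ballAverage {f : Euc n → ℂ} (hf : Integrable f) :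
    Integrable (ballAverage ε f) :=
  hf.integrable_convolution _ integrable_ballBump

theorem support_ballAverage_subset {f : Euc n → ℂ} {x : Euc n} {R : ℝ}
    (hf : Function.support f ⊆ Metric.ball x R) :
    Function.support (ballAverage ε f) ⊆ Metric.ball x (R + ε) := by
  refine (support_convolution_subset _).trans ?_
  rintro _ ⟨u, hu, v, hv, rfl⟩
  have h1 := hf hu
  have h2 : v ∈ Metric.ball (0 : Euc n) ε := Set.support_indicator_subset hv
  rw [mem_ball_iff_norm] at h1 ⊢
  rw [mem_ball_zero_iff] at h2
  calc ‖u + v - x‖ = ‖(u - x) + v‖ := by congr 1; abel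
    _ ≤ ‖u - x‖ + ‖v‖ := norm_add_le _ _
    _ < R + ε := add_lt_add h1 h2

theorem enorm_ballAverage_le (f : Euc n → ℂ) (v : Euc n) :
    ‖ballAverage ε f v‖ₑ ≤ ∫⁻ t, ‖f t‖ₑ * ‖ballBump n ε (v - t)‖ₑ := by
  refine (enorm_integral_le_lintegral_enorm _).trans (le_of_eq ?_)
  refine lintegral_congr fun t => ?_
  rw [ContinuousLinearMap.mul_apply', enorm_mul]

theorem enorm_ballAverage_le_setLIntegral (hε : 0 < ε) (f : Euc n → ℂ) (v : Euc n) :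
    ‖ballAverage ε f v‖ₑ ≤ ENNReal.ofReal (volume.real (Metric.ball (0 : Euc n) ε))⁻¹ *
      ∫⁻ t in Metric.ball v ε, ‖f t‖ₑ := by
  refine (enorm_ballAverage_le f v).trans (le_of_eq ?_)
  rw [← lintegral_const_mul' _ _ ENNReal.ofReal_ne_top, ← lintegral_indicator measurableSet_ball]
  refine lintegral_congr fun t => ?_
  rw [enorm_ballBump hε]
  by_cases ht : t ∈ Metric.ball v ε
  · have h1 : v - t ∈ Metric.ball (0 : Euc n) ε := by
      rw [mem_ball_zero_iff, norm_sub_rev]; exact mem_ball_iff_norm.1 ht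
    rw [Set.indicator_of_mem h1, Set.indicator_of_mem ht, mul_comm]
  · have h1 : v - t ∉ Metric.ball (0 : Euc n) ε := fun h => ht (by
      rw [mem_ball_zero_iff, norm_sub_rev] at h; exact mem_ball_iff_norm.2 h)
    rw [Set.indicator_of_notMem h1, Set.indicator_of_notMem ht, mul_zero]

theorem lintegral_enorm_ballAverage_le (hε : 0 < ε) {f : Euc n → ℂ} (hf : Integrable f) :
    ∫⁻ v, ‖ballAverage ε f v‖ₑ ≤ ∫⁻ v, ‖f v‖ₑ := by
  refine (lintegral_mono (enorm_ballAverage_le f)).trans ?_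
  rw [lintegral_lintegral_swap]
  · refine le_of_eq (lintegral_congr fun t => ?_)
    rw [lintegral_const_mul' _ _ enorm_ne_top, lintegral_sub_right_eq_self fun v => ‖ballBump n ε v‖ₑ,
      lintegral_enorm_ballBump hε, mul_one]
  · have h1 := (hf.convolution_integrand (ContinuousLinearMap.mul ℂ ℂ)
      (integrable_ballBump (n := n) (ε := ε))).aestronglyMeasurable.enorm
    refine h1.congr (Eventually.of_forall fun q => ?_)
    simp [Function.uncurry, enorm_mul]

/-- The estimate `‖f̂‖_{L¹(σ)} ≤ A R^γ a^{1-1/p} b^{1/p}` for functions `f = ∑ fᵢ` with `fᵢ` supported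
in very sparse balls of radius `R`, with total mass at most `b`, and with mass at most `a` at
scale `ε`. -/
def SparseMassEstimate {n : ℕ} (σ : Measure (Euc n)) (p γ C₁ A ε : ℝ) (q : ℕ) : Prop :=
  ∀ (ι : Type) [Fintype ι] (x : ι → Euc n) (R : ℝ) (f : ι → Euc n → ℂ) (a b : ℝ≥0∞), 1 ≤ R →
    (∀ i, Integrable (f i)) → (∀ i, Function.support (f i) ⊆ Metric.ball (x i) R) →
    (∀ i j, i ≠ j → C₁ * (Fintype.card ι * R) ^ q ≤ ‖x i - x j‖) →
    a ≠ ⊤ → (∀ i v, ∫⁻ t in Metric.ball v ε, ‖f i t‖ₑ ≤ a) → ∑ i, ∫⁻ t, ‖f i t‖ₑ ≤ b →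
    ∫⁻ ξ, ‖𝓕 (fun v => ∑ i, f i v) ξ‖ₑ ∂σ ≤
      ENNReal.ofReal (A * R ^ γ) * (a ^ (1 - 1 / p) * b ^ (1 / p))

/-- On S the transform of f is at most twice that of its ball average F. The average is bounded
pointwise by c a, and its mass does not exceed that of f; hence ‖F‖_p^p ≤ (c a)^(p-1) ‖f‖_1, and the
sparse estimate for the averages involves only masses. -/
theorem exists_sparseMassEstimate {e : ℕ} {S : Set (Euc (e + 2))}
    (hS : IsCompactPosDefHypersurface S) {p γ : ℝ} (hp : 1 < p) (hp2 : p < 2) (hγ : 0 < γ)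
    (hloc : LocalRestrictionEstimate S p γ) :
    ∃ C₁ A ε : ℝ, 1 ≤ C₁ ∧ 0 < A ∧ 0 < ε ∧ ε ≤ 1 ∧
      SparseMassEstimate (surfaceMeasure S) p γ C₁ A ε (2 * e + 6) := by
  obtain ⟨C₁, A, hC₁, hA, hsp⟩ := sparse_restriction_estimate hS hp hp2 hγ hloc
  obtain ⟨ε, hε0, hε1, hhalf⟩ := exists_half_le_norm_fourier_ballBump hS.isCompact.isBounded
  have hp0 : 0 < p := by linarith
  set c : ℝ := (volume.real (Metric.ball (0 : Euc (e + 2)) ε))⁻¹ with hc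
  have hc0 : 0 < c := inv_pos.2 (volume_real_ball_pos hε0)
  have hexp : 0 ≤ 1 - 1 / p := by
    have : 1 / p ≤ 1 := (div_le_one hp0).2 hp.le
    linarith
  -- Averaging enlarges the supporting radius from R to R + ε ≤ 2R, which costs the powers of 2 in
  -- the separation and in R^γ; the leading 2 comes from the lower bound 1/2 on the transform of the
  -- bump.
  refine ⟨C₁ * 2 ^ (2 * e + 6), 2 * (A * 2 ^ γ) * c ^ (1 - 1 / p), ε,
    one_le_mul_of_one_le_of_one_le hC₁ (one_le_pow₀ one_le_two), by positivity, hε0, hε1, ?_⟩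
  intro ι _ x R f a b hR hf hs hx ha hfa hfb
  have hR0 : 0 < R := by linarith
  set F : ι → Euc (e + 2) → ℂ := fun i => ballAverage ε (f i) with hF
  have hFI : ∀ i, Integrable (F i) := fun i => integrable_ballAverage (hf i)
  have hFp : ∀ i, eLpNorm (F i) (ENNReal.ofReal p) volume ^ p ≤
      (ENNReal.ofReal c * a) ^ (p - 1) * ∫⁻ t, ‖f i t‖ₑ := by
    intro i
    rw [eLpNorm_rpow_eq_lintegral hp0]
    calc ∫⁻ v, ‖F i v‖ₑ ^ p ≤ ∫⁻ v, (ENNReal.ofReal c * a) ^ (p - 1) * ‖F i v‖ₑ := by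
          refine lintegral_mono fun v => ?_
          have h1 : ‖F i v‖ₑ ≤ ENNReal.ofReal c * a :=
            (enorm_ballAverage_le_setLIntegral hε0 (f i) v).trans (by gcongr; exact hfa i v)
          have h2 : ‖F i v‖ₑ ^ p = ‖F i v‖ₑ ^ (p - 1) * ‖F i v‖ₑ := by
            conv_lhs => rw [← sub_add_cancel p 1]
            rw [ENNReal.rpow_add_of_nonneg _ _ (by linarith) zero_le_one, ENNReal.rpow_one]
          simp only [h2]
          gcongr
      _ ≤ _ := by
          rw [lintegral_const_mul' _ _ (ENNReal.rpow_ne_top_of_nonneg (by linarith)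
            (ENNReal.mul_ne_top ENNReal.ofReal_ne_top ha))]
          exact mul_le_mul_right (lintegral_enorm_ballAverage_le hε0 (hf i)) _
  have hFL : ∀ i, MemLp (F i) (ENNReal.ofReal p) := by
    intro i
    refine ⟨(hFI i).aestronglyMeasurable, ?_⟩
    have h1 : eLpNorm (F i) (ENNReal.ofReal p) volume ^ p < ⊤ := (hFp i).trans_lt
      (ENNReal.mul_lt_top (ENNReal.rpow_lt_top_of_nonneg (by linarith)
        (ENNReal.mul_ne_top ENNReal.ofReal_ne_top ha)) (hf i).2)
    exact (ENNReal.rpow_lt_top_iff_of_pos hp0).1 h1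
  have hmain := hsp ι x (2 * R) F (by linarith) hFL
    (fun i => (support_ballAverage_subset (hs i)).trans (Metric.ball_subset_ball (by linarith)))
    (fun i j hij => le_trans (le_of_eq (by rw [← mul_assoc, mul_comm _ (2 : ℝ), mul_assoc, mul_pow]; ring))
      (hx i j hij))
  have hpt : ∀ᵐ ξ ∂surfaceMeasure S, ‖𝓕 (fun v => ∑ i, f i v) ξ‖ₑ ≤
      2 * ‖𝓕 (fun v => ∑ i, F i v) ξ‖ₑ := by
    filter_upwards [ae_restrict_mem hS.isCompact.isClosed.measurableSet] with ξ hξ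
    rw [fourier_finsetSum _ fun i _ => hf i, fourier_finsetSum _ fun i _ => hFI i]
    simp_rw [hF, fourier_ballAverage (hf _)]
    rw [← Finset.sum_mul, enorm_mul]
    have h1 : (1 : ℝ≥0∞) ≤ 2 * ‖𝓕 (ballBump (e + 2) ε) ξ‖ₑ := by
      rw [← ofReal_norm, two_mul_ofReal, ← ENNReal.ofReal_one]
      exact ENNReal.ofReal_le_ofReal (by linarith [hhalf ξ hξ])
    calc ‖∑ i, 𝓕 (f i) ξ‖ₑ = ‖∑ i, 𝓕 (f i) ξ‖ₑ * 1 := (mul_one _).symm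
      _ ≤ ‖∑ i, 𝓕 (f i) ξ‖ₑ * (2 * ‖𝓕 (ballBump (e + 2) ε) ξ‖ₑ) := by gcongr
      _ = _ := by ring
  have hsum : (∑ i, eLpNorm (F i) (ENNReal.ofReal p) volume ^ p) ^ (1 / p) ≤
      ENNReal.ofReal (c ^ (1 - 1 / p)) * (a ^ (1 - 1 / p) * b ^ (1 / p)) := by
    have h1 : ∑ i, eLpNorm (F i) (ENNReal.ofReal p) volume ^ p ≤
        (ENNReal.ofReal c * a) ^ (p - 1) * b := by
      refine (Finset.sum_le_sum fun i _ => hFp i).trans ?_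
      rw [← Finset.mul_sum]; gcongr
    refine (ENNReal.rpow_le_rpow h1 (by positivity)).trans (le_of_eq ?_)
    have h2 : (p - 1) * (1 / p) = 1 - 1 / p := by field_simp
    rw [ENNReal.mul_rpow_of_nonneg _ _ (by positivity), ← ENNReal.rpow_mul, h2,
      ENNReal.mul_rpow_of_nonneg _ _ hexp, ENNReal.ofReal_rpow_of_pos hc0, mul_assoc]
  calc _ ≤ ∫⁻ ξ, 2 * ‖𝓕 (fun v => ∑ i, F i v) ξ‖ₑ ∂surfaceMeasure S := lintegral_mono_ae hpt
    _ = 2 * ∫⁻ ξ, ‖𝓕 (fun v => ∑ i, F i v) ξ‖ₑ ∂surfaceMeasure S :=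
        lintegral_const_mul' _ _ (by simp)
    _ ≤ 2 * (ENNReal.ofReal (A * (2 * R) ^ γ) *
          (ENNReal.ofReal (c ^ (1 - 1 / p)) * (a ^ (1 - 1 / p) * b ^ (1 / p)))) := by
        gcongr
        exact hmain.trans (by gcongr)
    _ = _ := by
        have h3 : ENNReal.ofReal (2 * (A * 2 ^ γ) * c ^ (1 - 1 / p) * R ^ γ) =
            2 * ENNReal.ofReal (A * (2 * R) ^ γ) * ENNReal.ofReal (c ^ (1 - 1 / p)) := by
          rw [Real.mul_rpow zero_le_two hR0.le, two_mul_ofReal, ← ENNReal.ofReal_mul (by positivity)]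
          congr 1; ring
        rw [h3]; ring

end Smoothing

/-! ### Covering a finite set by sparse families of balls -/

section SparseCover

/-- Greedy colouring: with d + 1 colours, each new point finds one not used by its at most d
neighbours. -/
theorem exists_coloring_of_card_le {α : Type*} [DecidableEq α] {r : α → α → Prop} [DecidableRel r]
    (hr : ∀ x y, r x y → r y x) (d : ℕ) (X : Finset α)
    (hX : ∀ x ∈ X, (X.filter fun y => r x y).card ≤ d) :
    ∃ c : α → Fin (d + 1), ∀ x ∈ X, ∀ y ∈ X, x ≠ y → r x y → c x ≠ c y := by
  induction X using Finset.induction_on with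
  | empty => exact ⟨fun _ => 0, by simp⟩
  | insert a X ha ih =>
    obtain ⟨c, hc⟩ := ih fun x hx => le_trans
      (Finset.card_le_card (Finset.filter_subset_filter _ (Finset.subset_insert a X)))
      (hX x (Finset.mem_insert_of_mem hx))
    have hcard : ((X.filter fun y => r a y).image c).card < Fintype.card (Fin (d + 1)) := by
      rw [Fintype.card_fin]
      have h1 := hX a (Finset.mem_insert_self a X)
      have h2 : (X.filter fun y => r a y).card ≤ d :=
        le_trans (Finset.card_le_card (Finset.filter_subset_filter _ (Finset.subset_insert a X))) h1
      exact Nat.lt_succ_of_le (Finset.card_image_le.trans h2)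
    obtain ⟨k, hk⟩ : ∃ k, k ∉ (X.filter fun y => r a y).image c := by
      by_contra! hcon
      exact hcard.not_ge (by rw [Finset.eq_univ_of_forall hcon]; simp)
    have hne : ∀ x ∈ X, x ≠ a := fun x hx h => ha (h ▸ hx)
    have hk' : ∀ y ∈ X, r a y → c y ≠ k := fun y hy hay h =>
      hk (Finset.mem_image.2 ⟨y, Finset.mem_filter.2 ⟨hy, hay⟩, h⟩)
    refine ⟨Function.update c a k, fun x hx y hy hxy hrxy => ?_⟩
    rcases Finset.mem_insert.1 hx with rfl | hx' <;> rcases Finset.mem_insert.1 hy with rfl | hy'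
    · exact absurd rfl hxy
    · rw [Function.update_self, Function.update_of_ne (hne y hy')]
      exact (hk' y hy' hrxy).symm
    · rw [Function.update_self, Function.update_of_ne (hne x hx')]
      exact hk' x hx' (hr _ _ hrxy)
    · rw [Function.update_of_ne (hne x hx'), Function.update_of_ne (hne y hy')]
      exact hc x hx' y hy' hxy hrxy

theorem exists_separated_net {α : Type*} [PseudoMetricSpace α] [DecidableEq α] {ρ : ℝ} (hρ : 0 ≤ ρ)
    (E : Finset α) : ∃ X ⊆ E, (∀ x ∈ X, ∀ y ∈ X, x ≠ y → ρ < dist x y) ∧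
      ∀ x ∈ E, ∃ y ∈ X, dist x y ≤ ρ := by
  induction E using Finset.induction_on with
  | empty => exact ⟨∅, by simp⟩
  | insert a E ha ih =>
    obtain ⟨X, hXE, hsep, hnet⟩ := ih
    by_cases h : ∃ y ∈ X, dist a y ≤ ρ
    · refine ⟨X, hXE.trans (Finset.subset_insert a E), hsep, fun x hx => ?_⟩
      rcases Finset.mem_insert.1 hx with rfl | hx
      exacts [h, hnet x hx]
    · push Not at h
      refine ⟨insert a X, Finset.insert_subset_insert a hXE, fun x hx y hy hxy => ?_, fun x hx => ?_⟩
      · rcases Finset.mem_insert.1 hx with rfl | hx' <;> rcases Finset.mem_insert.1 hy with rfl | hy'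
        · exact absurd rfl hxy
        · exact h _ hy'
        · rw [dist_comm]; exact h _ hx'
        · exact hsep x hx' y hy' hxy
      · rcases Finset.mem_insert.1 hx with rfl | hx
        · exact ⟨x, Finset.mem_insert_self _ _, by rwa [dist_self]⟩
        · obtain ⟨y, hy, hxy⟩ := hnet x hx
          exact ⟨y, Finset.mem_insert_of_mem hy, hxy⟩

/-- A set of points at which the number of neighbours in `E` grows by a factor at most `θ` from
scale `ρ` to scale `ρ'` splits into few classes, each contained in a sparse family of balls. -/
theorem exists_sparse_classes {α : Type*} [PseudoMetricSpace α] [DecidableEq α] {E E' : Finset α}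
    (hE : E' ⊆ E) {ρ ρ' θ w : ℝ} (hρ : 0 ≤ ρ) (hρρ : 2 * ρ ≤ ρ') (hw : 0 < w)
    (hlow : ∀ x ∈ E', w ≤ (E.filter fun y => dist x y ≤ ρ).card)
    (hup : ∀ x ∈ E', ((E.filter fun y => dist x y ≤ ρ').card : ℝ) ≤ w * θ) :
    ∃ (ctr : α → α) (col : α → Fin (⌊θ⌋₊ + 1)), ∀ x ∈ E', ctr x ∈ E ∧ dist x (ctr x) ≤ 2 * ρ ∧
      ∀ y ∈ E', col x = col y → ctr x ≠ ctr y → ρ' / 2 < dist (ctr x) (ctr y) := by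
  classical
  obtain ⟨X, hXE, hsep, hnet⟩ := exists_separated_net (by positivity : 0 ≤ 2 * ρ) E'
  -- Volume counting: net points are more than 2ρ apart, so the ρ-balls around those within ρ' / 2
  -- of x are disjoint. Each holds at least w points of E, and all lie in the ρ'-ball of x, which
  -- holds at most w θ. Hence there are at most θ of them.
  have hdeg : ∀ x ∈ X, (X.filter fun y => dist x y ≤ ρ' / 2).card ≤ ⌊θ⌋₊ := by
    intro x hx
    set Y := X.filter fun y => dist x y ≤ ρ' / 2 with hY
    refine Nat.le_floor ?_
    have hdisj : ∀ y ∈ Y, ∀ z ∈ Y, y ≠ z → Disjoint (E.filter fun u => dist y u ≤ ρ)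
        (E.filter fun u => dist z u ≤ ρ) := by
      intro y hy z hz hyz
      refine Finset.disjoint_left.2 fun u hu hu' => ?_
      have h1 := (Finset.mem_filter.1 hu).2
      have h2 := (Finset.mem_filter.1 hu').2
      have h3 := hsep y (Finset.mem_filter.1 hy).1 z (Finset.mem_filter.1 hz).1 hyz
      have h4 := dist_triangle_right y z u
      linarith
    have h1 : (Y.biUnion fun y => E.filter fun u => dist y u ≤ ρ) ⊆
        E.filter fun u => dist x u ≤ ρ' := by
      intro u hu
      obtain ⟨y, hy, huy⟩ := Finset.mem_biUnion.1 hu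
      have h2 := (Finset.mem_filter.1 hy).2
      have h3 := Finset.mem_filter.1 huy
      refine Finset.mem_filter.2 ⟨h3.1, (dist_triangle x y u).trans ?_⟩
      linarith [h3.2]
    have h2 := Finset.card_le_card h1
    rw [Finset.card_biUnion hdisj] at h2
    have h3 : (Y.card : ℝ) * w ≤ ∑ y ∈ Y, ((E.filter fun u => dist y u ≤ ρ).card : ℝ) := by
      rw [← nsmul_eq_mul]
      exact Finset.card_nsmul_le_sum _ _ _ fun y hy => hlow y (hXE (Finset.mem_filter.1 hy).1)
    have h4 : ∑ y ∈ Y, ((E.filter fun u => dist y u ≤ ρ).card : ℝ) ≤ w * θ :=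
      le_trans (by exact_mod_cast h2) (hup x (hXE hx))
    have h5 : w * (Y.card : ℝ) ≤ w * θ := by linarith
    exact le_of_mul_le_mul_left h5 hw
  obtain ⟨c, hc⟩ := exists_coloring_of_card_le (r := fun x y : α => dist x y ≤ ρ' / 2)
    (fun x y h => by rwa [dist_comm]) ⌊θ⌋₊ X hdeg
  choose! ctr hctr hdist using hnet
  refine ⟨ctr, fun x => c (ctr x), fun x hx => ⟨hE (hXE (hctr x hx)), hdist x hx,
    fun y hy hcol hne => ?_⟩⟩
  by_contra hcon
  exact hc _ (hctr x hx) _ (hctr y hy) hne (not_lt.1 hcon) hcol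

/-- A finite set is covered by few sparse families of balls, of radii chosen from a rapidly
increasing sequence. -/
theorem exists_sparse_cover {α : Type*} [PseudoMetricSpace α] [DecidableEq α] (E : Finset α) {θ : ℝ}
    (hθ : 1 ≤ θ) {K : ℕ} (hK : 1 ≤ K) (hcard : (E.card : ℝ) ≤ θ ^ K) {ρ : ℕ → ℝ}
    (hρ : ∀ k, 0 ≤ ρ k) (hρρ : ∀ k, 2 * ρ k ≤ ρ (k + 1)) :
    ∃ (lev : α → Fin K) (ctr : α → α) (col : α → Fin (⌊θ⌋₊ + 1)), ∀ x ∈ E, ctr x ∈ E ∧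
      dist x (ctr x) ≤ 2 * ρ (lev x) ∧ ∀ y ∈ E, lev x = lev y → col x = col y → ctr x ≠ ctr y →
        ρ (lev x + 1) / 2 < dist (ctr x) (ctr y) := by
  classical
  have hθ0 : 0 < θ := by linarith
  set cnt : ℕ → α → ℝ := fun k x => ((E.filter fun y => dist x y ≤ ρ k).card : ℝ) with hcnt
  have hcntE : ∀ k x, cnt k x ≤ E.card := fun k x => by
    simp only [hcnt]
    exact_mod_cast Finset.card_le_card (Finset.filter_subset _ E)
  -- The level is the least k for which the count at scale k + 1 is at most θ^(k+1). It is below K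
  -- since E has at most θ^K points. Minimality gives a count of at least θ^k at scale k; for k = 0
  -- the point x itself suffices.
  have hlevel : ∀ x ∈ E, ∃ k : Fin K, θ ^ (k : ℕ) ≤ cnt k x ∧ cnt (k + 1) x ≤ θ ^ (k : ℕ) * θ := by
    intro x hx
    have hex : ∃ k, cnt (k + 1) x ≤ θ ^ (k + 1) := by
      refine ⟨K - 1, ?_⟩
      rw [Nat.sub_add_cancel hK]
      exact (hcntE K x).trans hcard
    have hlt : Nat.find hex < K := by
      have : Nat.find hex ≤ K - 1 := Nat.find_min' hex (by
        rw [Nat.sub_add_cancel hK]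
        exact (hcntE K x).trans hcard)
      omega
    refine ⟨⟨Nat.find hex, hlt⟩, ?_, ?_⟩
    · rcases Nat.eq_zero_or_pos (Nat.find hex) with h0 | hpos
      · simp only [h0, pow_zero]
        have : 0 < (E.filter fun y => dist x y ≤ ρ 0).card :=
          Finset.card_pos.2 ⟨x, Finset.mem_filter.2 ⟨hx, by rw [dist_self]; exact hρ 0⟩⟩
        simp only [hcnt]
        exact_mod_cast this
      · have h1 := Nat.find_min hex (Nat.sub_lt hpos one_pos)
        rw [show Nat.find hex - 1 + 1 = Nat.find hex by omega] at h1
        exact (not_le.1 h1).le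
    · have := Nat.find_spec hex
      rwa [pow_succ] at this
  have hKne : Nonempty (Fin K) := ⟨⟨0, hK⟩⟩
  choose! lev hlow hup using hlevel
  have hcls := fun k : Fin K => exists_sparse_classes (E := E) (E' := E.filter fun x => lev x = k)
    (Finset.filter_subset _ _) (hρ k) (hρρ k) (pow_pos hθ0 (k : ℕ))
    (fun x hx => by
      obtain ⟨h1, h2⟩ := Finset.mem_filter.1 hx
      have := hlow x h1; rwa [h2] at this)
    (fun x hx => by
      obtain ⟨h1, h2⟩ := Finset.mem_filter.1 hx
      have := hup x h1; rwa [h2] at this)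
  choose ctr col hcc using hcls
  refine ⟨lev, fun x => ctr (lev x) x, fun x => col (lev x) x, fun x hx => ?_⟩
  have h1 := hcc (lev x) x (Finset.mem_filter.2 ⟨hx, rfl⟩)
  refine ⟨h1.1, h1.2.1, fun y hy hl hc hne => ?_⟩
  simp only [← hl] at hc hne ⊢
  exact h1.2.2 y (Finset.mem_filter.2 ⟨hy, hl.symm⟩) hc hne

end SparseCover

/-! ### Unit cells -/

section Cells

variable {n : ℕ}

/-- The lattice point of the unit cell containing `x`. -/
noncomputable def cellIndex (x : Euc n) : Fin n → ℤ := fun i => ⌊x i⌋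

/-- A lattice point as a point of Euclidean space. -/
noncomputable def latticePoint (k : Fin n → ℤ) : Euc n := WithLp.toLp 2 fun i => (k i : ℝ)

theorem measurable_cellIndex : Measurable (cellIndex (n := n)) := by
  refine measurable_pi_lambda _ fun i => Int.measurable_floor.comp ?_
  exact (EuclideanSpace.proj i : Euc n →L[ℝ] ℝ).continuous.measurable

theorem measurableSet_preimage_cellIndex (s : Set (Fin n → ℤ)) :
    MeasurableSet (cellIndex (n := n) ⁻¹' s) :=
  measurable_cellIndex s.to_countable.measurableSet

theorem norm_le_sum_abs (x : Euc n) : ‖x‖ ≤ ∑ i, |x i| := by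
  conv_lhs => rw [← (EuclideanSpace.basisFun (Fin n) ℝ).sum_repr x]
  refine (norm_sum_le _ _).trans (Finset.sum_le_sum fun i _ => ?_)
  rw [norm_smul]; simp

theorem dist_le_norm_latticePoint_sub (k l : Fin n → ℤ) :
    dist k l ≤ ‖latticePoint k - latticePoint l‖ := by
  rw [dist_pi_le_iff (norm_nonneg _)]
  intro i
  have h1 : |(latticePoint k - latticePoint l) i| ≤ ‖latticePoint k - latticePoint l‖ := by
    rw [← Real.norm_eq_abs]; exact PiLp.norm_apply_le _ i
  rw [Int.dist_eq]
  simpa [latticePoint] using h1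

/-- The distance of the cell indices bounds the integer part of each coordinate difference, and the
fractional part adds at most 1. The sum over n coordinates gives the factor n, and the last 1 makes
the inequality strict in every dimension. -/
theorem norm_sub_latticePoint_lt (x : Euc n) (l : Fin n → ℤ) :
    ‖x - latticePoint l‖ < n * (dist (cellIndex x) l + 1) + 1 := by
  refine lt_of_le_of_lt (norm_le_sum_abs _) ?_
  have h1 : ∀ i, |(x - latticePoint l) i| ≤ dist (cellIndex x) l + 1 := by
    intro i
    have h2 : dist (cellIndex x i) (l i) ≤ dist (cellIndex x) l := dist_le_pi_dist _ _ i
    rw [Int.dist_eq] at h2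
    have h3 : (x - latticePoint l) i = ((cellIndex x i : ℝ) - l i) + Int.fract (x i) := by
      simp only [PiLp.sub_apply, latticePoint, cellIndex]
      linarith [Int.floor_add_fract (x i)]
    rw [h3]
    refine (abs_add_le _ _).trans (add_le_add h2 ?_)
    rw [abs_of_nonneg (Int.fract_nonneg _)]
    exact (Int.fract_lt_one _).le
  have h4 := Finset.sum_le_sum fun i (_ : i ∈ Finset.univ) => h1 i
  rw [Finset.sum_const, Finset.card_univ, Fintype.card_fin, nsmul_eq_mul] at h4
  linarith

theorem setLIntegral_biUnion_finset_le {α ι : Type*} [MeasurableSpace α] {μ : Measure α}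
    (s : Finset ι) (t : ι → Set α) (g : α → ℝ≥0∞) :
    ∫⁻ x in ⋃ i ∈ s, t i, g x ∂μ ≤ ∑ i ∈ s, ∫⁻ x in t i, g x ∂μ := by
  classical
  induction s using Finset.induction_on with
  | empty => simp
  | insert a s ha ih =>
    rw [Finset.set_biUnion_insert, Finset.sum_insert ha]
    exact (lintegral_union_le _ _ _).trans (add_le_add le_rfl ih)

/-- A ball of radius at most 1 meets only cells whose index differs by at most one in each
coordinate from that of the centre. -/
theorem setLIntegral_ball_le_of_cell_le {ε : ℝ} (hε : ε ≤ 1) {g : Euc n → ℝ≥0∞} {a : ℝ≥0∞}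
    (ha : ∀ k, ∫⁻ t in cellIndex ⁻¹' {k}, g t ≤ a) (v : Euc n) :
    ∫⁻ t in Metric.ball v ε, g t ≤ 3 ^ n * a := by
  set P : Finset (Fin n → ℤ) :=
    Fintype.piFinset fun i => Finset.Icc (cellIndex v i - 1) (cellIndex v i + 1) with hP
  have hsub : Metric.ball v ε ⊆ ⋃ k ∈ P, cellIndex ⁻¹' {k} := by
    intro t ht
    simp only [Set.mem_iUnion, Set.mem_preimage, Set.mem_singleton_iff, exists_prop, exists_eq_right']
    rw [hP, Fintype.mem_piFinset]
    intro i
    have h1 : |t i - v i| < 1 := by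
      have h2 : ‖(t - v) i‖ ≤ ‖t - v‖ := PiLp.norm_apply_le _ i
      have h3 := mem_ball_iff_norm.1 ht
      rw [Real.norm_eq_abs] at h2
      exact lt_of_le_of_lt h2 (h3.trans_le hε)
    rw [abs_lt] at h1
    rw [Finset.mem_Icc]
    constructor
    · rw [cellIndex, cellIndex, Int.le_floor]
      push_cast
      linarith [Int.floor_le (v i)]
    · have : ⌊t i⌋ < ⌊v i⌋ + 2 := by
        rw [Int.floor_lt]; push_cast
        linarith [Int.lt_floor_add_one (v i)]
      simp only [cellIndex]; omega
  calc ∫⁻ t in Metric.ball v ε, g t ≤ ∫⁻ t in ⋃ k ∈ P, cellIndex ⁻¹' {k}, g t :=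
        lintegral_mono_set hsub
    _ ≤ ∑ k ∈ P, ∫⁻ t in cellIndex ⁻¹' {k}, g t := setLIntegral_biUnion_finset_le _ _ _
    _ ≤ ∑ k ∈ P, a := Finset.sum_le_sum fun k _ => ha k
    _ = 3 ^ n * a := by
        have : ∀ z : ℤ, z + 1 + 1 - (z - 1) = 3 := fun z => by ring
        rw [Finset.sum_const, hP, Fintype.card_piFinset, nsmul_eq_mul]
        simp [this]

theorem lintegral_le_of_cell_le {T : Finset (Fin n → ℤ)} {f : Euc n → ℂ} {a : ℝ≥0∞}
    (hs : ∀ x, f x ≠ 0 → cellIndex x ∈ T) (ha : ∀ k, ∫⁻ t in cellIndex ⁻¹' {k}, ‖f t‖ₑ ≤ a) :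
    ∫⁻ t, ‖f t‖ₑ ≤ T.card * a := by
  have hsub : (Function.support fun t => ‖f t‖ₑ) ⊆ ⋃ k ∈ T, cellIndex ⁻¹' {k} := by
    intro t ht
    have h1 : f t ≠ 0 := fun h0 => ht (by simp [h0])
    simpa using hs t h1
  rw [← setLIntegral_eq_of_support_subset hsub]
  refine (setLIntegral_biUnion_finset_le _ _ _).trans ((Finset.sum_le_sum fun k _ => ha k).trans ?_)
  rw [Finset.sum_const, nsmul_eq_mul]

end Cells

/-! ### Functions with small mass in each unit cell -/

section LevelSets

variable {n : ℕ} {σ : Measure (Euc n)} {p γ C₁ A ε : ℝ} {q : ℕ}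

/-- The estimate for one sparse class of cells. -/
theorem SparseMassEstimate.sparse_class (hsp : SparseMassEstimate σ p γ C₁ A ε q) (hp : 1 < p)
    (hC₁ : 0 ≤ C₁) (hε : ε ≤ 1) {T : Finset (Fin n → ℤ)} {ctr : (Fin n → ℤ) → Fin n → ℤ} {r N : ℝ}
    (hr : 0 ≤ r) (hctr : ∀ k ∈ T, dist k (ctr k) ≤ r) (hTN : (T.card : ℝ) ≤ N)
    (hsep : ∀ k ∈ T, ∀ l ∈ T, ctr k ≠ ctr l →
      C₁ * (N * (n * (r + 1) + 1)) ^ q ≤ dist (ctr k) (ctr l))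
    {f : Euc n → ℂ} (hf : Integrable f) (hs : ∀ x, f x ≠ 0 → cellIndex x ∈ T) {a : ℝ≥0∞}
    (hatop : a ≠ ⊤) (ha : ∀ k, ∫⁻ t in cellIndex ⁻¹' {k}, ‖f t‖ₑ ≤ a) :
    ∫⁻ ξ, ‖𝓕 f ξ‖ₑ ∂σ ≤ ENNReal.ofReal (A * (n * (r + 1) + 1) ^ γ) *
      (3 ^ n * ENNReal.ofReal N ^ (1 / p) * a) := by
  classical
  set R : ℝ := n * (r + 1) + 1 with hR
  have hR1 : 1 ≤ R := by
    have : 0 ≤ (n : ℝ) * (r + 1) := by positivity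
    linarith
  set I : Finset (Fin n → ℤ) := T.image ctr with hI
  set g : {i // i ∈ I} → Euc n → ℂ := fun i =>
    (cellIndex ⁻¹' {k | k ∈ T ∧ ctr k = i}).indicator f with hg
  have hgI : ∀ i, Integrable (g i) := fun i => hf.indicator (measurableSet_preimage_cellIndex _)
  have hsum : (fun v => ∑ i, g i v) = f := by
    funext v
    by_cases hv : f v = 0
    · rw [hv]
      refine Finset.sum_eq_zero fun i _ => ?_
      simp only [hg, Set.indicator_apply, hv, ite_self]
    · have hT := hs v hv
      have hmem : ctr (cellIndex v) ∈ I := Finset.mem_image_of_mem ctr hT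
      rw [Finset.sum_eq_single ⟨ctr (cellIndex v), hmem⟩]
      · simp only [hg]
        rw [Set.indicator_of_mem]
        exact ⟨hT, rfl⟩
      · intro i _ hi
        simp only [hg]
        rw [Set.indicator_of_notMem]
        rintro ⟨-, h2⟩
        exact hi (Subtype.ext h2.symm)
      · intro h; exact absurd (Finset.mem_univ _) h
  have hgle : ∀ i v, ‖g i v‖ₑ ≤ ‖f v‖ₑ := fun i v => enorm_indicator_le_enorm_self _ _
  have hcardI : (Fintype.card {i // i ∈ I} : ℝ) ≤ N := by
    rw [Fintype.card_coe]
    exact le_trans (by exact_mod_cast Finset.card_image_le) hTN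
  -- One piece is formed for each centre. The mass at scale ε is at most 3^n a and the total mass at
  -- most card T · a; in the interpolated bound the two powers of a recombine to a itself, leaving
  -- N^(1/p).
  have key := hsp {i // i ∈ I} (fun i => latticePoint i) R g (3 ^ n * a) (T.card * a) hR1 hgI ?_ ?_
    (ENNReal.mul_ne_top (by simp) hatop) ?_ ?_
  · rw [hsum] at key
    refine key.trans (mul_le_mul_right ?_ _)
    have hexp : 0 ≤ 1 - 1 / p := by
      have : 1 / p ≤ 1 := (div_le_one (by linarith)).2 hp.le
      linarith
    have hexp1 : 1 - 1 / p ≤ 1 := by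
      have : 0 ≤ 1 / p := by positivity
      linarith
    have h3 : ((3 : ℝ≥0∞) ^ n) ^ (1 - 1 / p) ≤ 3 ^ n := by
      conv_rhs => rw [← ENNReal.rpow_one ((3 : ℝ≥0∞) ^ n)]
      exact ENNReal.rpow_le_rpow_of_exponent_le (one_le_pow₀ (by norm_num)) hexp1
    have hcT : (T.card : ℝ≥0∞) ≤ ENNReal.ofReal N := by
      rw [← ENNReal.ofReal_natCast]; exact ENNReal.ofReal_le_ofReal hTN
    have haa : a ^ (1 - 1 / p) * a ^ (1 / p) = a := by
      rw [← ENNReal.rpow_add_of_nonneg _ _ hexp (by positivity), sub_add_cancel, ENNReal.rpow_one]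
    rw [ENNReal.mul_rpow_of_nonneg _ _ hexp, ENNReal.mul_rpow_of_nonneg _ _ (by positivity)]
    calc _ = ((3 : ℝ≥0∞) ^ n) ^ (1 - 1 / p) * (T.card : ℝ≥0∞) ^ (1 / p) *
          (a ^ (1 - 1 / p) * a ^ (1 / p)) := by ring
      _ ≤ _ := by rw [haa]; gcongr
  · intro i v hv
    have hv' : v ∈ cellIndex ⁻¹' {k | k ∈ T ∧ ctr k = i} := Set.mem_of_indicator_ne_zero hv
    obtain ⟨h1, h2⟩ := hv'
    rw [mem_ball_iff_norm]
    refine (norm_sub_latticePoint_lt v i).trans_le ?_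
    rw [hR, ← h2]
    have := hctr _ h1
    gcongr
  · intro i j hij
    obtain ⟨k, hk, hki⟩ := Finset.mem_image.1 i.2
    obtain ⟨l, hl, hlj⟩ := Finset.mem_image.1 j.2
    refine le_trans ?_ (dist_le_norm_latticePoint_sub _ _)
    have hne : ctr k ≠ ctr l := fun h => hij (Subtype.ext (by rw [← hki, ← hlj, h]))
    have h1 := hsep k hk l hl hne
    rw [hki, hlj] at h1
    refine le_trans ?_ h1
    gcongr
  · intro i v
    refine setLIntegral_ball_le_of_cell_le hε (fun k => ?_) v
    exact (lintegral_mono fun t => hgle i t).trans (ha k)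
  · rw [← lintegral_finsetSum' _ fun i _ => (hgI i).aestronglyMeasurable.enorm]
    refine le_trans (lintegral_mono fun v => ?_) (lintegral_le_of_cell_le hs ha)
    simp only
    by_cases hv : cellIndex v ∈ T
    · have hmem : ctr (cellIndex v) ∈ I := Finset.mem_image_of_mem ctr hv
      rw [Finset.sum_eq_single ⟨ctr (cellIndex v), hmem⟩]
      · exact hgle _ v
      · intro i _ hi
        simp only [hg]
        rw [Set.indicator_of_notMem, enorm_zero]
        rintro ⟨-, h2⟩
        exact hi (Subtype.ext h2.symm)
      · intro h; exact absurd (Finset.mem_univ _) h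
    · refine le_of_eq_of_le (Finset.sum_eq_zero fun i _ => ?_) zero_le
      simp only [hg]
      rw [Set.indicator_of_notMem, enorm_zero]
      exact fun h => hv h.1

/-- The radii `X ^ ((2q) ^ j)` grow fast enough for the sparseness condition. -/
theorem iterated_pow_scales {X N : ℝ} (hC₁ : 1 ≤ C₁) (hn : 1 ≤ n) (hq : 1 ≤ q) (hN : 1 ≤ N)
    (hX : X = 8 * C₁ * n * N) (j : ℕ) :
    2 * X ^ ((2 * q) ^ j) ≤ X ^ ((2 * q) ^ (j + 1)) ∧
    C₁ * (N * (n * (2 * X ^ ((2 * q) ^ j) + 1) + 1)) ^ q ≤ X ^ ((2 * q) ^ (j + 1)) / 2 ∧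
    n * (2 * X ^ ((2 * q) ^ j) + 1) + 1 ≤ X ^ ((2 * q) ^ (j + 1)) := by
  have hn' : (1 : ℝ) ≤ n := by exact_mod_cast hn
  have hCN : 1 ≤ C₁ * N := one_le_mul_of_one_le_of_one_le hC₁ hN
  have hX1 : 8 * (n : ℝ) ≤ X := by
    rw [hX]; nlinarith [mul_le_mul_of_nonneg_left hCN (by positivity : (0 : ℝ) ≤ 8 * n)]
  have hX8 : 8 ≤ X := by linarith
  rw [pow_succ, pow_mul]
  set Y : ℝ := X ^ ((2 * q) ^ j) with hY
  have hYX : X ≤ Y := le_self_pow₀ (by linarith) (pow_ne_zero _ (by omega))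
  have hY8 : 8 ≤ Y := hX8.trans hYX
  have hYD : Y ^ 2 ≤ Y ^ (2 * q) := pow_le_pow_right₀ (by linarith) (by omega)
  have hR : n * (2 * Y + 1) + 1 ≤ 4 * n * Y := by
    nlinarith [mul_le_mul hn' hY8 (by norm_num) (by linarith)]
  refine ⟨le_trans (by nlinarith) hYD, ?_, le_trans (le_trans hR ?_) hYD⟩
  · have h1 : C₁ * (N * (n * (2 * Y + 1) + 1)) ^ q ≤ C₁ * (N * (4 * n * Y)) ^ q := by
      gcongr
    -- Once 2 C₁ is absorbed into the q-th power, the base 2 C₁ · N · 4nY is exactly X Y, by the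
    -- choice of X. It is at most Y², so the (2q)-th power of the present radius suffices as the
    -- next one.
    have h2 : 2 * C₁ ≤ (2 * C₁) ^ q := le_self_pow₀ (by linarith) (by omega)
    have h3 : 2 * (C₁ * (N * (4 * n * Y)) ^ q) ≤ Y ^ (2 * q) := by
      calc 2 * (C₁ * (N * (4 * n * Y)) ^ q) = (2 * C₁) * (N * (4 * n * Y)) ^ q := by ring
        _ ≤ (2 * C₁) ^ q * (N * (4 * n * Y)) ^ q := by gcongr
        _ = (X * Y) ^ q := by rw [← mul_pow, hX]; ring
        _ ≤ (Y * Y) ^ q := by gcongr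
        _ = Y ^ (2 * q) := by rw [pow_mul, sq]
    linarith
  · nlinarith

/-- The estimate for functions with mass at most `a` in each of finitely many unit cells. -/
theorem SparseMassEstimate.level_set (hsp : SparseMassEstimate σ p γ C₁ A ε q) (hp : 1 < p)
    (hC₁ : 1 ≤ C₁) (hA : 0 < A) (hε : ε ≤ 1) (hγ : 0 ≤ γ) (hn : 1 ≤ n) (hq : 1 ≤ q) {K : ℕ}
    (hK : 1 ≤ K) :
    ∃ C : ℝ, 0 < C ∧ ∀ E : Finset (Fin n → ℤ), E.Nonempty → ∀ f : Euc n → ℂ, Integrable f →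
      (∀ x, f x ≠ 0 → cellIndex x ∈ E) → ∀ a : ℝ≥0∞, a ≠ ⊤ →
      (∀ k, ∫⁻ t in cellIndex ⁻¹' {k}, ‖f t‖ₑ ≤ a) →
        ∫⁻ ξ, ‖𝓕 f ξ‖ₑ ∂σ ≤
          ENNReal.ofReal (C * (E.card : ℝ) ^ (1 / p + 1 / K + γ * (2 * q) ^ K)) * a := by
  classical
  set M : ℝ := 8 * C₁ * n with hM
  have hn' : (1 : ℝ) ≤ n := by exact_mod_cast hn
  have hM0 : 0 < M := by positivity
  have hp0 : 0 < p := by linarith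
  refine ⟨2 * K * (A * M ^ (γ * (2 * q) ^ K) * 3 ^ n), by positivity, ?_⟩
  intro E hE f hf hs a ha hfa
  set N : ℝ := (E.card : ℝ) with hN
  have hN1 : 1 ≤ N := by
    rw [hN]
    exact_mod_cast hE.card_pos
  have hN0 : 0 < N := by linarith
  set X : ℝ := M * N with hX
  have hX' : X = 8 * C₁ * n * N := by rw [hX, hM]
  have hX0 : 0 < X := by positivity
  have hscale := iterated_pow_scales (n := n) (q := q) hC₁ hn hq hN1 hX'
  set ρ : ℕ → ℝ := fun j => X ^ ((2 * q) ^ j) with hρ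
  -- There are K levels and at most 2θ colours, so the decomposition costs 2K N^(1/K). Every class
  -- has supporting radius at most ρ K = (MN)^((2q)^K), which yields the term γ (2q)^K in the
  -- exponent.
  set θ : ℝ := N ^ (1 / (K : ℝ)) with hθ
  have hθ1 : 1 ≤ θ := Real.one_le_rpow hN1 (by positivity)
  have hθK : N ≤ θ ^ K := by
    rw [hθ, one_div, Real.rpow_inv_natCast_pow hN0.le (by omega)]
  obtain ⟨lev, ctr, col, hcov⟩ := exists_sparse_cover E hθ1 hK hθK (ρ := ρ)
    (fun k => by positivity) (fun k => (hscale k).1)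
  set T : Fin K × Fin (⌊θ⌋₊ + 1) → Finset (Fin n → ℤ) := fun i =>
    E.filter fun k => lev k = i.1 ∧ col k = i.2 with hT
  set g : Fin K × Fin (⌊θ⌋₊ + 1) → Euc n → ℂ := fun i =>
    (cellIndex ⁻¹' (T i)).indicator f with hg
  have hgI : ∀ i, Integrable (g i) := fun i => hf.indicator (measurableSet_preimage_cellIndex _)
  have hsum : (fun v => ∑ i, g i v) = f := by
    funext v
    by_cases hv : f v = 0
    · rw [hv]
      refine Finset.sum_eq_zero fun i _ => ?_
      simp only [hg, Set.indicator_apply, hv, ite_self]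
    · have hvE := hs v hv
      rw [Finset.sum_eq_single (lev (cellIndex v), col (cellIndex v))]
      · simp only [hg]
        rw [Set.indicator_of_mem]
        simp [hT, hvE]
      · intro i _ hi
        simp only [hg]
        rw [Set.indicator_of_notMem]
        intro h
        simp only [hT, Set.mem_preimage, Finset.coe_filter, Set.mem_ofPred_eq] at h
        exact hi (Prod.ext h.2.1.symm h.2.2.symm)
      · intro h; exact absurd (Finset.mem_univ _) h
  have hone : ∀ i, ∫⁻ ξ, ‖𝓕 (g i) ξ‖ₑ ∂σ ≤
      ENNReal.ofReal (A * ρ K ^ γ) * (3 ^ n * ENNReal.ofReal N ^ (1 / p) * a) := by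
    intro i
    have hmem : ∀ k ∈ T i, k ∈ E ∧ lev k = i.1 ∧ col k = i.2 := fun k hk => by
      simpa [hT] using hk
    have hs3 := hscale i.1
    refine (hsp.sparse_class (T := T i) (ctr := ctr) (r := 2 * ρ i.1) (N := N) hp (by linarith) hε
      (by positivity) ?_ ?_ ?_ (hgI i) ?_ ha ?_).trans ?_
    · intro k hk
      obtain ⟨h1, h2, -⟩ := hmem k hk
      rw [← h2]
      exact (hcov k h1).2.1
    · rw [hN]
      exact_mod_cast Finset.card_filter_le _ _
    · intro k hk l hl hkl
      obtain ⟨h1, h2, h3⟩ := hmem k hk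
      obtain ⟨h1', h2', h3'⟩ := hmem l hl
      have h4 := (hcov k h1).2.2 l h1' (h2.trans h2'.symm) (h3.trans h3'.symm) hkl
      rw [h2] at h4
      exact hs3.2.1.trans h4.le
    · intro x hx
      have h : x ∈ cellIndex ⁻¹' (T i : Set (Fin n → ℤ)) := Set.mem_of_indicator_ne_zero hx
      exact h
    · intro k
      exact (lintegral_mono fun t => enorm_indicator_le_enorm_self _ _).trans (hfa k)
    · have hle : (n : ℝ) * (2 * ρ i.1 + 1) + 1 ≤ ρ K := by
        refine hs3.2.2.trans ?_
        have hX1 : 1 ≤ X := by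
          rw [hX']
          have := one_le_mul_of_one_le_of_one_le (one_le_mul_of_one_le_of_one_le hC₁ hn') hN1
          linarith
        exact pow_le_pow_right₀ hX1 (Nat.pow_le_pow_right (by omega) i.1.2)
      gcongr
  have hcount : ((Fintype.card (Fin K × Fin (⌊θ⌋₊ + 1)) : ℕ) : ℝ) ≤ 2 * K * θ := by
    rw [Fintype.card_prod, Fintype.card_fin, Fintype.card_fin]
    push_cast
    have := Nat.floor_le (zero_le_one.trans hθ1)
    nlinarith [(Nat.cast_nonneg K : (0 : ℝ) ≤ K)]
  have hρK : ρ K ^ γ = M ^ (γ * (2 * q) ^ K) * N ^ (γ * (2 * q) ^ K) := by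
    rw [hρ]
    simp only
    rw [← Real.rpow_natCast, ← Real.rpow_mul hX0.le, hX, Real.mul_rpow hM0.le hN0.le]
    push_cast
    rw [mul_comm γ]
  have hNN : N ^ (1 / p + 1 / (K : ℝ) + γ * (2 * q) ^ K) =
      N ^ (1 / p) * θ * N ^ (γ * (2 * q) ^ K) := by
    rw [Real.rpow_add hN0, Real.rpow_add hN0]
  calc ∫⁻ ξ, ‖𝓕 f ξ‖ₑ ∂σ = ∫⁻ ξ, ‖∑ i, 𝓕 (g i) ξ‖ₑ ∂σ := by
        refine lintegral_congr fun ξ => ?_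
        rw [← fourier_finsetSum _ (fun i _ => hgI i), hsum]
    _ ≤ ∫⁻ ξ, ∑ i, ‖𝓕 (g i) ξ‖ₑ ∂σ := lintegral_mono fun ξ => enorm_sum_le _ _
    _ = ∑ i, ∫⁻ ξ, ‖𝓕 (g i) ξ‖ₑ ∂σ :=
        lintegral_finsetSum _ fun i _ => (continuous_fourier_of_integrable (hgI i)).measurable.enorm
    _ ≤ ∑ i : Fin K × Fin (⌊θ⌋₊ + 1),
          ENNReal.ofReal (A * ρ K ^ γ) * (3 ^ n * ENNReal.ofReal N ^ (1 / p) * a) :=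
        Finset.sum_le_sum fun i _ => hone i
    _ ≤ ENNReal.ofReal (2 * K * θ) *
          (ENNReal.ofReal (A * ρ K ^ γ) * (3 ^ n * ENNReal.ofReal N ^ (1 / p) * a)) := by
        rw [Finset.sum_const, nsmul_eq_mul, Finset.card_univ]
        gcongr
        rw [← ENNReal.ofReal_natCast]
        exact ENNReal.ofReal_le_ofReal hcount
    _ = _ := by
        have h3 : (3 : ℝ≥0∞) ^ n = ENNReal.ofReal (3 ^ n) := by
          rw [ENNReal.ofReal_pow (by norm_num)]; norm_num
        rw [h3, ENNReal.ofReal_rpow_of_pos hN0, ← ENNReal.ofReal_mul (by positivity), ← mul_assoc,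
          ← mul_assoc, ← ENNReal.ofReal_mul (by positivity), ← ENNReal.ofReal_mul (by positivity),
          hNN, hρK]
        congr 2
        ring

end LevelSets

/-! ### Summation over dyadic mass levels -/

section DyadicSum

variable {n : ℕ} {σ : Measure (Euc n)} {C s p₁ : ℝ}

/-- The estimate `‖f̂‖_{L¹(σ)} ≤ C N^s a` for functions supported in `N` unit cells, with mass at
most `a` in each of them. -/
def CellMassEstimate (σ : Measure (Euc n)) (C s : ℝ) : Prop :=
  ∀ E : Finset (Fin n → ℤ), E.Nonempty → ∀ f : Euc n → ℂ, Integrable f →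
    (∀ x, f x ≠ 0 → cellIndex x ∈ E) → ∀ a : ℝ≥0∞, a ≠ ⊤ →
    (∀ k, ∫⁻ t in cellIndex ⁻¹' {k}, ‖f t‖ₑ ≤ a) →
      ∫⁻ ξ, ‖𝓕 f ξ‖ₑ ∂σ ≤ ENNReal.ofReal (C * (E.card : ℝ) ^ s) * a

theorem two_rpow_natFloor_logb_bounds {x : ℝ} (hx : 1 ≤ x) :
    (2 : ℝ) ^ (⌊Real.logb 2 x⌋₊) ≤ x ∧ x < 2 ^ (⌊Real.logb 2 x⌋₊ + 1) := by
  have hx0 : 0 < x := by linarith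
  have hl : 0 ≤ Real.logb 2 x := Real.logb_nonneg one_lt_two hx
  constructor
  · rw [← Real.rpow_natCast, ← Real.le_logb_iff_rpow_le one_lt_two hx0]
    exact Nat.floor_le hl
  · rw [← Real.rpow_natCast, ← Real.logb_lt_iff_lt_rpow one_lt_two hx0]
    push_cast
    exact Nat.lt_floor_add_one _

theorem sum_geometric_le {r : ℝ} (hr0 : 0 ≤ r) (hr1 : r < 1) (s : Finset ℕ) :
    ∑ m ∈ s, r ^ m ≤ (1 - r)⁻¹ := by
  rw [← tsum_geometric_of_lt_one hr0 hr1]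
  exact (summable_geometric_of_lt_one hr0 hr1).sum_le_tsum s fun _ _ => by positivity

/-- Let B be the ℓ^p₁ norm of b. By Chebyshev's inequality at most 2^((m+1) p₁) cells have b between
B / 2^(m+1) and B / 2^m. Together they contribute at most a multiple of B · 2^(m (p₁ s - 1)), a
geometric series because p₁ s < 1. -/
theorem CellMassEstimate.dyadic_sum (h : CellMassEstimate σ C s) (hC : 0 < C) (hs : 0 ≤ s)
    (hp₁ : 0 < p₁) (hps : p₁ * s < 1) :
    ∃ C' : ℝ, 0 < C' ∧ ∀ (E : Finset (Fin n → ℤ)) (f : Euc n → ℂ), Integrable f →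
      (∀ x, f x ≠ 0 → cellIndex x ∈ E) → ∀ b : (Fin n → ℤ) → ℝ, (∀ k ∈ E, 0 < b k) →
      (∀ k ∈ E, ∫⁻ t in cellIndex ⁻¹' {k}, ‖f t‖ₑ ≤ ENNReal.ofReal (b k)) →
        ∫⁻ ξ, ‖𝓕 f ξ‖ₑ ∂σ ≤ ENNReal.ofReal (C' * (∑ k ∈ E, b k ^ p₁) ^ (1 / p₁)) := by
  classical
  set r : ℝ := 2 ^ (p₁ * s - 1) with hr
  have hr0 : 0 < r := by positivity
  have hr1 : r < 1 := Real.rpow_lt_one_of_one_lt_of_neg one_lt_two (by linarith)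
  refine ⟨C * 2 ^ (p₁ * s) * (1 - r)⁻¹, mul_pos (by positivity) (inv_pos.2 (by linarith)), ?_⟩
  intro E f hf hsupp b hb hfb
  set B : ℝ := (∑ k ∈ E, b k ^ p₁) ^ (1 / p₁) with hB
  have hsum0 : 0 ≤ ∑ k ∈ E, b k ^ p₁ := Finset.sum_nonneg fun k hk => by
    have := hb k hk; positivity
  have hB0 : 0 ≤ B := by positivity
  have hBp : B ^ p₁ = ∑ k ∈ E, b k ^ p₁ := by
    rw [hB, ← Real.rpow_mul hsum0, one_div, inv_mul_cancel₀ hp₁.ne', Real.rpow_one]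
  have hbB : ∀ k ∈ E, b k ≤ B := by
    intro k hk
    have h1 : b k ^ p₁ ≤ B ^ p₁ := by
      rw [hBp]
      exact Finset.single_le_sum (f := fun k => b k ^ p₁)
        (fun l hl => by have := hb l hl; positivity) hk
    exact (Real.rpow_le_rpow_iff (hb k hk).le hB0 hp₁).1 h1
  set L : (Fin n → ℤ) → ℕ := fun k => ⌊Real.logb 2 (B / b k)⌋₊ with hL
  set T : ℕ → Finset (Fin n → ℤ) := fun m => E.filter fun k => L k = m with hT
  have hlev : ∀ m, ∀ k ∈ T m, 0 < B ∧ B < 2 ^ (m + 1) * b k ∧ b k ≤ B * (2 ^ m)⁻¹ := by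
    intro m k hk
    obtain ⟨hkE, hkm⟩ := Finset.mem_filter.1 hk
    have hbk := hb k hkE
    have h1 := two_rpow_natFloor_logb_bounds ((one_le_div hbk).2 (hbB k hkE))
    change (2 : ℝ) ^ (L k) ≤ _ ∧ _ < 2 ^ (L k + 1) at h1
    rw [hkm] at h1
    refine ⟨hbk.trans_le (hbB k hkE), (div_lt_iff₀ hbk).1 h1.2, ?_⟩
    rw [← div_eq_mul_inv, le_div_iff₀ (by positivity), mul_comm]
    exact (le_div_iff₀ hbk).1 h1.1
  have hcard : ∀ m, (T m).Nonempty → ((T m).card : ℝ) ≤ (2 ^ (m + 1)) ^ p₁ := by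
    rintro m ⟨k₀, hk₀⟩
    have hBpos := (hlev m k₀ hk₀).1
    have h1 : ((T m).card : ℝ) * (B / 2 ^ (m + 1)) ^ p₁ ≤ B ^ p₁ := by
      rw [hBp, ← nsmul_eq_mul, ← Finset.sum_const]
      refine (Finset.sum_le_sum fun k hk => ?_).trans
        (Finset.sum_le_sum_of_subset_of_nonneg (Finset.filter_subset _ E)
          fun k hk _ => (Real.rpow_pos_of_pos (hb k hk) p₁).le)
      have h2 := (hlev m k hk).2.1
      refine Real.rpow_le_rpow (by positivity) ?_ hp₁.le
      rw [div_le_iff₀ (by positivity), mul_comm]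
      exact h2.le
    rw [Real.div_rpow hBpos.le (by positivity), mul_div_assoc', div_le_iff₀ (by positivity),
      mul_comm (B ^ p₁)] at h1
    exact le_of_mul_le_mul_right h1 (by positivity)
  set J : Finset ℕ := E.image L with hJ
  have hTne : ∀ m ∈ J, (T m).Nonempty := by
    intro m hm
    obtain ⟨k, hk, hkm⟩ := Finset.mem_image.1 hm
    exact ⟨k, Finset.mem_filter.2 ⟨hk, hkm⟩⟩
  set g : ℕ → Euc n → ℂ := fun m => (cellIndex ⁻¹' (T m)).indicator f with hg
  have hgI : ∀ m, Integrable (g m) := fun i => hf.indicator (measurableSet_preimage_cellIndex _)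
  have hsum : (fun v => ∑ m ∈ J, g m v) = f := by
    funext v
    by_cases hv : f v = 0
    · rw [hv]
      refine Finset.sum_eq_zero fun i _ => ?_
      simp only [hg, Set.indicator_apply, hv, ite_self]
    · have hvE := hsupp v hv
      rw [Finset.sum_eq_single (L (cellIndex v))]
      · simp only [hg]
        rw [Set.indicator_of_mem]
        simp [hT, hvE]
      · intro i _ hi
        simp only [hg]
        rw [Set.indicator_of_notMem]
        intro h
        exact hi (Finset.mem_filter.1 h).2.symm
      · intro h; exact absurd (Finset.mem_image_of_mem L hvE) h
  have hone : ∀ m ∈ J, ∫⁻ ξ, ‖𝓕 (g m) ξ‖ₑ ∂σ ≤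
      ENNReal.ofReal (C * 2 ^ (p₁ * s) * B * r ^ m) := by
    intro m hm
    refine (h (T m) (hTne m hm) (g m) (hgI m) ?_ (ENNReal.ofReal (B * (2 ^ m)⁻¹))
      ENNReal.ofReal_ne_top ?_).trans ?_
    · intro x hx
      have hx' : x ∈ cellIndex ⁻¹' (T m : Set (Fin n → ℤ)) := Set.mem_of_indicator_ne_zero hx
      exact hx'
    · intro k
      by_cases hk : k ∈ T m
      · refine (lintegral_mono fun t => enorm_indicator_le_enorm_self _ _).trans
          ((hfb k (Finset.mem_filter.1 hk).1).trans ?_)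
        exact ENNReal.ofReal_le_ofReal (hlev m k hk).2.2
      · refine le_of_eq_of_le ?_ zero_le
        rw [setLIntegral_congr_fun (g := fun _ => 0) (measurableSet_preimage_cellIndex _)]
        · simp
        · intro t ht
          simp only [hg]
          rw [Set.indicator_of_notMem, enorm_zero]
          intro h
          have : cellIndex t = k := ht
          exact hk (this ▸ h)
    · rw [← ENNReal.ofReal_mul (by positivity)]
      refine ENNReal.ofReal_le_ofReal ?_
      have h1 : ((T m).card : ℝ) ^ s ≤ 2 ^ (p₁ * s) * (2 ^ (p₁ * s)) ^ m := by
        calc ((T m).card : ℝ) ^ s ≤ ((2 ^ (m + 1)) ^ p₁) ^ s :=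
              Real.rpow_le_rpow (by positivity) (hcard m (hTne m hm)) hs
          _ = 2 ^ (p₁ * s) * (2 ^ (p₁ * s)) ^ m := by
              rw [← Real.rpow_mul (by positivity), ← pow_succ', ← Real.rpow_natCast,
                ← Real.rpow_natCast, ← Real.rpow_mul zero_le_two, ← Real.rpow_mul zero_le_two,
                mul_comm]
      have h2 : r ^ m = (2 ^ (p₁ * s)) ^ m * (2 ^ m)⁻¹ := by
        rw [hr, Real.rpow_sub_one two_ne_zero, div_pow, div_eq_mul_inv]
      rw [h2]
      calc C * ((T m).card : ℝ) ^ s * (B * (2 ^ m)⁻¹)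
          ≤ C * (2 ^ (p₁ * s) * (2 ^ (p₁ * s)) ^ m) * (B * (2 ^ m)⁻¹) := by gcongr
        _ = _ := by ring
  calc ∫⁻ ξ, ‖𝓕 f ξ‖ₑ ∂σ = ∫⁻ ξ, ‖∑ m ∈ J, 𝓕 (g m) ξ‖ₑ ∂σ := by
        refine lintegral_congr fun ξ => ?_
        rw [← fourier_finsetSum _ (fun i _ => hgI i), hsum]
    _ ≤ ∫⁻ ξ, ∑ m ∈ J, ‖𝓕 (g m) ξ‖ₑ ∂σ := lintegral_mono fun ξ => enorm_sum_le _ _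
    _ = ∑ m ∈ J, ∫⁻ ξ, ‖𝓕 (g m) ξ‖ₑ ∂σ :=
        lintegral_finsetSum _ fun i _ => (continuous_fourier_of_integrable (hgI i)).measurable.enorm
    _ ≤ ∑ m ∈ J, ENNReal.ofReal (C * 2 ^ (p₁ * s) * B * r ^ m) := Finset.sum_le_sum hone
    _ = ENNReal.ofReal (C * 2 ^ (p₁ * s) * B * ∑ m ∈ J, r ^ m) := by
        rw [← ENNReal.ofReal_sum_of_nonneg fun _ _ => by positivity, Finset.mul_sum]
    _ ≤ ENNReal.ofReal (C * 2 ^ (p₁ * s) * B * (1 - r)⁻¹) := by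
        have := sum_geometric_le hr0.le hr1 J
        exact ENNReal.ofReal_le_ofReal (by gcongr)
    _ = _ := by congr 1; ring

theorem volume_preimage_cellIndex_singleton (k : Fin n → ℤ) :
    volume (cellIndex (n := n) ⁻¹' {k}) = 1 := by
  have h : cellIndex (n := n) ⁻¹' {k} = WithLp.ofLp ⁻¹'
      (Set.univ.pi fun i => Set.Ico (k i : ℝ) (k i + 1)) := by
    ext x
    simp only [Set.mem_preimage, Set.mem_singleton_iff, cellIndex, funext_iff, Set.mem_pi,
      Set.mem_univ, true_implies, Set.mem_Ico, Int.floor_eq_iff]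
  rw [h, (PiLp.volume_preserving_ofLp (Fin n)).measure_preimage
    (MeasurableSet.univ_pi fun i => measurableSet_Ico).nullMeasurableSet, Real.volume_pi_Ico]
  simp

/-- By Hölder's inequality, the `ℓ^{p₁}` norm of the masses of `f` in the unit cells is bounded by
its `L^{p₁}` norm. -/
theorem sum_lintegral_cell_rpow_le (hp₁ : 1 ≤ p₁) {f : Euc n → ℂ} (hf : AEStronglyMeasurable f)
    (E : Finset (Fin n → ℤ)) :
    ∑ k ∈ E, (∫⁻ t in cellIndex ⁻¹' {k}, ‖f t‖ₑ) ^ p₁ ≤ eLpNorm f (ENNReal.ofReal p₁) volume ^ p₁ := by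
  have hp0 : 0 < p₁ := by linarith
  have hone : ∀ k : Fin n → ℤ, (∫⁻ t in cellIndex ⁻¹' {k}, ‖f t‖ₑ) ^ p₁ ≤
      ∫⁻ t in cellIndex ⁻¹' {k}, ‖f t‖ₑ ^ p₁ := by
    intro k
    have : IsProbabilityMeasure (volume.restrict (cellIndex (n := n) ⁻¹' {k})) :=
      ⟨by rw [Measure.restrict_apply_univ, volume_preimage_cellIndex_singleton]⟩
    rw [← eLpNorm_rpow_eq_lintegral hp0, ← eLpNorm_one_eq_lintegral_enorm]
    refine ENNReal.rpow_le_rpow ?_ hp0.le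
    exact eLpNorm_le_eLpNorm_of_exponent_le (by rwa [ENNReal.one_le_ofReal]) hf.restrict
  calc _ ≤ ∑ k ∈ E, ∫⁻ t in cellIndex ⁻¹' {k}, ‖f t‖ₑ ^ p₁ := Finset.sum_le_sum fun k _ => hone k
    _ = ∫⁻ t in ⋃ k ∈ E, cellIndex ⁻¹' {k}, ‖f t‖ₑ ^ p₁ := by
        rw [lintegral_biUnion_finset]
        · intro k _ l _ hkl
          exact (Set.disjoint_singleton.2 hkl).preimage _
        · exact fun k _ => measurableSet_preimage_cellIndex _
    _ ≤ ∫⁻ t, ‖f t‖ₑ ^ p₁ := setLIntegral_le_lintegral _ _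
    _ = _ := (eLpNorm_rpow_eq_lintegral hp0 f).symm

theorem CellMassEstimate.of_finite_support (h : CellMassEstimate σ C s) (hC : 0 < C) (hs : 0 ≤ s)
    (hp₁ : 1 ≤ p₁) (hps : p₁ * s < 1) :
    ∃ C' : ℝ, 0 < C' ∧ ∀ (E : Finset (Fin n → ℤ)) (f : Euc n → ℂ), Integrable f →
      MemLp f (ENNReal.ofReal p₁) → (∀ x, f x ≠ 0 → cellIndex x ∈ E) →
        ∫⁻ ξ, ‖𝓕 f ξ‖ₑ ∂σ ≤ ENNReal.ofReal C' * eLpNorm f (ENNReal.ofReal p₁) volume := by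
  classical
  have hp0 : 0 < p₁ := by linarith
  obtain ⟨C', hC', hdy⟩ := h.dyadic_sum hC hs hp0 hps
  refine ⟨C', hC', fun E f hf hfp hsupp => ?_⟩
  set μ : (Fin n → ℤ) → ℝ≥0∞ := fun k => ∫⁻ t in cellIndex ⁻¹' {k}, ‖f t‖ₑ with hμ
  have hμtop : ∀ k, μ k ≠ ⊤ := fun k =>
    ((setLIntegral_le_lintegral _ _).trans_lt hf.hasFiniteIntegral).ne
  -- The dyadic decomposition takes logarithms and needs positive masses. On cells of mass zero f
  -- vanishes almost everywhere, so these are removed without changing its transform.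
  set T : Finset (Fin n → ℤ) := E.filter fun k => μ k ≠ 0 with hT
  set g : Euc n → ℂ := (cellIndex ⁻¹' (T : Set (Fin n → ℤ))).indicator f with hg
  have hgI : Integrable g := hf.indicator (measurableSet_preimage_cellIndex _)
  have hae : f =ᵐ[volume] g := by
    set u : Euc n → ℂ := (cellIndex ⁻¹' (T : Set (Fin n → ℤ))ᶜ).indicator f with hu
    have h0 : ∫⁻ t, ‖u t‖ₑ = 0 := by
      have h1 := lintegral_le_of_cell_le (T := E) (f := u) (a := 0) ?_ ?_
      · simpa using h1
      · intro x hx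
        refine hsupp x fun h0 => hx ?_
        simp only [hu, Set.indicator_apply, h0, ite_self]
      · intro k
        by_cases hk : k ∈ E ∧ μ k = 0
        · exact (lintegral_mono fun t => enorm_indicator_le_enorm_self _ _).trans hk.2.le
        · refine le_of_eq ?_
          rw [setLIntegral_congr_fun (g := fun _ => 0) (measurableSet_preimage_cellIndex _)]
          · simp
          · intro t ht
            have htk : cellIndex t = k := ht
            simp only [enorm_eq_zero]
            by_cases hft : f t = 0
            · simp only [hu, Set.indicator_apply, hft, ite_self]
            · refine Set.indicator_of_notMem (Set.notMem_compl_iff.2 ?_) _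
              change cellIndex t ∈ T
              have hkE := hsupp t hft
              rw [htk] at hkE ⊢
              exact Finset.mem_filter.2 ⟨hkE, fun h0 => hk ⟨hkE, h0⟩⟩
    have huI : Integrable u := hf.indicator (measurableSet_preimage_cellIndex _)
    rw [lintegral_eq_zero_iff' huI.aestronglyMeasurable.enorm] at h0
    filter_upwards [h0] with t ht
    have hut : u t = 0 := by simpa using ht
    by_cases htT : t ∈ cellIndex ⁻¹' (T : Set (Fin n → ℤ))
    · rw [hg, Set.indicator_of_mem htT]
    · rw [hg, Set.indicator_of_notMem htT]
      rwa [hu, Set.indicator_of_mem (by exact htT)] at hut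
  have hfg : 𝓕 f = 𝓕 g := by
    funext ξ
    rw [Real.fourier_eq, Real.fourier_eq]
    refine integral_congr_ae ?_
    filter_upwards [hae] with t ht
    rw [ht]
  rw [hfg]
  refine (hdy T g hgI ?_ (fun k => (μ k).toReal) ?_ ?_).trans ?_
  · intro x hx
    have hx' : x ∈ cellIndex ⁻¹' (T : Set (Fin n → ℤ)) := Set.mem_of_indicator_ne_zero hx
    exact hx'
  · intro k hk
    exact ENNReal.toReal_pos (Finset.mem_filter.1 hk).2 (hμtop k)
  · intro k _
    rw [ENNReal.ofReal_toReal (hμtop k)]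
    exact lintegral_mono fun t => enorm_indicator_le_enorm_self _ _
  · rw [ENNReal.ofReal_mul hC'.le]
    refine mul_le_mul_right ?_ _
    have h1 := sum_lintegral_cell_rpow_le hp₁ hfp.1 T
    have h2 : ENNReal.ofReal (∑ k ∈ T, (μ k).toReal ^ p₁) = ∑ k ∈ T, μ k ^ p₁ := by
      rw [ENNReal.ofReal_sum_of_nonneg fun _ _ => by positivity]
      refine Finset.sum_congr rfl fun k _ => ?_
      rw [← ENNReal.ofReal_rpow_of_nonneg ENNReal.toReal_nonneg hp0.le,
        ENNReal.ofReal_toReal (hμtop k)]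
    rw [← ENNReal.ofReal_rpow_of_nonneg (Finset.sum_nonneg fun _ _ => by positivity)
      (by positivity), h2]
    calc _ ≤ (eLpNorm f (ENNReal.ofReal p₁) volume ^ p₁) ^ (1 / p₁) :=
          ENNReal.rpow_le_rpow h1 (by positivity)
      _ = _ := by
          rw [← ENNReal.rpow_mul, one_div, mul_inv_cancel₀ hp0.ne', ENNReal.rpow_one]

end DyadicSum

/-! ### The global estimate -/

section GlobalEstimate

variable {n : ℕ} {σ : Measure (Euc n)} {p₁ A : ℝ}

theorem tendsto_fourier_indicator {f : Euc n → ℂ} (hf : Integrable f) {s : ℕ → Set (Euc n)}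
    (hs : ∀ m, MeasurableSet (s m)) (hev : ∀ x, ∀ᶠ m in atTop, x ∈ s m) (ξ : Euc n) :
    Tendsto (fun m => 𝓕 ((s m).indicator f) ξ) atTop (𝓝 (𝓕 f ξ)) := by
  simp only [Real.fourier_eq]
  refine tendsto_integral_of_dominated_convergence (fun v => ‖f v‖) (fun m => ?_) hf.norm
    (fun m => ?_) ?_
  · exact ((Real.fourierIntegral_convergent_iff ξ).2 (hf.indicator (hs m))).aestronglyMeasurable
  · refine Eventually.of_forall fun v => ?_
    rw [Circle.norm_smul]
    exact norm_indicator_le_norm_self _ _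
  · refine Eventually.of_forall fun v => tendsto_const_nhds.congr' ?_
    filter_upwards [hev v] with m hm
    rw [Set.indicator_of_mem hm]

/-- The function is truncated to growing boxes of cells. Its integrability makes the transforms
converge pointwise, and Fatou's lemma carries the uniform bound to the limit. -/
theorem lintegral_fourier_le_of_finite_support {c : ℝ≥0∞}
    (h : ∀ (E : Finset (Fin n → ℤ)) (f : Euc n → ℂ), Integrable f →
      MemLp f (ENNReal.ofReal p₁) → (∀ x, f x ≠ 0 → cellIndex x ∈ E) →
        ∫⁻ ξ, ‖𝓕 f ξ‖ₑ ∂σ ≤ c * eLpNorm f (ENNReal.ofReal p₁) volume)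
    {f : Euc n → ℂ} (hf : Integrable f) (hfp : MemLp f (ENNReal.ofReal p₁)) :
    ∫⁻ ξ, ‖𝓕 f ξ‖ₑ ∂σ ≤ c * eLpNorm f (ENNReal.ofReal p₁) volume := by
  set E : ℕ → Finset (Fin n → ℤ) := fun m =>
    Fintype.piFinset fun _ => Finset.Icc (-(m : ℤ)) m with hE
  set t : ℕ → Set (Euc n) := fun m => cellIndex ⁻¹' (E m) with ht
  have htm : ∀ m, MeasurableSet (t m) := fun m => measurableSet_preimage_cellIndex _
  have hev : ∀ x, ∀ᶠ m in atTop, x ∈ t m := by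
    intro x
    filter_upwards [eventually_ge_atTop (∑ i, (cellIndex x i).natAbs)] with m hm
    change cellIndex x ∈ E m
    rw [hE, Fintype.mem_piFinset]
    intro i
    have h1 : (cellIndex x i).natAbs ≤ ∑ i, (cellIndex x i).natAbs :=
      Finset.single_le_sum (f := fun i => (cellIndex x i).natAbs) (fun _ _ => zero_le)
        (Finset.mem_univ i)
    rw [Finset.mem_Icc]
    omega
  have hb : ∀ m, ∫⁻ ξ, ‖𝓕 ((t m).indicator f) ξ‖ₑ ∂σ ≤
      c * eLpNorm f (ENNReal.ofReal p₁) volume := by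
    intro m
    refine (h (E m) _ (hf.indicator (htm m)) (hfp.indicator (htm m)) ?_).trans ?_
    · intro x hx
      have hx' : x ∈ t m := Set.mem_of_indicator_ne_zero hx
      exact hx'
    · exact mul_le_mul_right (eLpNorm_indicator_le f) _
  calc ∫⁻ ξ, ‖𝓕 f ξ‖ₑ ∂σ = ∫⁻ ξ, liminf (fun m => ‖𝓕 ((t m).indicator f) ξ‖ₑ) atTop ∂σ :=
        lintegral_congr fun ξ => ((tendsto_fourier_indicator hf htm hev ξ).enorm).liminf_eq.symm
    _ ≤ liminf (fun m => ∫⁻ ξ, ‖𝓕 ((t m).indicator f) ξ‖ₑ ∂σ) atTop :=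
        lintegral_liminf_le fun m =>
          (continuous_fourier_of_integrable (hf.indicator (htm m))).measurable.enorm
    _ ≤ _ := liminf_le_of_le (by isBoundedDefault) fun b hbb => by
        obtain ⟨m, hm⟩ := hbb.exists
        exact hm.trans (hb m)

/-- An a priori estimate on `L¹ ∩ L^{p₁}` extends to `L^{p₁}`. -/
theorem globalRestrictionEstimate_of_integrable {S : Set (Euc n)} (hp₁ : 1 ≤ p₁) (hA : 0 < A)
    (h : ∀ f : Euc n → ℂ, Integrable f → MemLp f (ENNReal.ofReal p₁) →
      ∫⁻ ξ, ‖𝓕 f ξ‖ₑ ∂(surfaceMeasure S) ≤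
        ENNReal.ofReal A * eLpNorm f (ENNReal.ofReal p₁) volume) :
    GlobalRestrictionEstimate S p₁ := by
  set q : ℝ≥0∞ := ENNReal.ofReal p₁ with hq
  have hq1 : 1 ≤ q := by rwa [hq, ENNReal.one_le_ofReal]
  have hqtop : q ≠ ⊤ := ENNReal.ofReal_ne_top
  set c : ℝ≥0∞ := ENNReal.ofReal A with hc
  have hctop : c ≠ ⊤ := ENNReal.ofReal_ne_top
  set σ := surfaceMeasure S with hσ
  have hle : ∀ f : Euc n → ℂ, Integrable f → MemLp f q → eLpNorm (𝓕 f) 1 σ ≤ c * eLpNorm f q := by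
    intro f hf hfq
    rw [eLpNorm_one_eq_lintegral_enorm]
    exact h f hf hfq
  have hsub : ∀ f g : Euc n → ℂ, Integrable f → MemLp f q → Integrable g → MemLp g q →
      eLpNorm (𝓕 f - 𝓕 g) 1 σ ≤ c * eLpNorm (f - g) q := by
    intro f g hf hfq hg hgq
    have h1 : 𝓕 f - 𝓕 g = 𝓕 (f - g) := by
      funext ξ
      rw [Pi.sub_apply, fourier_sub_apply hf hg]
    rw [h1]
    exact hle _ (hf.sub hg) (hfq.sub hgq)
  have hmeas : ∀ f : Euc n → ℂ, Integrable f → AEStronglyMeasurable (𝓕 f) σ := fun f hf =>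
    (continuous_fourier_of_integrable hf).aestronglyMeasurable
  refine ⟨A, hA, fun f hf => ?_⟩
  -- Approximants in L¹ ∩ L^q converging at a geometric rate, so that their transforms form a
  -- summably Cauchy sequence in L¹(σ), whose limit is the restriction.
  have happ : ∀ k : ℕ, ∃ g : Euc n → ℂ, eLpNorm (f - g) q volume ≤ 2⁻¹ ^ k ∧ Integrable g ∧
      MemLp g q := by
    intro k
    obtain ⟨g, hgs, hg, hgc, hgq⟩ := hf.exists_hasCompactSupport_eLpNorm_sub_le hqtop
      (ε := 2⁻¹ ^ k) (pow_ne_zero _ (by simp))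
    exact ⟨g, hg, hgc.integrable_of_hasCompactSupport hgs, hgq⟩
  choose u hu huI huq using happ
  have hdist : ∀ v : Euc n → ℂ, MemLp v q → ∀ k,
      eLpNorm (v - u k) q ≤ eLpNorm (v - f) q + 2⁻¹ ^ k := by
    intro v hv k
    have h1 : v - u k = (v - f) + (f - u k) := by abel
    rw [h1]
    exact (eLpNorm_add_le (hv.sub hf).1 (hf.sub (huq k)).1 hq1).trans (by gcongr; exact hu k)
  obtain ⟨g, hgL, hg⟩ := Lp.cauchy_complete_eLpNorm (μ := σ) (p := 1) (f := fun k => 𝓕 (u k))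
    le_rfl (fun k => ⟨hmeas _ (huI k), (hle _ (huI k) (huq k)).trans_lt
      (ENNReal.mul_lt_top hctop.lt_top (huq k).2)⟩)
    -- Two approximants beyond index k differ by at most 2 · 2^(-k); the extra 1 provides the strict
    -- inequality required by `Lp.cauchy_complete_eLpNorm`.
    (B := fun k => (c * 2 + 1) * 2⁻¹ ^ k) (by
      rw [ENNReal.tsum_mul_left, ENNReal.tsum_geometric]
      refine ENNReal.mul_ne_top (by finiteness) ?_
      simp) (by
      intro N k l hk hl
      have h1 : ∀ m, N ≤ m → (2⁻¹ : ℝ≥0∞) ^ m ≤ 2⁻¹ ^ N := fun m hm =>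
        pow_le_pow_of_le_one zero_le (by simp) hm
      have h2 : eLpNorm (u k - u l) q ≤ 2⁻¹ ^ N + 2⁻¹ ^ N := by
        refine (hdist _ (huq k) l).trans (add_le_add ?_ (h1 l hl))
        rw [eLpNorm_sub_comm]
        exact (hu k).trans (h1 k hk)
      have h0 : (2⁻¹ : ℝ≥0∞) ^ N ≠ 0 := pow_ne_zero _ (by simp)
      have ht : (2⁻¹ : ℝ≥0∞) ^ N ≠ ⊤ := ENNReal.pow_ne_top (by simp)
      calc eLpNorm (𝓕 (u k) - 𝓕 (u l)) 1 σ ≤ c * (2⁻¹ ^ N + 2⁻¹ ^ N) :=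
            (hsub _ _ (huI k) (huq k) (huI l) (huq l)).trans (mul_le_mul_right h2 _)
        _ < c * (2⁻¹ ^ N + 2⁻¹ ^ N) + 2⁻¹ ^ N :=
            ENNReal.lt_add_right (ENNReal.mul_ne_top hctop (ENNReal.add_ne_top.2 ⟨ht, ht⟩)) h0
        _ = (c * 2 + 1) * 2⁻¹ ^ N := by ring)
  have hpow : Tendsto (fun k : ℕ => (2⁻¹ : ℝ≥0∞) ^ k) atTop (𝓝 0) :=
    ENNReal.tendsto_pow_atTop_nhds_zero_of_lt_one (by simp)
  refine ⟨g, ⟨hgL, fun v hvI hvq hv => ?_⟩, ?_⟩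
  -- An arbitrary approximating sequence is compared with the chosen one at the same index, which
  -- shows that the limit does not depend on the sequence.
  · have hlim : Tendsto (fun k => c * (eLpNorm (v k - f) q + 2⁻¹ ^ k) +
        eLpNorm (𝓕 (u k) - g) 1 σ) atTop (𝓝 0) := by
      have := (ENNReal.Tendsto.const_mul (hv.add hpow) (Or.inr hctop)).add hg
      simpa using this
    refine tendsto_of_tendsto_of_tendsto_of_le_of_le tendsto_const_nhds hlim
      (fun k => zero_le) fun k => ?_
    have h1 : 𝓕 (v k) - g = (𝓕 (v k) - 𝓕 (u k)) + (𝓕 (u k) - g) := by abel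
    simp only
    rw [h1]
    refine (eLpNorm_add_le ((hmeas _ (hvI k)).sub (hmeas _ (huI k)))
      ((hmeas _ (huI k)).sub hgL.1) le_rfl).trans (add_le_add ?_ le_rfl)
    exact (hsub _ _ (hvI k) (hvq k) (huI k) (huq k)).trans
      (mul_le_mul_right (hdist _ (hvq k) k) _)
  · have hlim : Tendsto (fun k => eLpNorm (𝓕 (u k) - g) 1 σ + c * (eLpNorm f q volume + 2⁻¹ ^ k))
        atTop (𝓝 (c * eLpNorm f q volume)) := by
      have := hg.add (ENNReal.Tendsto.const_mul
        ((tendsto_const_nhds (x := eLpNorm f q volume)).add hpow) (Or.inr hctop))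
      simpa using this
    refine ge_of_tendsto' hlim fun k => ?_
    have h1 : g = (g - 𝓕 (u k)) + 𝓕 (u k) := by abel
    have h2 : u k = f + (u k - f) := by abel
    have h3 : eLpNorm (u k) q volume ≤ eLpNorm f q volume + 2⁻¹ ^ k := by
      conv_lhs => rw [h2]
      refine (eLpNorm_add_le hf.1 ((huq k).sub hf).1 hq1).trans (add_le_add le_rfl ?_)
      rw [eLpNorm_sub_comm]
      exact hu k
    conv_lhs => rw [h1]
    refine (eLpNorm_add_le (hgL.1.sub (hmeas _ (huI k))) (hmeas _ (huI k)) le_rfl).trans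
      (add_le_add (eLpNorm_sub_comm _ _ _ _).le ?_)
    exact (hle _ (huI k) (huq k)).trans (mul_le_mul_right h3 _)

end GlobalEstimate

/-! ### Choice of the number of scales, and conclusion. -/

/-- The number of scales can be chosen so that the exponent of the cell estimate exceeds `1 / p`
by at most a multiple of `1 / log (1 / γ)`. -/
theorem exists_number_of_scales {D γ : ℝ} (hD : 1 < D) (hγ : 0 < γ)
    (hγD : 2 * Real.log D < Real.log (1 / γ)) :
    ∃ K : ℕ, 1 ≤ K ∧ 1 / K + γ * D ^ K ≤ (4 * Real.log D + 2) / Real.log (1 / γ) := by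
  set x := Real.log (1 / γ) with hx
  have hlD : 0 < Real.log D := Real.log_pos hD
  have hx0 : 0 < x := by linarith
  have hγx : γ = Real.exp (-x) := by
    rw [hx, one_div, Real.log_inv, neg_neg, Real.exp_log hγ]
  -- For this t one has D^t = γ^(-1/2), so with K = ⌊t⌋ the second term is at most γ^(1/2) =
  -- e^(-x/2) ≤ 2 / x. As t ≥ 1 gives K ≥ t / 2, the first term is at most 4 log D / x.
  set t := x / (2 * Real.log D) with ht
  have ht1 : 1 ≤ t := (one_le_div (by positivity)).2 hγD.le
  have hK1 : 1 ≤ ⌊t⌋₊ := Nat.le_floor (by exact_mod_cast ht1)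
  have hK1' : (1 : ℝ) ≤ ⌊t⌋₊ := by exact_mod_cast hK1
  have hKt : (⌊t⌋₊ : ℝ) ≤ t := Nat.floor_le (by linarith)
  have htK : t < ⌊t⌋₊ + 1 := Nat.lt_floor_add_one t
  refine ⟨⌊t⌋₊, hK1, ?_⟩
  have h1 : 1 / (⌊t⌋₊ : ℝ) ≤ 4 * Real.log D / x := by
    have h2 : t / 2 ≤ ⌊t⌋₊ := by linarith
    calc 1 / (⌊t⌋₊ : ℝ) ≤ 1 / (t / 2) := one_div_le_one_div_of_le (by linarith) h2
      _ = 4 * Real.log D / x := by rw [ht]; field_simp; norm_num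
  have h3 : γ * D ^ ⌊t⌋₊ ≤ 2 / x := by
    have h4 : D ^ ⌊t⌋₊ ≤ Real.exp (x / 2) := by
      rw [← Real.exp_log (by linarith : 0 < D), ← Real.exp_nat_mul,
        Real.exp_le_exp]
      have := (le_div_iff₀ (by positivity)).1 hKt
      linarith
    calc γ * D ^ ⌊t⌋₊ ≤ Real.exp (-x) * Real.exp (x / 2) := by rw [← hγx]; gcongr
      _ = (Real.exp (x / 2))⁻¹ := by rw [← Real.exp_add, ← Real.exp_neg]; congr 1; ring
      _ ≤ (x / 2)⁻¹ := inv_anti₀ (by linarith) (by linarith [Real.add_one_le_exp (x / 2)])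
      _ = 2 / x := by rw [inv_div]
  rw [add_div]
  exact add_le_add h1 h3

theorem lemmaA1 (n : ℕ) (hn : 2 ≤ n) :
    ∃ C : ℝ, 0 < C ∧
      ∀ S : Set (Euc n), IsCompactPosDefHypersurface S →
        ∀ p γ : ℝ, 1 < p → p < 2 → 0 < γ → γ < 1 →
          LocalRestrictionEstimate S p γ →
            ∀ p₁ : ℝ, 1 ≤ p₁ → 1 / p + C / Real.log (1 / γ) < 1 / p₁ →
              GlobalRestrictionEstimate S p₁ := by
  obtain ⟨e, rfl⟩ : ∃ e, n = e + 2 := ⟨n - 2, by omega⟩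
  -- This is the factor 2q by which the exponents of successive radii grow, with q = 2e + 6 the
  -- sparseness exponent. It depends only on the dimension, and hence so does C.
  set D : ℝ := 2 * ((2 * e + 6 : ℕ) : ℝ) with hD
  have hD1 : 1 < D := by
    rw [hD]; push_cast; linarith [(Nat.cast_nonneg e : (0 : ℝ) ≤ e)]
  have hlD : 0 < Real.log D := Real.log_pos hD1
  refine ⟨4 * Real.log D + 2, by positivity, ?_⟩
  intro S hS p γ hp hp2 hγ hγ1 hloc p₁ hp₁ hlt
  have hp0 : 0 < p := by linarith
  have hp₁0 : 0 < p₁ := by linarith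
  have hx0 : 0 < Real.log (1 / γ) := Real.log_pos ((one_lt_div hγ).2 hγ1)
  -- The condition on p₁ forces γ to be small: since 1 / p₁ ≤ 1, it can hold only if C / log(1/γ) <
  -- 1. This leaves room for at least one scale.
  have hγD : 2 * Real.log D < Real.log (1 / γ) := by
    have h1 : (4 * Real.log D + 2) / Real.log (1 / γ) < 1 := by
      have h2 : 1 / p₁ ≤ 1 := (div_le_one hp₁0).2 hp₁
      have h3 : 0 < 1 / p := by positivity
      linarith
    rw [div_lt_one hx0] at h1
    linarith
  obtain ⟨K, hK, hKle⟩ := exists_number_of_scales hD1 hγ hγD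
  obtain ⟨C₁, A, ε, hC₁, hA, -, hε, hsp⟩ := exists_sparseMassEstimate hS hp hp2 hγ hloc
  obtain ⟨C₂, hC₂, hcell⟩ := hsp.level_set hp hC₁ hA hε hγ.le (by omega) (by omega) hK
  have hcell' : CellMassEstimate (surfaceMeasure S) C₂ (1 / p + 1 / K + γ * D ^ K) := hcell
  have hs : p₁ * (1 / p + 1 / K + γ * D ^ K) < 1 := by
    rw [mul_comm, ← lt_div_iff₀ hp₁0]
    linarith
  obtain ⟨C₃, hC₃, hfin⟩ := hcell'.of_finite_support hC₂ (by positivity) hp₁ hs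
  exact globalRestrictionEstimate_of_integrable hp₁ hC₃ fun f hf hfp =>
    lintegral_fourier_le_of_finite_support hfin hf hfp
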